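/- Let $D$ be a knot diagram on the oriented sphere $\mathbb S^2$, with underlying immersed circle $P$, and let $m=C(D)$ be its number of crossings. Let $\mathcal R$ be the set of connected components of $\mathbb S^2\setminus N(P)$, where $N(P)$ is a regular neighbourhood of $P$. For $S\subseteq\mathcal R$ let $F(S)=\mathbb S^2\setminus\bigcup_{R\in S}R$ be the punctured sphere obtained by removing the open disks in $S$, and let $c(D,S)$ be the minimal number of crossings of a knot diagram on $F(S)$ obtained from $D$ by finitely many Reidemeister moves (and isotopies) performed on $F(S)$. Let $c(D)$ be the minimal number of crossings of a knot diagram obtained from $D$ by Reidemeister moves on $\mathbb S^2$. For $0\le n\le m+2$ let $c_{\max}(D,n)$ and $c_{\min}(D,n)$ be the maximum and the minimum of $c(D,S)$ over all $S\subseteq\mathcal R$ with $|S|=n$. (Diagrams are described by their combinatorial maps on the sphere with crossing information, together with the positions of the labelled punctures, that is, up to orientation-preserving homeomorphism.) Then $|\mathcal R|=m+2$, and: 1. $c_{\max}(D,n)\le c_{\max}(D,n+1)$ and $c_{\min}(D,n)\le c_{\min}(D,n+1)$ for $0\le n<m+2$; 2. $c_{\min}(D,n)\le c_{\max}(D,n)$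 for $0\le n\le m+2$; 3. $c_{\max}(D,0)=c_{\max}(D,1)$ and $c_{\min}(D,0)=c_{\min}(D,1)=c_{\min}(D,2)$; 4. $c_{\max}(D,0)=c_{\min}(D,0)=c(D)$ and $c_{\max}(D,m+2)=c_{\min}(D,m+2)=C(D)$. -/

import Mathlib

/-!
# Knot diagrams on the sphere and on punctured spheres

A knot diagram on the oriented sphere, taken up to orientation-preserving homeomorphism, is
recorded by its combinatorial map (rotation system).  The underlying curve, a generic immersion of
one circle, is a connected graph embedded in the sphere.  Its vertices are the crossings (four
half-edges each) together with finitely many auxiliary points chosen on the curve (two half-edges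
each).  Auxiliary points carry no information: they may be inserted and erased freely.  They are
there so that the embedded circle without crossings is on the same footing as all other diagrams.

A half-edge is called a dart; it points away from its vertex.
-/

/-- The set of orbits (cycles, including fixed points) of a permutation. -/
abbrev Orbits {α : Type} (f : Equiv.Perm α) : Type :=
  Quotient (Equiv.Perm.SameCycle.setoid f)

/-- A knot diagram on the oriented sphere. -/
structure KnotDiagram where
  /-- The half-edges of the curve. -/
  Dart : Type
  finite : Finite Dart
  nonempty : Nonempty Dart
  /-- The next dart, counterclockwise, at the same vertex. -/
  rot : Equiv.Perm Dart
  /-- The other half of the same edge. -/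
  flip : Equiv.Perm Dart
  /-- Whether the strand through a dart at a crossing is the upper one.
  The value at an auxiliary point is irrelevant. -/
  upper : Dart → Bool
  /-- Every vertex has two or four darts: the next two fields say that the orbits of `rot` have
  two or four elements. -/
  rot_ne : ∀ h, rot h ≠ h
  rot_four : ∀ h, rot (rot (rot (rot h))) = h
  flip_ne : ∀ h, flip h ≠ h
  flip_flip : ∀ h, flip (flip h) = h
  /-- At a crossing one strand is over and the other one is under. -/
  upper_rot : ∀ h, rot (rot h) ≠ h → upper (rot h) = !upper h
  /-- The curve is one closed curve: going along edges and straight on at vertices, one gets from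
  any dart to any other dart. -/
  one_component : ∀ h k, Relation.ReflTransGen
    (fun a b => b = flip a ∨ (rot (rot a) = a ∧ b = rot a) ∨
      (rot (rot a) ≠ a ∧ b = rot (rot a))) h k
  /-- The surface is the sphere: (vertices) - (edges) + (faces) = 2.  The faces are the orbits of
  the map that walks along a dart and then takes the next dart of the face on its left. -/
  euler : (Nat.card (Orbits rot) : ℤ) - Nat.card (Orbits flip)
    + Nat.card (Orbits (rot⁻¹ * flip)) = 2

namespace KnotDiagram

/-- From a dart, walk along its edge, keeping the region on the left, and turn into the next dart
on the boundary of that region. -/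
def faceStep (D : KnotDiagram) : Equiv.Perm D.Dart := D.rot⁻¹ * D.flip

/-- The set of complementary regions of the curve (equivalently, of the components of the
complement of a regular neighbourhood of the curve). -/
def Region (D : KnotDiagram) : Type := Orbits D.faceStep

/-- The region on the left of a dart: the one that contains the sector between `h` and `rot h`. -/
def leftRegion (D : KnotDiagram) (h : D.Dart) : D.Region :=
  Quotient.mk (Equiv.Perm.SameCycle.setoid D.faceStep) h

/-- The second next dart at the same vertex. At a crossing this is the opposite dart. -/
def across (D : KnotDiagram) (h : D.Dart) : D.Dart := D.rot (D.rot h)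

/-- The dart sits at a crossing, not at an auxiliary point. -/
def AtCrossing (D : KnotDiagram) (h : D.Dart) : Prop := D.across h ≠ h

/-- The number of crossings of a diagram. -/
noncomputable def crossings (D : KnotDiagram) : ℕ :=
  Nat.card {v : Orbits D.rot // ∃ h : D.Dart, D.AtCrossing h ∧
    Quotient.mk (Equiv.Perm.SameCycle.setoid D.rot) h = v}

/-- `E` is obtained from `D` by deleting the darts in `X` (and then possibly changing how the
remaining darts are connected); `j` is the inclusion of the remaining darts. Remaining crossings
keep their crossing information. -/
structure Deletes (D E : KnotDiagram) (X : Set D.Dart) (j : E.Dart → D.Dart) : Prop where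
  injective : Function.Injective j
  range_eq : Set.range j = Xᶜ
  upper_eq : ∀ x, E.AtCrossing x → E.upper x = D.upper (j x)

/-- The six darts on the boundary of the triangular region on the left of `a`, `b`, `c`. -/
def triangle (D : KnotDiagram) (a b c : D.Dart) : Set D.Dart :=
  {a, D.rot a, b, D.rot b, c, D.rot c}

open Classical in
/-- Bookkeeping for the third move at the triangle with corners `a`, `b`, `c`. Each strand of the
triangle meets two crossings, which it meets in the opposite order after the move. Hence whatever
was attached to a strand at one end (an outer dart at the first crossing) is attached afterwards
to the inner dart on that strand at the other crossing, and conversely. Other darts are not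
affected. -/
noncomputable def slide (D : KnotDiagram) (a b c : D.Dart) (h : D.Dart) : D.Dart :=
  if h ∈ D.triangle a b c then D.across (D.flip h)
  else if D.across h ∈ D.triangle a b c then D.flip (D.across h)
  else h

end KnotDiagram

/-- A knot diagram on a sphere with punctures labelled by `ι`, up to orientation-preserving
homeomorphisms that respect the labels: for every puncture, the region of the diagram in which it
lies. Several punctures may lie in the same region. -/
structure PuncturedDiagram (ι : Type) where
  diagram : KnotDiagram
  place : ι → diagram.Region

open Classical in
/-- Elementary moves of knot diagrams on a punctured sphere. The disk in which a move takes place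
contains no puncture, and punctures do not move. The moves are listed in one direction only.

A puncture lies, before and after a move, on the left of "the same" dart, and that dart is one
that the move does not delete (for the third move: is not on the boundary of the triangle). -/
inductive ElementaryMove {ι : Type} : PuncturedDiagram ι → PuncturedDiagram ι → Prop
  /-- The same diagram up to homeomorphism. -/
  | homeo (D E : KnotDiagram) (p : ι → D.Region) (q : ι → E.Region) (j : E.Dart ≃ D.Dart)
      (upper_eq : ∀ x, E.AtCrossing x → E.upper x = D.upper (j x))
      (flip_eq : ∀ x, j (E.flip x) = D.flip (j x))
      (rot_eq : ∀ x, j (E.rot x) = D.rot (j x))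
      (place_eq : ∀ i, ∃ x, p i = D.leftRegion (j x) ∧ q i = E.leftRegion x) :
      ElementaryMove ⟨D, p⟩ ⟨E, q⟩
  /-- Erase the auxiliary point with darts `k` and `rot k` (which is not the only vertex). -/
  | erase (D E : KnotDiagram) (p : ι → D.Region) (q : ι → E.Region) (j : E.Dart → D.Dart)
      (k : D.Dart) (aux : ¬ D.AtCrossing k) (not_circle : D.flip k ≠ D.rot k)
      (del : D.Deletes E {k, D.rot k} j)
      (flip_eq : ∀ x, j (E.flip x) =
        if D.flip (j x) = k then D.flip (D.rot k)
        else if D.flip (j x) = D.rot k then D.flip k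
        else D.flip (j x))
      (rot_eq : ∀ x, j (E.rot x) = D.rot (j x))
      (place_eq : ∀ i, ∃ x, p i = D.leftRegion (j x) ∧ q i = E.leftRegion x) :
      ElementaryMove ⟨D, p⟩ ⟨E, q⟩
  /-- First Reidemeister move: the edge from `h` to `rot h` is a loop that bounds the region on
  the left of `h`. The loop is removed and the crossing becomes an auxiliary point. -/
  | reidemeister1 (D E : KnotDiagram) (p : ι → D.Region) (q : ι → E.Region)
      (j : E.Dart → D.Dart) (h : D.Dart) (cross : D.AtCrossing h)
      (monogon : D.flip h = D.rot h)
      (del : D.Deletes E {h, D.rot h} j)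
      (flip_eq : ∀ x, j (E.flip x) = D.flip (j x))
      (rot_eq : ∀ x, j (E.rot x) =
        if j x = D.across h then D.across (D.rot h)
        else if j x = D.across (D.rot h) then D.across h
        else D.rot (j x))
      (place_eq : ∀ i, ∃ x, p i = D.leftRegion (j x) ∧ q i = E.leftRegion x) :
      ElementaryMove ⟨D, p⟩ ⟨E, q⟩
  /-- Second Reidemeister move: the region on the left of `v` and `w` is a bigon with two different
  corners, and one of its two strands is over the other one at both corners. The strands are
  pulled apart; an auxiliary point remains on each of them. -/
  | reidemeister2 (D E : KnotDiagram) (p : ι → D.Region) (q : ι → E.Region)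
      (j : E.Dart → D.Dart) (v w : D.Dart) (cross_v : D.AtCrossing v) (cross_w : D.AtCrossing w)
      (distinct : ¬ D.rot.SameCycle v w)
      (edge_vw : D.flip v = D.rot w) (edge_wv : D.flip w = D.rot v)
      (upper_both : D.upper v = D.upper (D.rot w))
      (del : D.Deletes E {v, D.rot v, w, D.rot w} j)
      (flip_eq : ∀ x, j (E.flip x) = D.flip (j x))
      (rot_eq : ∀ x, j (E.rot x) =
        if j x = D.across v then D.across (D.rot w)
        else if j x = D.across (D.rot w) then D.across v
        else if j x = D.across w then D.across (D.rot v)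
        else if j x = D.across (D.rot v) then D.across w
        else D.rot (j x))
      (place_eq : ∀ i, ∃ x, p i = D.leftRegion (j x) ∧ q i = E.leftRegion x) :
      ElementaryMove ⟨D, p⟩ ⟨E, q⟩
  /-- Third Reidemeister move: the region on the left of `a`, `b`, `c` is a triangle with three
  different corners, and the three strands are not cyclically over each other. -/
  | reidemeister3 (D E : KnotDiagram) (p : ι → D.Region) (q : ι → E.Region)
      (j : E.Dart ≃ D.Dart) (a b c : D.Dart)
      (cross_a : D.AtCrossing a) (cross_b : D.AtCrossing b) (cross_c : D.AtCrossing c)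
      (distinct_ab : ¬ D.rot.SameCycle a b) (distinct_bc : ¬ D.rot.SameCycle b c)
      (distinct_ca : ¬ D.rot.SameCycle c a)
      (edge_ab : D.flip a = D.rot b) (edge_bc : D.flip b = D.rot c)
      (edge_ca : D.flip c = D.rot a)
      (not_cyclic : ¬ (D.upper a = D.upper b ∧ D.upper b = D.upper c))
      (upper_eq : ∀ x, E.AtCrossing x → E.upper x = D.upper (j x))
      (flip_eq : ∀ x, j (E.flip x) = D.slide a b c (D.flip (D.slide a b c (j x))))
      (rot_eq : ∀ x, j (E.rot x) = D.rot (j x))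
      (place_eq : ∀ i, ∃ y, y ∉ D.triangle a b c ∧ p i = D.leftRegion y ∧
        q i = E.leftRegion (j.symm (D.slide a b c y))) :
      ElementaryMove ⟨D, p⟩ ⟨E, q⟩

namespace KnotDiagram

/-- The minimal number of crossings of a diagram obtained from `D` by finitely many Reidemeister
moves and their inverses on the sphere with punctures placed in the regions of `D` by `p`. -/
noncomputable def minCrossings (D : KnotDiagram) {ι : Type} (p : ι → D.Region) : ℕ :=
  sInf {k | ∃ E : PuncturedDiagram ι,
    Relation.EqvGen ElementaryMove ⟨D, p⟩ E ∧ E.diagram.crossings = k}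

/-- `c(D)`: the minimum over all diagrams obtained on the sphere without punctures. -/
noncomputable def c (D : KnotDiagram) : ℕ :=
  D.minCrossings (Empty.elim : Empty → D.Region)

/-- `c(D, S)`: the minimum over all diagrams obtained on the sphere punctured once in every region
that belongs to `S`. -/
noncomputable def cOn (D : KnotDiagram) (S : Set D.Region) : ℕ :=
  D.minCrossings (Subtype.val : S → D.Region)

/-- The maximum of `c(D, S)` over all sets `S` of `n` regions. -/
noncomputable def cMax (D : KnotDiagram) (n : ℕ) : ℕ :=
  sSup {k | ∃ S : Set D.Region, S.ncard = n ∧ D.cOn S = k}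

/-- The minimum of `c(D, S)` over all sets `S` of `n` regions. -/
noncomputable def cMin (D : KnotDiagram) (n : ℕ) : ℕ :=
  sInf {k | ∃ S : Set D.Region, S.ncard = n ∧ D.cOn S = k}

end KnotDiagram

/-!
Punctures obstruct moves; two facts measure how much.  Forgetting punctures never does any harm
(`minCrossings_comp_le`), which gives the monotonicity in `n`.  The number of regions is Euler's
formula (`card_region`).

*Few punctures are no obstruction.*  If all the punctures lie in the two regions beside one edge
of the curve, then `c(D, S) = c(D)` (`cOn_of_subset`); this covers every set of at most one region,
and some sets of two regions.  Write `Linked V g W k` if `V` and `W` are related by moves on the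
sphere punctured on both sides of `g`, respectively `k`.  Each single move takes place away from the
two sides of some edge (`ElementaryMove.exists_linked`), so it remains to show that the edge does
not matter, that is, that the two punctures may travel along the curve (`linked_or_linked_flip`).
Auxiliary points are harmless (`linked_rot`).  To pass a crossing (`across_linked`), move the other
strand instead: it slides along the curve away from the punctures and is then swung around the
sphere until it comes back to the punctured edge from the other side, or disappears.  On the way it
passes the vertices of the diagram one after the other, by second and third moves
(`Reaches.sweep`).  It then crosses every edge twice or not at all, apart from the punctured edge
and the ends of the strand itself.  Where it closes up, the crossings in between come in pairs
because closed curves on the sphere bound (`Threaded.paired`), so an innermost such part is a bigon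
or a kink, and second and first moves pull the strand tight (`Reaches.tighten`).  If it has
disappeared, the same is done for the other position of the punctures (`cross_linked`).

*Punctures in all regions prevent any simplification.*  A colouring assigns an element of `ZMod 2`
to every region; its corner sum at a crossing is the sum of the colours of the four sectors.  On a
sphere the corner sums at the crossings can be prescribed, and the colours of two adjacent regions
as well, and this characterises spheres (`planar_iff_euler`).  Given colours `s` at the punctures,
consider the crossings for which some colouring restricts to `s` and has an odd corner sum at this
crossing only.  A second move changes the number of these crossings by zero or two, a third move
does not change it, and a first move changes it only if some colouring without odd corner sums
restricts to `s`, a property that is itself invariant.  Thus parities are invariant in the other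
cases (`SameHits`, `sameHits_of_eqvGen`).  If every region has a puncture, each crossing is the only
one for suitable `s`, and it follows that no move sequence decreases the number of crossings
(`SameHits.card_crossing_le`, `crossings_le_of_surjective`).

All constructions of new diagrams are made for surfaces of arbitrary genus (`VirtualDiagram`),
because the combinatorics does not depend on the genus.  The criterion by colourings is used to see
that the surface is still a sphere.
-/

/-! ### Colourings and the Euler characteristic -/

/-- A knot diagram on a closed oriented surface that need not be a sphere: a `KnotDiagram` without
its Euler characteristic.  Connectedness is recorded as an induction principle along the curve. -/
structure VirtualDiagram where
  Dart : Type
  finite : Finite Dart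
  nonempty : Nonempty Dart
  rot : Equiv.Perm Dart
  flip : Equiv.Perm Dart
  upper : Dart → Bool
  rot_ne : ∀ h, rot h ≠ h
  rot_four : ∀ h, rot (rot (rot (rot h))) = h
  flip_ne : ∀ h, flip h ≠ h
  flip_flip : ∀ h, flip (flip h) = h
  upper_rot : ∀ h, rot (rot h) ≠ h → upper (rot h) = !upper h
  along : ∀ P : Dart → Prop, (∀ a, P a → P (flip a)) →
    (∀ a, rot (rot a) = a → P a → P (rot a)) →
    (∀ a, rot (rot a) ≠ a → P a → P (rot (rot a))) → ∀ h k, P h → P k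

/-- Forget that the surface is a sphere. -/
def KnotDiagram.toVirtual (D : KnotDiagram) : VirtualDiagram where
  Dart := D.Dart
  finite := D.finite
  nonempty := D.nonempty
  rot := D.rot
  flip := D.flip
  upper := D.upper
  rot_ne := D.rot_ne
  rot_four := D.rot_four
  flip_ne := D.flip_ne
  flip_flip := D.flip_flip
  upper_rot := D.upper_rot
  along := by
    intro P h1 h2 h3 h k hP
    induction D.one_component h k with
    | refl => exact hP
    | tail _ hbc ih =>
      rcases hbc with rfl | ⟨h, rfl⟩ | ⟨h, rfl⟩
      · exact h1 _ ih
      · exact h2 _ h ih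
      · exact h3 _ h ih

namespace VirtualDiagram

variable (V : VirtualDiagram)

theorem rot_inv (x : V.Dart) : V.rot⁻¹ x = V.rot (V.rot (V.rot x)) := by
  rw [Equiv.Perm.inv_eq_iff_eq, V.rot_four]

/-- A colouring of the regions by `ZMod 2`, written as a function of the darts: a dart `x` stands
for the region on its left.  The region on the right of `x` is the one on the left of
`V.flip x`, and it contains the sector preceding `x`. -/
def IsColoring (φ : V.Dart → ZMod 2) : Prop :=
  ∀ x, φ (V.rot (V.rot (V.rot x))) = φ (V.flip x)

/-- The sum of the colours of the four sectors at a vertex (an auxiliary point counts both of its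
sectors twice). -/
def cornerSum (φ : V.Dart → ZMod 2) (x : V.Dart) : ZMod 2 :=
  φ x + φ (V.rot x) + φ (V.rot (V.rot x)) + φ (V.rot (V.rot (V.rot x)))

/-- A criterion for the surface to be a sphere in terms of colourings: there is a checkerboard
colouring, and any prescribed corner sums at the crossings are realised by a colouring. -/
def Planar : Prop :=
  (∃ φ, V.IsColoring φ ∧ ∀ x, φ (V.flip x) = φ x + 1) ∧
  ∀ δ : V.Dart → ZMod 2, (∀ x, δ (V.rot x) = δ x) → (∀ x, V.rot (V.rot x) = x → δ x = 0) →
    ∃ φ, V.IsColoring φ ∧ V.cornerSum φ = δ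

/-- The set of crossings. -/
abbrev Crossing : Type :=
  {v : Orbits V.rot // ∃ h : V.Dart, V.rot (V.rot h) ≠ h ∧
    Quotient.mk (Equiv.Perm.SameCycle.setoid V.rot) h = v}

end VirtualDiagram

theorem sameCycle_iff_of_four {α : Type} (f : Equiv.Perm α) (h4 : ∀ x, f (f (f (f x))) = x)
    (x y : α) : f.SameCycle x y ↔ y = x ∨ y = f x ∨ y = f (f x) ∨ y = f (f (f x)) := by
  constructor
  · rintro ⟨i, rfl⟩
    have h : f ^ (4 : ℤ) = 1 := by
      ext z
      exact h4 z
    have h' : (f ^ i) = f ^ (i % 4) := by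
      conv_lhs => rw [← Int.mul_ediv_add_emod i 4, zpow_add, zpow_mul, h, one_zpow, one_mul]
    rw [h']
    have : i % 4 = 0 ∨ i % 4 = 1 ∨ i % 4 = 2 ∨ i % 4 = 3 := by omega
    rcases this with h | h | h | h <;> rw [h]
    · left; rfl
    · right; left; rfl
    · right; right; left; rfl
    · right; right; right; rfl
  · rintro (rfl | rfl | rfl | rfl)
    · exact Equiv.Perm.SameCycle.refl _ _
    · exact ⟨1, rfl⟩
    · exact ⟨2, rfl⟩
    · exact ⟨3, rfl⟩

theorem orbit_mk_eq {α : Type} (f : Equiv.Perm α) (x y : α) :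
    (Quotient.mk (Equiv.Perm.SameCycle.setoid f) x = Quotient.mk _ y) ↔ f.SameCycle x y := by
  rw [Quotient.eq]
  rfl

/-- If all the orbits in a family have `k` elements, they have `k` times as many elements in total
as there are orbits in the family. -/
theorem card_of_orbits_card {α : Type} [Finite α] (f : Equiv.Perm α) (P : Orbits f → Prop) (k : ℕ)
    (hk : ∀ x, P (Quotient.mk _ x) → Nat.card {y // f.SameCycle x y} = k) :
    Nat.card {x // P (Quotient.mk (Equiv.Perm.SameCycle.setoid f) x)}
      = k * Nat.card {o // P o} := by
  let e : {x // P (Quotient.mk (Equiv.Perm.SameCycle.setoid f) x)} ≃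
      Σ o : {o // P o}, {x : α // Quotient.mk (Equiv.Perm.SameCycle.setoid f) x = o.1} :=
    { toFun := fun x => ⟨⟨_, x.2⟩, ⟨x.1, rfl⟩⟩
      invFun := fun s => ⟨s.2.1, by rw [s.2.2]; exact s.1.2⟩
      left_inv := fun _ => rfl
      right_inv := by
        rintro ⟨⟨o, ho⟩, ⟨x, h⟩⟩
        dsimp only at h
        subst h
        rfl }
  have : Fintype {o // P o} := Fintype.ofFinite _
  rw [Nat.card_congr e, Nat.card_sigma, Finset.sum_congr rfl (g := fun _ => k)]
  · simp [mul_comm, Nat.card_eq_fintype_card]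
  · rintro ⟨o, ho⟩ -
    obtain ⟨x, rfl⟩ := Quotient.exists_rep o
    rw [← hk x ho]
    refine Nat.card_congr (Equiv.subtypeEquivRight fun y => ?_)
    rw [orbit_mk_eq, Equiv.Perm.sameCycle_comm]

namespace VirtualDiagram

variable (V : VirtualDiagram)

theorem sameCycle_rot (x y : V.Dart) : V.rot.SameCycle x y ↔
    y = x ∨ y = V.rot x ∨ y = V.rot (V.rot x) ∨ y = V.rot (V.rot (V.rot x)) :=
  sameCycle_iff_of_four _ V.rot_four x y

variable {V} in
theorem ne_of_crossing {x : V.Dart} (h : V.rot (V.rot x) ≠ x) :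
    V.rot x ≠ x ∧ V.rot (V.rot x) ≠ x ∧ V.rot (V.rot (V.rot x)) ≠ x ∧
    V.rot (V.rot x) ≠ V.rot x ∧ V.rot (V.rot (V.rot x)) ≠ V.rot x ∧
    V.rot (V.rot (V.rot x)) ≠ V.rot (V.rot x) := by
  refine ⟨V.rot_ne _, h, fun h' => V.rot_ne x ?_, V.rot_ne _, fun h' => h (V.rot.injective h'),
    V.rot_ne _⟩
  simpa [h'] using V.rot_four x

theorem crossing_rot_iff {x : V.Dart} :
    V.rot (V.rot (V.rot x)) = V.rot x ↔ V.rot (V.rot x) = x := V.rot.apply_eq_iff_eq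

/-- (vertices) - (edges) = - (crossings): an auxiliary point has two half-edges, a crossing has
four. -/
theorem card_orbits_sub :
    (Nat.card (Orbits V.rot) : ℤ) - Nat.card (Orbits V.flip) = - Nat.card V.Crossing := by
  have := V.finite
  have hdet : ∀ x, (∃ h, V.rot (V.rot h) ≠ h ∧ Quotient.mk (Equiv.Perm.SameCycle.setoid V.rot) h =
      Quotient.mk _ x) ↔ V.rot (V.rot x) ≠ x := by
    intro x
    constructor
    · rintro ⟨h, hh, e⟩
      rw [orbit_mk_eq, V.sameCycle_rot] at e
      rcases e with rfl | rfl | rfl | rfl <;>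
        simpa [V.rot_four, V.crossing_rot_iff, eq_comm] using hh
    · exact fun h => ⟨x, h, rfl⟩
  have h1 := card_of_orbits_card V.flip (fun _ => True) 2 (by
    intro x _
    have : {y | V.flip.SameCycle x y} = {x, V.flip x} := by
      ext y
      have h4 : ∀ x, V.flip (V.flip (V.flip (V.flip x))) = x := by simp [V.flip_flip]
      simp only [Set.mem_ofPred_eq, sameCycle_iff_of_four _ h4, V.flip_flip]
      grind
    rw [← Set.coe_ofPred, this, Nat.card_coe_set_eq, Set.ncard_pair (V.flip_ne x).symm])
  have h2 := card_of_orbits_card V.rot (fun o => ∃ h, V.rot (V.rot h) ≠ h ∧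
      Quotient.mk (Equiv.Perm.SameCycle.setoid V.rot) h = o) 4 (by
    intro x hx
    rw [hdet] at hx
    have : {y | V.rot.SameCycle x y} =
        ({x, V.rot x, V.rot (V.rot x), V.rot (V.rot (V.rot x))} : Set V.Dart) := by
      ext y
      simp [V.sameCycle_rot]
    rw [← Set.coe_ofPred, this, Nat.card_coe_set_eq]
    obtain ⟨a, b, c, d, e, f⟩ := ne_of_crossing hx
    rw [Set.ncard_insert_of_notMem, Set.ncard_insert_of_notMem, Set.ncard_pair f.symm]
    · simp [d.symm, e.symm]
    · simp [a.symm, b.symm, c.symm])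
  have h3 := card_of_orbits_card V.rot (fun o => ¬ ∃ h, V.rot (V.rot h) ≠ h ∧
      Quotient.mk (Equiv.Perm.SameCycle.setoid V.rot) h = o) 2 (by
    intro x hx
    rw [hdet, not_not] at hx
    have : {y | V.rot.SameCycle x y} = {x, V.rot x} := by
      ext y
      simp only [Set.mem_ofPred_eq, V.sameCycle_rot, hx, Set.mem_insert_iff, Set.mem_singleton_iff]
      grind
    rw [← Set.coe_ofPred, this, Nat.card_coe_set_eq, Set.ncard_pair (V.rot_ne x).symm])
  have h4 : Nat.card (Orbits V.rot) = Nat.card V.Crossing + Nat.card {o : Orbits V.rot //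
      ¬ ∃ h, V.rot (V.rot h) ≠ h ∧ Quotient.mk (Equiv.Perm.SameCycle.setoid V.rot) h = o} := by
    classical
    rw [← Nat.card_sum]
    exact Nat.card_congr (Equiv.sumCompl _).symm
  have h5 : Nat.card V.Dart = Nat.card {x : V.Dart // ∃ h, V.rot (V.rot h) ≠ h ∧
      Quotient.mk (Equiv.Perm.SameCycle.setoid V.rot) h = Quotient.mk _ x} +
      Nat.card {x : V.Dart // ¬ ∃ h, V.rot (V.rot h) ≠ h ∧
      Quotient.mk (Equiv.Perm.SameCycle.setoid V.rot) h = Quotient.mk _ x} := by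
    classical
    rw [← Nat.card_sum]
    exact Nat.card_congr (Equiv.sumCompl _).symm
  rw [Nat.card_congr (Equiv.subtypeUnivEquiv fun _ => trivial),
    Nat.card_congr (Equiv.subtypeUnivEquiv fun _ => trivial)] at h1
  unfold Crossing at *
  omega

/-- If all corner sums vanish, the sum of the colours on the two sides of an edge does not change
along the curve. -/
theorem edgeSum_const {φ : V.Dart → ZMod 2} (hφ : V.IsColoring φ)
    (h0 : ∀ x, V.cornerSum φ x = 0) (x y : V.Dart) :
    φ x + φ (V.flip x) = φ y + φ (V.flip y) := by
  have key := V.along (fun a => φ a + φ (V.flip a) = φ x + φ (V.flip x))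
  refine (key ?_ ?_ ?_ x y rfl).symm
  · intro a ha
    rw [V.flip_flip, add_comm, ha]
  · intro a ha h
    have h1 := hφ a
    have h2 := hφ (V.rot a)
    rw [V.rot_four] at h2
    rw [ha] at h1
    rw [← h, ← h1, ← h2, add_comm]
  · intro a _ h
    have h1 := hφ a
    have h2 := hφ (V.rot (V.rot a))
    rw [V.rot_four] at h2
    rw [← h, ← h1, ← h2]
    have h3 := h0 a
    unfold cornerSum at h3
    have h4 : ∀ a b c d : ZMod 2, a + b + c + d = 0 → c + b = a + d := by decide
    exact h4 _ _ _ _ h3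

/-- A colouring in which the two sides of every edge agree is constant, since the curve is
connected. -/
theorem const_of_edgeSum {φ : V.Dart → ZMod 2} (hφ : V.IsColoring φ)
    (h0 : ∀ x, φ x + φ (V.flip x) = 0) (x y : V.Dart) : φ x = φ y := by
  have h1 : ∀ a, φ (V.flip a) = φ a := by
    intro a
    have : ∀ a b : ZMod 2, a + b = 0 → b = a := by decide
    exact this _ _ (h0 a)
  have h2 : ∀ a, φ (V.rot a) = φ a := by
    intro a
    have := hφ (V.rot a)
    rw [V.rot_four, h1] at this
    exact this.symm
  refine V.along (fun a => φ x = φ a) ?_ ?_ ?_ x y rfl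
  · intro a h; rw [h1, h]
  · intro a _ h; rw [h2, h]
  · intro a _ h; rw [h2, h2, h]

/-- The additive group of colourings. -/
def colorings : AddSubgroup (V.Dart → ZMod 2) where
  carrier := {φ | V.IsColoring φ}
  zero_mem' := fun _ => rfl
  add_mem' := by
    intro a b ha hb x
    simp only [Pi.add_apply, ha x, hb x]
  neg_mem' := by
    intro a ha x
    simp only [Pi.neg_apply, ha x]

/-- Colourings are functions on the set of regions. -/
def coloringsEquiv : V.colorings ≃ (Orbits (V.rot⁻¹ * V.flip) → ZMod 2) where
  toFun φ := Quotient.lift φ.1 (by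
    have h1 : ∀ x, φ.1 ((V.rot⁻¹ * V.flip) x) = φ.1 x := by
      intro x
      have := φ.2 (V.flip x)
      rw [V.flip_flip] at this
      rw [Equiv.Perm.mul_apply, V.rot_inv, this]
    rintro a b ⟨i, rfl⟩
    induction i using Int.induction_on with
    | zero => rfl
    | succ i ih => rw [add_comm, zpow_add, zpow_one, Equiv.Perm.mul_apply, h1, ih]
    | pred i ih =>
      rw [ih, ← h1 (((V.rot⁻¹ * V.flip) ^ (-(i : ℤ) - 1)) a), ← Equiv.Perm.mul_apply, ← zpow_one_add]
      rw [show 1 + (-(i : ℤ) - 1) = -i by ring])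
  invFun g := ⟨fun x => g (Quotient.mk _ x), by
    intro x
    refine congrArg g (Quotient.sound ?_).symm
    refine ⟨1, ?_⟩
    rw [zpow_one, Equiv.Perm.mul_apply, V.flip_flip, V.rot_inv]⟩
  left_inv φ := rfl
  right_inv g := by
    funext o
    obtain ⟨x, rfl⟩ := Quotient.exists_rep o
    rfl

variable {V} in
theorem cornerSum_rot (φ : V.Dart → ZMod 2) (x : V.Dart) :
    V.cornerSum φ (V.rot x) = V.cornerSum φ x := by
  unfold cornerSum
  rw [V.rot_four]
  ring

variable {V} in
theorem cornerSum_aux (φ : V.Dart → ZMod 2) {x : V.Dart} (hx : V.rot (V.rot x) = x) :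
    V.cornerSum φ x = 0 := by
  unfold cornerSum
  rw [hx]
  have : ∀ a b : ZMod 2, a + b + a + b = 0 := by decide
  exact this _ _

variable {V} in
theorem cornerSum_add (φ ψ : V.Dart → ZMod 2) (x : V.Dart) :
    V.cornerSum (φ + ψ) x = V.cornerSum φ x + V.cornerSum ψ x := by
  simp only [cornerSum, Pi.add_apply]
  ring

/-- The group of rot-invariant functions that vanish at the auxiliary points. -/
def crossingFunctions : AddSubgroup (V.Dart → ZMod 2) where
  carrier := {δ | (∀ x, δ (V.rot x) = δ x) ∧ ∀ x, V.rot (V.rot x) = x → δ x = 0}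
  zero_mem' := ⟨fun _ => rfl, fun _ _ => rfl⟩
  add_mem' := by
    rintro a b ⟨ha, ha'⟩ ⟨hb, hb'⟩
    refine ⟨fun x => by simp only [Pi.add_apply, ha x, hb x], fun x hx => ?_⟩
    simp only [Pi.add_apply, ha' x hx, hb' x hx, add_zero]
  neg_mem' := by
    rintro a ⟨ha, ha'⟩
    refine ⟨fun x => by simp only [Pi.neg_apply, ha x], fun x hx => ?_⟩
    simp only [Pi.neg_apply, ha' x hx, neg_zero]

theorem card_crossingFunctions : Nat.card V.crossingFunctions = 2 ^ Nat.card V.Crossing := by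
  classical
  have := V.finite
  have : Nat.card (V.Crossing → ZMod 2) = 2 ^ Nat.card V.Crossing := by
    rw [Nat.card_fun]; simp
  rw [← this]
  have inv : ∀ δ : V.crossingFunctions, ∀ a b, V.rot.SameCycle a b → δ.1 a = δ.1 b := by
    intro δ a b h
    rw [V.sameCycle_rot] at h
    rcases h with rfl | rfl | rfl | rfl <;> simp [δ.2.1]
  let toFun (g : V.Crossing → ZMod 2) (x : V.Dart) : ZMod 2 :=
    if h : V.rot (V.rot x) ≠ x then g ⟨Quotient.mk _ x, x, h, rfl⟩ else 0
  have h1 : ∀ g x, toFun g (V.rot x) = toFun g x := by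
    intro g x
    dsimp only [toFun]
    by_cases h : V.rot (V.rot x) ≠ x
    · have h' : V.rot (V.rot (V.rot x)) ≠ V.rot x := fun e => h (V.rot.injective e)
      rw [dif_pos h, dif_pos h']
      congr 2
      exact ((orbit_mk_eq V.rot _ _).2 ⟨1, rfl⟩).symm
    · have h' : ¬ V.rot (V.rot (V.rot x)) ≠ V.rot x := fun e => h (fun e' => e (by rw [e']))
      rw [dif_neg h, dif_neg h']
  have h2 : ∀ g x, V.rot (V.rot x) = x → toFun g x = 0 :=
    fun g x hx => dif_neg (not_not.2 hx)
  refine Nat.card_congr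
    { toFun := fun δ v => Quotient.lift δ.1 (inv δ) v.1
      invFun := fun g => ⟨toFun g, h1 g, h2 g⟩
      left_inv := ?_
      right_inv := ?_ }
  · intro δ
    ext x
    dsimp only [toFun]
    by_cases h : V.rot (V.rot x) ≠ x
    · simp [h]
    · simp [h, δ.2.2 x (not_not.1 h)]
  · intro g
    funext ⟨v, x, hx, hv⟩
    subst hv
    simp [toFun, hx]

/-- The corner sums of a colouring. -/
def cornerSumHom : V.colorings →+ V.crossingFunctions where
  toFun φ := ⟨V.cornerSum φ.1, cornerSum_rot φ.1, fun _ hx => cornerSum_aux φ.1 hx⟩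
  map_zero' := by
    ext x
    simp [cornerSum]
  map_add' φ ψ := by
    ext x
    simp [cornerSum_add]

/-- The map from colourings to corner sums has a kernel with at most four elements, and it is
surjective with a kernel of four elements precisely on the sphere: compare cardinalities. -/
theorem planar_iff_card :
    V.Planar ↔ Nat.card (Orbits (V.rot⁻¹ * V.flip)) = Nat.card V.Crossing + 2 := by
  classical
  have := V.finite
  obtain ⟨x₀⟩ := V.nonempty
  -- A colouring with vanishing corner sums is determined by two colours, at `x₀` and across it.
  let ev : V.cornerSumHom.ker → ZMod 2 × ZMod 2 := fun φ => (φ.1.1 x₀, φ.1.1 (V.flip x₀))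
  have hker : ∀ φ : V.cornerSumHom.ker, ∀ x, V.cornerSum φ.1.1 x = 0 := by
    intro φ x
    have h := φ.2
    rw [AddMonoidHom.mem_ker] at h
    exact congrFun (congrArg Subtype.val h) x
  have hinj : Function.Injective ev := by
    intro φ ψ h
    simp only [ev, Prod.mk.injEq] at h
    have hc : V.IsColoring (φ.1.1 + ψ.1.1) := V.colorings.add_mem φ.1.2 ψ.1.2
    have hs : ∀ x, V.cornerSum (φ.1.1 + ψ.1.1) x = 0 := by
      intro x
      rw [cornerSum_add, hker, hker, add_zero]
    have h1 : ∀ x, (φ.1.1 + ψ.1.1) x + (φ.1.1 + ψ.1.1) (V.flip x) = 0 := by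
      intro x
      rw [V.edgeSum_const hc hs x x₀]
      simp only [Pi.add_apply, h.1, h.2, CharTwo.add_self_eq_zero]
    have h2 : ∀ x, φ.1.1 x + ψ.1.1 x = 0 := by
      intro x
      have := V.const_of_edgeSum hc h1 x x₀
      simpa [h.1, CharTwo.add_self_eq_zero] using this
    apply Subtype.ext
    apply Subtype.ext
    funext x
    have : ∀ a b : ZMod 2, a + b = 0 → a = b := by decide
    exact this _ _ (h2 x)
  have hcard : Nat.card V.colorings = Nat.card V.cornerSumHom.ker * Nat.card V.cornerSumHom.range := by
    rw [AddSubgroup.card_eq_card_quotient_mul_card_addSubgroup V.cornerSumHom.ker, mul_comm]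
    congr 1
    exact Nat.card_congr (QuotientAddGroup.quotientKerEquivRange V.cornerSumHom).toEquiv
  have hcol : Nat.card V.colorings = 2 ^ Nat.card (Orbits (V.rot⁻¹ * V.flip)) := by
    rw [Nat.card_congr V.coloringsEquiv, Nat.card_fun]
    simp
  have hk4 : Nat.card (ZMod 2 × ZMod 2) = 4 := by simp
  have hkle : Nat.card V.cornerSumHom.ker ≤ 4 := hk4 ▸ Nat.card_le_card_of_injective ev hinj
  have hrle : Nat.card V.cornerSumHom.range ≤ 2 ^ Nat.card V.Crossing := by
    rw [← V.card_crossingFunctions]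
    exact Nat.card_le_card_of_injective _ Subtype.val_injective
  have hrpos : 0 < Nat.card V.cornerSumHom.range := Nat.card_pos
  constructor
  · rintro ⟨⟨χ, hχ, hχ1⟩, hδ⟩
    have hsurj : Function.Surjective V.cornerSumHom := by
      intro δ
      obtain ⟨φ, hφ, e⟩ := hδ δ.1 δ.2.1 δ.2.2
      exact ⟨⟨φ, hφ⟩, Subtype.ext e⟩
    have hr : Nat.card V.cornerSumHom.range = 2 ^ Nat.card V.Crossing := by
      rw [← V.card_crossingFunctions, AddMonoidHom.range_eq_top.2 hsurj]
      exact Nat.card_congr AddSubgroup.topEquiv.toEquiv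
    have hχ0 : ∀ x, V.cornerSum χ x = 0 := by
      intro x
      have h1 : ∀ x, χ (V.rot (V.rot (V.rot x))) = χ x + 1 := fun x => by rw [hχ, hχ1]
      have h2 : ∀ x, χ (V.rot x) = χ x + 1 := by
        intro x
        have := h1 (V.rot x)
        rw [V.rot_four] at this
        have h3 : ∀ a b : ZMod 2, a = b + 1 → b = a + 1 := by decide
        exact h3 _ _ this
      simp only [cornerSum, h2]
      have : ∀ a : ZMod 2, a + (a + 1) + (a + 1 + 1) + (a + 1 + 1 + 1) = 0 := by decide
      exact this _
    have h1 : (1 : V.Dart → ZMod 2) ∈ V.colorings := fun _ => rfl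
    have h10 : ∀ x, V.cornerSum 1 x = 0 := by
      intro x
      simp only [cornerSum, Pi.one_apply]
      decide
    let kχ : V.cornerSumHom.ker := ⟨⟨χ, hχ⟩, Subtype.ext (funext hχ0)⟩
    let k1 : V.cornerSumHom.ker := ⟨⟨1, h1⟩, Subtype.ext (funext h10)⟩
    have hevadd : ∀ a b, ev (a + b) = ev a + ev b := fun _ _ => rfl
    have hev1 : ev k1 = (1, 1) := rfl
    have hevχ : ev kχ = (χ x₀, χ x₀ + 1) := by
      simp only [ev, kχ, hχ1]
    have hsurj2 : Function.Surjective ev := by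
      rintro ⟨a, b⟩
      have key : ∀ a b c : ZMod 2, (a, b) = (0, 0) ∨ (a, b) = (1, 1) ∨ (a, b) = (c, c + 1) ∨
        (a, b) = (c, c + 1) + (1, 1) := by decide
      rcases key a b (χ x₀) with h | h | h | h
      · exact ⟨0, h.symm ▸ rfl⟩
      · exact ⟨k1, by rw [h, hev1]⟩
      · exact ⟨kχ, by rw [h, hevχ]⟩
      · exact ⟨kχ + k1, by rw [h, hevadd, hevχ, hev1]⟩
    have hk : Nat.card V.cornerSumHom.ker = 4 := by
      rw [← hk4]
      exact Nat.card_eq_of_bijective ev ⟨hinj, hsurj2⟩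
    rw [hk, hr, hcol] at hcard
    have : (2 : ℕ) ^ Nat.card (Orbits (V.rot⁻¹ * V.flip)) = 2 ^ (Nat.card V.Crossing + 2) := by
      rw [hcard, pow_add]
      ring
    exact Nat.pow_right_injective le_rfl this
  · intro h
    have hprod : Nat.card V.cornerSumHom.ker * Nat.card V.cornerSumHom.range =
        4 * 2 ^ Nat.card V.Crossing := by
      rw [← hcard, hcol, h, pow_add]
      ring
    have hk : Nat.card V.cornerSumHom.ker = 4 := by nlinarith
    have hr : Nat.card V.cornerSumHom.range = 2 ^ Nat.card V.Crossing := by nlinarith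
    have hbij : Function.Bijective ev :=
      (Nat.bijective_iff_injective_and_card ev).2 ⟨hinj, by rw [hk, hk4]⟩
    have hsurj : Function.Surjective V.cornerSumHom := by
      rw [← AddMonoidHom.range_eq_top]
      apply AddSubgroup.eq_top_of_card_eq
      rw [hr, V.card_crossingFunctions]
    constructor
    · obtain ⟨φ, hφ⟩ := hbij.2 (0, 1)
      refine ⟨φ.1.1, φ.1.2, fun x => ?_⟩
      have h1 := V.edgeSum_const φ.1.2 (hker φ) x x₀
      have h2 : φ.1.1 x₀ = 0 := congrArg Prod.fst hφ
      have h3 : φ.1.1 (V.flip x₀) = 1 := congrArg Prod.snd hφ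
      rw [h2, h3] at h1
      have : ∀ a b : ZMod 2, a + b = 0 + 1 → b = a + 1 := by decide
      exact this _ _ h1
    · intro δ h1 h2
      obtain ⟨φ, hφ⟩ := hsurj ⟨δ, h1, h2⟩
      exact ⟨φ.1, φ.2, congrArg Subtype.val hφ⟩

theorem planar_iff_euler : V.Planar ↔ (Nat.card (Orbits V.rot) : ℤ) - Nat.card (Orbits V.flip)
    + Nat.card (Orbits (V.rot⁻¹ * V.flip)) = 2 := by
  rw [V.planar_iff_card, V.card_orbits_sub]
  omega

/-- A planar virtual diagram is a knot diagram on the sphere. -/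
def toKnot (h : V.Planar) : KnotDiagram where
  Dart := V.Dart
  finite := V.finite
  nonempty := V.nonempty
  rot := V.rot
  flip := V.flip
  upper := V.upper
  rot_ne := V.rot_ne
  rot_four := V.rot_four
  flip_ne := V.flip_ne
  flip_flip := V.flip_flip
  upper_rot := V.upper_rot
  one_component := by
    intro h k
    refine V.along (fun a => Relation.ReflTransGen _ h a) ?_ ?_ ?_ h k .refl
    · exact fun a ha => ha.tail (Or.inl rfl)
    · exact fun a h' ha => ha.tail (Or.inr (Or.inl ⟨h', rfl⟩))
    · exact fun a h' ha => ha.tail (Or.inr (Or.inr ⟨h', rfl⟩))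
  euler := V.planar_iff_euler.1 h

end VirtualDiagram

namespace KnotDiagram

variable (D : KnotDiagram)

theorem planar : D.toVirtual.Planar := D.toVirtual.planar_iff_euler.2 D.euler

theorem card_region : Nat.card D.Region = D.crossings + 2 :=
  D.toVirtual.planar_iff_card.1 D.planar

end KnotDiagram

namespace VirtualDiagram

/-! ### Moves on arbitrary surfaces -/

/-- The six darts on the boundary of a triangular region, as in `KnotDiagram.triangle`. -/
def triangle (V : VirtualDiagram) (a b c : V.Dart) : Set V.Dart :=
  {a, V.rot a, b, V.rot b, c, V.rot c}

open Classical in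
/-- The bookkeeping of the third move, as in `KnotDiagram.slide`. -/
noncomputable def slide (V : VirtualDiagram) (a b c : V.Dart) (h : V.Dart) : V.Dart :=
  if h ∈ V.triangle a b c then V.rot (V.rot (V.flip h))
  else if V.rot (V.rot h) ∈ V.triangle a b c then V.flip (V.rot (V.rot h))
  else h

open Classical in
/-- `W` arises from `V` by erasing the auxiliary point with darts `k` and `V.rot k`. -/
structure Erases (V W : VirtualDiagram) (j : W.Dart → V.Dart) (k : V.Dart) : Prop where
  aux : V.rot (V.rot k) = k
  not_circle : V.flip k ≠ V.rot k
  injective : Function.Injective j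
  range_eq : Set.range j = {k, V.rot k}ᶜ
  upper_eq : ∀ x, W.rot (W.rot x) ≠ x → W.upper x = V.upper (j x)
  flip_eq : ∀ x, j (W.flip x) =
    if V.flip (j x) = k then V.flip (V.rot k)
    else if V.flip (j x) = V.rot k then V.flip k
    else V.flip (j x)
  rot_eq : ∀ x, j (W.rot x) = V.rot (j x)

open Classical in
/-- `W` arises from `V` by the first Reidemeister move at the monogon on the left of `h`. -/
structure Untwists (V W : VirtualDiagram) (j : W.Dart → V.Dart) (h : V.Dart) : Prop where
  cross : V.rot (V.rot h) ≠ h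
  monogon : V.flip h = V.rot h
  injective : Function.Injective j
  range_eq : Set.range j = {h, V.rot h}ᶜ
  upper_eq : ∀ x, W.rot (W.rot x) ≠ x → W.upper x = V.upper (j x)
  flip_eq : ∀ x, j (W.flip x) = V.flip (j x)
  rot_eq : ∀ x, j (W.rot x) =
    if j x = V.rot (V.rot h) then V.rot (V.rot (V.rot h))
    else if j x = V.rot (V.rot (V.rot h)) then V.rot (V.rot h)
    else V.rot (j x)

open Classical in
/-- `W` arises from `V` by the second Reidemeister move at the bigon on the left of `v`, `w`. -/
structure Separates (V W : VirtualDiagram) (j : W.Dart → V.Dart) (v w : V.Dart) : Prop where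
  cross_v : V.rot (V.rot v) ≠ v
  cross_w : V.rot (V.rot w) ≠ w
  distinct : ¬ V.rot.SameCycle v w
  edge_vw : V.flip v = V.rot w
  edge_wv : V.flip w = V.rot v
  upper_both : V.upper v = V.upper (V.rot w)
  injective : Function.Injective j
  range_eq : Set.range j = {v, V.rot v, w, V.rot w}ᶜ
  upper_eq : ∀ x, W.rot (W.rot x) ≠ x → W.upper x = V.upper (j x)
  flip_eq : ∀ x, j (W.flip x) = V.flip (j x)
  rot_eq : ∀ x, j (W.rot x) =
    if j x = V.rot (V.rot v) then V.rot (V.rot (V.rot w))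
    else if j x = V.rot (V.rot (V.rot w)) then V.rot (V.rot v)
    else if j x = V.rot (V.rot w) then V.rot (V.rot (V.rot v))
    else if j x = V.rot (V.rot (V.rot v)) then V.rot (V.rot w)
    else V.rot (j x)

/-- `W` arises from `V` by the third Reidemeister move at the triangle on the left of `a`, `b`,
`c`. -/
structure Slides (V W : VirtualDiagram) (j : W.Dart ≃ V.Dart) (a b c : V.Dart) : Prop where
  cross_a : V.rot (V.rot a) ≠ a
  cross_b : V.rot (V.rot b) ≠ b
  cross_c : V.rot (V.rot c) ≠ c
  distinct_ab : ¬ V.rot.SameCycle a b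
  distinct_bc : ¬ V.rot.SameCycle b c
  distinct_ca : ¬ V.rot.SameCycle c a
  edge_ab : V.flip a = V.rot b
  edge_bc : V.flip b = V.rot c
  edge_ca : V.flip c = V.rot a
  not_cyclic : ¬ (V.upper a = V.upper b ∧ V.upper b = V.upper c)
  upper_eq : ∀ x, W.rot (W.rot x) ≠ x → W.upper x = V.upper (j x)
  flip_eq : ∀ x, j (W.flip x) = V.slide a b c (V.flip (V.slide a b c (j x)))
  rot_eq : ∀ x, j (W.rot x) = V.rot (j x)

/-- An isomorphism of diagrams. -/
structure IsIso (V W : VirtualDiagram) (j : W.Dart ≃ V.Dart) : Prop where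
  upper_eq : ∀ x, W.rot (W.rot x) ≠ x → W.upper x = V.upper (j x)
  flip_eq : ∀ x, j (W.flip x) = V.flip (j x)
  rot_eq : ∀ x, j (W.rot x) = V.rot (j x)

section

variable {V W : VirtualDiagram} {j : W.Dart → V.Dart}

theorem IsColoring.face {φ : V.Dart → ZMod 2} (hφ : V.IsColoring φ) (x : V.Dart) :
    φ (V.rot (V.rot (V.rot (V.flip x)))) = φ x := by
  rw [hφ, V.flip_flip]

/-! ### Colourings and isomorphisms -/

theorem IsIso.coloring {j : W.Dart ≃ V.Dart} (m : IsIso V W j) {φ : V.Dart → ZMod 2}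
    (hφ : V.IsColoring φ) : W.IsColoring (φ ∘ j) := by
  intro x
  simp only [Function.comp, m.rot_eq, m.flip_eq, hφ _]

theorem IsIso.cornerSum {j : W.Dart ≃ V.Dart} (m : IsIso V W j) (φ : V.Dart → ZMod 2)
    (x : W.Dart) : W.cornerSum (φ ∘ j) x = V.cornerSum φ (j x) := by
  simp only [VirtualDiagram.cornerSum, Function.comp, m.rot_eq]

/-! ### Colourings and auxiliary points -/

theorem Erases.cases {k : V.Dart} (m : Erases V W j k) (y : V.Dart) :
    y = k ∨ y = V.rot k ∨ ∃ x, y = j x := by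
  by_cases h : y ∈ Set.range j
  · obtain ⟨x, rfl⟩ := h
    exact Or.inr (Or.inr ⟨x, rfl⟩)
  · rw [m.range_eq] at h
    simp only [Set.mem_compl_iff, not_not, Set.mem_insert_iff, Set.mem_singleton_iff] at h
    tauto

theorem Erases.ne {k : V.Dart} (m : Erases V W j k) (x : W.Dart) : j x ≠ k ∧ j x ≠ V.rot k := by
  have h : j x ∈ Set.range j := ⟨x, rfl⟩
  rw [m.range_eq] at h
  simp only [Set.mem_compl_iff, Set.mem_insert_iff, Set.mem_singleton_iff] at h
  tauto

theorem Erases.coloring {k : V.Dart} (m : Erases V W j k) {φ : V.Dart → ZMod 2}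
    (hφ : V.IsColoring φ) : W.IsColoring (φ ∘ j) := by
  intro x
  simp only [Function.comp, m.rot_eq, m.flip_eq, hφ _]
  have h1 := hφ k
  have h2 := hφ (V.rot k)
  rw [V.rot_four] at h2
  rw [m.aux] at h1
  split_ifs with h h
  · rw [h, h2]
  · rw [h, h1]
  · rfl

theorem Erases.cornerSum {k : V.Dart} (m : Erases V W j k) (φ : V.Dart → ZMod 2)
    (x : W.Dart) : W.cornerSum (φ ∘ j) x = V.cornerSum φ (j x) := by
  simp only [VirtualDiagram.cornerSum, Function.comp, m.rot_eq]

theorem Erases.exists_coloring {k : V.Dart} (m : Erases V W j k) {ψ : W.Dart → ZMod 2}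
    (hψ : W.IsColoring ψ) : ∃ φ, V.IsColoring φ ∧ φ ∘ j = ψ := by
  classical
  have n1 : V.flip k ≠ k := V.flip_ne k
  have n2 := m.not_circle
  have n3 : V.flip (V.rot k) ≠ V.rot k := V.flip_ne _
  have n4 : V.flip (V.rot k) ≠ k := fun h => n2 (by
    have := congrArg V.flip h
    rw [V.flip_flip] at this
    exact this.symm)
  have n5 : V.rot k ≠ k := V.rot_ne k
  have hk := m.aux
  obtain ⟨a, ha⟩ : ∃ a, V.flip k = j a := by
    rcases m.cases (V.flip k) with h | h | h
    · exact absurd h n1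
    · exact absurd h n2
    · exact h
  obtain ⟨b, hb⟩ : ∃ b, V.flip (V.rot k) = j b := by
    rcases m.cases (V.flip (V.rot k)) with h | h | h
    · exact absurd h n4
    · exact absurd h n3
    · exact h
  have ha' : V.flip (j a) = k := by rw [← ha, V.flip_flip]
  have hb' : V.flip (j b) = V.rot k := by rw [← hb, V.flip_flip]
  have hab : W.flip a = b := m.injective (by rw [m.flip_eq, if_pos ha', hb])
  have hba : W.flip b = a := by rw [← hab, W.flip_flip]
  let φ : V.Dart → ZMod 2 := fun y => if y = k then ψ b else if y = V.rot k then ψ a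
    else Function.extend j ψ 0 y
  have hφj : ∀ x, φ (j x) = ψ x := by
    intro x
    have := m.ne x
    simp only [φ, if_neg this.1, if_neg this.2, m.injective.extend_apply]
  have hφk : φ k = ψ b := if_pos rfl
  have hφk' : φ (V.rot k) = ψ a := by simp only [φ, if_neg n5, if_true]
  refine ⟨φ, ?_, funext hφj⟩
  intro y
  rcases m.cases y with rfl | rfl | ⟨x, rfl⟩
  · rw [hk, hφk', ha, hφj]
  · rw [V.rot_four, hφk, hb, hφj]
  · rw [← m.rot_eq, ← m.rot_eq, ← m.rot_eq, hφj, hψ]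
    by_cases h1 : V.flip (j x) = k
    · have : x = a := m.injective (by rw [← ha, ← h1, V.flip_flip])
      subst this
      rw [hab, h1, hφk]
    · by_cases h2 : V.flip (j x) = V.rot k
      · have : x = b := m.injective (by rw [← hb, ← h2, V.flip_flip])
        subst this
        rw [hba, h2, hφk']
      · have := m.flip_eq x
        rw [if_neg h1, if_neg h2] at this
        rw [← this, hφj]

/-! ### Colourings and the first move -/

theorem Untwists.cases {h : V.Dart} (m : Untwists V W j h) (y : V.Dart) :
    y = h ∨ y = V.rot h ∨ ∃ x, y = j x := by
  by_cases hy : y ∈ Set.range j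
  · obtain ⟨x, rfl⟩ := hy
    exact Or.inr (Or.inr ⟨x, rfl⟩)
  · rw [m.range_eq] at hy
    simp only [Set.mem_compl_iff, not_not, Set.mem_insert_iff, Set.mem_singleton_iff] at hy
    tauto

theorem Untwists.ne {h : V.Dart} (m : Untwists V W j h) (x : W.Dart) :
    j x ≠ h ∧ j x ≠ V.rot h := by
  have hx : j x ∈ Set.range j := ⟨x, rfl⟩
  rw [m.range_eq] at hx
  simp only [Set.mem_compl_iff, Set.mem_insert_iff, Set.mem_singleton_iff] at hx
  tauto

/-- After the first move, the crossing has become the auxiliary point with the darts `p`, `q`. -/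
theorem Untwists.exists_aux {h : V.Dart} (m : Untwists V W j h) : ∃ p q : W.Dart,
    j p = V.rot (V.rot h) ∧ j q = V.rot (V.rot (V.rot h)) ∧ W.rot p = q ∧ W.rot q = p ∧
    ∀ x, x ≠ p → x ≠ q → j (W.rot x) = V.rot (j x) ∧ ¬ V.rot.SameCycle h (j x) := by
  obtain ⟨a1, a2, a3, a4, a5, a6⟩ := ne_of_crossing m.cross
  obtain ⟨p, hp⟩ : ∃ p, V.rot (V.rot h) = j p := by
    rcases m.cases (V.rot (V.rot h)) with e | e | e
    · exact absurd e a2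
    · exact absurd e a4
    · exact e
  obtain ⟨q, hq⟩ : ∃ q, V.rot (V.rot (V.rot h)) = j q := by
    rcases m.cases (V.rot (V.rot (V.rot h))) with e | e | e
    · exact absurd e a3
    · exact absurd e a5
    · exact e
  refine ⟨p, q, hp.symm, hq.symm, m.injective ?_, m.injective ?_, ?_⟩
  · rw [m.rot_eq, if_pos hp.symm, hq]
  · rw [m.rot_eq, if_neg, if_pos hq.symm, hp]
    rw [← hq]
    exact a6
  · intro x h1 h2
    have h3 : j x ≠ V.rot (V.rot h) := fun e => h1 (m.injective (e.trans hp))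
    have h4 : j x ≠ V.rot (V.rot (V.rot h)) := fun e => h2 (m.injective (e.trans hq))
    refine ⟨by rw [m.rot_eq, if_neg h3, if_neg h4], ?_⟩
    rw [V.sameCycle_rot]
    have := m.ne x
    tauto

theorem Untwists.side {h : V.Dart} (m : Untwists V W j h) {φ : V.Dart → ZMod 2}
    (hφ : V.IsColoring φ) : φ (V.rot (V.rot (V.rot h))) = φ (V.rot h) := by
  rw [hφ, m.monogon]

theorem Untwists.coloring {h : V.Dart} (m : Untwists V W j h) {φ : V.Dart → ZMod 2}
    (hφ : V.IsColoring φ) : W.IsColoring (φ ∘ j) := by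
  obtain ⟨p, q, hp, hq, hpq, hqp, hx⟩ := m.exists_aux
  intro x
  simp only [Function.comp]
  by_cases h1 : x = p
  · subst h1
    rw [hpq, hqp, hpq, m.flip_eq, ← hφ, hp, hq, V.rot_four, m.side hφ]
  by_cases h2 : x = q
  · subst h2
    rw [hqp, hpq, hqp, m.flip_eq, ← hφ, hp, hq, V.rot_four]
  have hr : ∀ x, x ≠ p → x ≠ q → W.rot x ≠ p ∧ W.rot x ≠ q := by
    intro x h1 h2
    refine ⟨fun e => h2 ?_, fun e => h1 ?_⟩
    · rw [← hqp] at e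
      exact W.rot.injective e
    · rw [← hpq] at e
      exact W.rot.injective e
  obtain ⟨h3, h4⟩ := hr x h1 h2
  obtain ⟨h5, h6⟩ := hr _ h3 h4
  rw [(hx _ h5 h6).1, (hx _ h3 h4).1, (hx _ h1 h2).1, m.flip_eq, hφ]

theorem Untwists.cornerSum {h : V.Dart} (m : Untwists V W j h) (φ : V.Dart → ZMod 2)
    (x : W.Dart) (hx : ¬ V.rot.SameCycle h (j x)) :
    W.cornerSum (φ ∘ j) x = V.cornerSum φ (j x) := by
  obtain ⟨p, q, hp, hq, hpq, hqp, hx'⟩ := m.exists_aux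
  have h1 : ∀ x, ¬ V.rot.SameCycle h (j x) → j (W.rot x) = V.rot (j x) := by
    intro x hx
    rw [V.sameCycle_rot] at hx
    refine (hx' x ?_ ?_).1
    · rintro rfl
      tauto
    · rintro rfl
      tauto
  have h2 : ∀ x, ¬ V.rot.SameCycle h (j x) → ¬ V.rot.SameCycle h (j (W.rot x)) := by
    intro x hx
    rwa [h1 x hx, Equiv.Perm.sameCycle_apply_right]
  simp only [VirtualDiagram.cornerSum, Function.comp]
  rw [h1 _ (h2 _ (h2 x hx)), h1 _ (h2 x hx), h1 x hx]

end

end VirtualDiagram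

namespace VirtualDiagram

/-! ### Colourings and the second move -/

section

variable {V W : VirtualDiagram} {j : W.Dart → V.Dart}

theorem Separates.cases {v w : V.Dart} (m : Separates V W j v w) (y : V.Dart) :
    y = v ∨ y = V.rot v ∨ y = w ∨ y = V.rot w ∨ ∃ x, y = j x := by
  by_cases hy : y ∈ Set.range j
  · obtain ⟨x, rfl⟩ := hy
    simp
  · rw [m.range_eq] at hy
    simp only [Set.mem_compl_iff, not_not, Set.mem_insert_iff, Set.mem_singleton_iff] at hy
    tauto

theorem Separates.ne {v w : V.Dart} (m : Separates V W j v w) (x : W.Dart) :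
    j x ≠ v ∧ j x ≠ V.rot v ∧ j x ≠ w ∧ j x ≠ V.rot w := by
  have hx : j x ∈ Set.range j := ⟨x, rfl⟩
  rw [m.range_eq] at hx
  simp only [Set.mem_compl_iff, Set.mem_insert_iff, Set.mem_singleton_iff] at hx
  tauto

theorem ne_of_not_sameCycle {v w : V.Dart} (h : ¬ V.rot.SameCycle v w) {x y : V.Dart}
    (hx : V.rot.SameCycle v x) (hy : V.rot.SameCycle w y) : x ≠ y := by
  rintro rfl
  exact h (hx.trans hy.symm)

theorem sameCycle_self (x : V.Dart) : V.rot.SameCycle x x ∧ V.rot.SameCycle x (V.rot x) ∧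
    V.rot.SameCycle x (V.rot (V.rot x)) ∧ V.rot.SameCycle x (V.rot (V.rot (V.rot x))) := by
  simp [sameCycle_rot]

/-- After the second move, the two crossings have become two auxiliary points: the one with darts
`p`, `p'` on the one strand and the one with darts `q`, `q'` on the other. -/
theorem Separates.exists_aux {v w : V.Dart} (m : Separates V W j v w) : ∃ p p' q q' : W.Dart,
    j p = V.rot (V.rot v) ∧ j p' = V.rot (V.rot (V.rot w)) ∧
    j q = V.rot (V.rot w) ∧ j q' = V.rot (V.rot (V.rot v)) ∧
    W.rot p = p' ∧ W.rot p' = p ∧ W.rot q = q' ∧ W.rot q' = q ∧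
    ∀ x, x ≠ p → x ≠ p' → x ≠ q → x ≠ q' → j (W.rot x) = V.rot (j x) ∧
      ¬ V.rot.SameCycle v (j x) ∧ ¬ V.rot.SameCycle w (j x) := by
  obtain ⟨a1, a2, a3, a4, a5, a6⟩ := ne_of_crossing m.cross_v
  obtain ⟨b1, b2, b3, b4, b5, b6⟩ := ne_of_crossing m.cross_w
  obtain ⟨v0, v1, v2, v3⟩ := sameCycle_self v
  obtain ⟨w0, w1, w2, w3⟩ := sameCycle_self w
  have ne := fun {x y} => ne_of_not_sameCycle (x := x) (y := y) m.distinct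
  have hj : ∀ y, y ≠ v → y ≠ V.rot v → y ≠ w → y ≠ V.rot w → ∃ x, j x = y := by
    intro y h1 h2 h3 h4
    rcases m.cases y with e | e | e | e | ⟨x, e⟩
    · exact absurd e h1
    · exact absurd e h2
    · exact absurd e h3
    · exact absurd e h4
    · exact ⟨x, e.symm⟩
  obtain ⟨p, hp⟩ := hj (V.rot (V.rot v)) a2 a4 (ne v2 w0) (ne v2 w1)
  obtain ⟨q', hq'⟩ := hj (V.rot (V.rot (V.rot v))) a3 a5 (ne v3 w0) (ne v3 w1)
  obtain ⟨q, hq⟩ := hj (V.rot (V.rot w)) (ne v0 w2).symm (ne v1 w2).symm b2 b4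
  obtain ⟨p', hp'⟩ := hj (V.rot (V.rot (V.rot w))) (ne v0 w3).symm (ne v1 w3).symm b3 b5
  refine ⟨p, p', q, q', hp, hp', hq, hq', m.injective ?_, m.injective ?_, m.injective ?_,
    m.injective ?_, ?_⟩
  · rw [m.rot_eq, if_pos hp, hp']
  · rw [m.rot_eq, hp', if_neg (ne v2 w3).symm, if_pos rfl, hp]
  · rw [m.rot_eq, hq, if_neg (ne v2 w2).symm, if_neg b6.symm, if_pos rfl, hq']
  · rw [m.rot_eq, hq', if_neg a6, if_neg (ne v3 w3), if_neg (ne v3 w2), if_pos rfl, hq]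
  · intro x h1 h2 h3 h4
    have h1' : j x ≠ V.rot (V.rot v) := fun e => h1 (m.injective (e.trans hp.symm))
    have h2' : j x ≠ V.rot (V.rot (V.rot w)) := fun e => h2 (m.injective (e.trans hp'.symm))
    have h3' : j x ≠ V.rot (V.rot w) := fun e => h3 (m.injective (e.trans hq.symm))
    have h4' : j x ≠ V.rot (V.rot (V.rot v)) := fun e => h4 (m.injective (e.trans hq'.symm))
    refine ⟨by rw [m.rot_eq, if_neg h1', if_neg h2', if_neg h3', if_neg h4'], ?_⟩
    rw [V.sameCycle_rot, V.sameCycle_rot]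
    have := m.ne x
    tauto

/-- Colours around a bigon: the bigon itself, and the regions next to its two strands. -/
theorem Separates.sides {v w : V.Dart} (m : Separates V W j v w) {φ : V.Dart → ZMod 2}
    (hφ : V.IsColoring φ) : φ v = φ w ∧ φ (V.rot w) = φ (V.rot (V.rot (V.rot v))) ∧
      φ (V.rot v) = φ (V.rot (V.rot (V.rot w))) := by
  have h1 := hφ.face v
  have h2 := hφ v
  have h3 := hφ w
  rw [m.edge_vw, V.rot_four] at h1
  rw [m.edge_vw] at h2
  rw [m.edge_wv] at h3
  exact ⟨h1.symm, h2.symm, h3.symm⟩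

/-- The two far regions, which the second move merges, have the same colour if the corner sums at
the two corners agree. -/
theorem Separates.opposite {v w : V.Dart} (m : Separates V W j v w) {φ : V.Dart → ZMod 2}
    (hφ : V.IsColoring φ) (hS : V.cornerSum φ v = V.cornerSum φ w) :
    φ (V.rot (V.rot v)) = φ (V.rot (V.rot w)) := by
  obtain ⟨h1, h2, h3⟩ := m.sides hφ
  unfold VirtualDiagram.cornerSum at hS
  rw [h1, h2, h3] at hS
  have : ∀ a b c d e : ZMod 2, a + b + c + d = a + d + e + b → c = e := by decide
  exact this _ _ _ _ _ hS

/-- A colouring survives the second move if the merged regions have the same colour. -/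
theorem Separates.coloring {v w : V.Dart} (m : Separates V W j v w) {φ : V.Dart → ZMod 2}
    (hφ : V.IsColoring φ) (hS : V.cornerSum φ v = V.cornerSum φ w) : W.IsColoring (φ ∘ j) := by
  obtain ⟨p, p', q, q', hp, hp', hq, hq', hpp, hpp', hqq, hqq', hx⟩ := m.exists_aux
  obtain ⟨s1, s2, s3⟩ := m.sides hφ
  have s4 := m.opposite hφ hS
  intro x
  simp only [Function.comp]
  rw [m.flip_eq, ← hφ]
  by_cases h1 : x = p
  · subst h1
    rw [hpp, hpp', hpp, hp, hp', V.rot_four, s3]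
  by_cases h2 : x = p'
  · subst h2
    rw [hpp', hpp, hpp', hp, hp', V.rot_four, s4]
  by_cases h3 : x = q
  · subst h3
    rw [hqq, hqq', hqq, hq, hq', V.rot_four, s2]
  by_cases h4 : x = q'
  · subst h4
    rw [hqq', hqq, hqq', hq, hq', V.rot_four, s4]
  have hr : ∀ x, (x ≠ p ∧ x ≠ p' ∧ x ≠ q ∧ x ≠ q') →
      (W.rot x ≠ p ∧ W.rot x ≠ p' ∧ W.rot x ≠ q ∧ W.rot x ≠ q') := by
    rintro x ⟨h1, h2, h3, h4⟩
    refine ⟨fun e => h2 ?_, fun e => h1 ?_, fun e => h4 ?_, fun e => h3 ?_⟩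
    · exact W.rot.injective (e.trans hpp'.symm)
    · exact W.rot.injective (e.trans hpp.symm)
    · exact W.rot.injective (e.trans hqq'.symm)
    · exact W.rot.injective (e.trans hqq.symm)
  have h5 := hr x ⟨h1, h2, h3, h4⟩
  have h6 := hr _ h5
  rw [(hx _ h6.1 h6.2.1 h6.2.2.1 h6.2.2.2).1, (hx _ h5.1 h5.2.1 h5.2.2.1 h5.2.2.2).1,
    (hx _ h1 h2 h3 h4).1]

theorem Separates.rot_of_not {v w : V.Dart} (m : Separates V W j v w) (x : W.Dart)
    (hv : ¬ V.rot.SameCycle v (j x)) (hw : ¬ V.rot.SameCycle w (j x)) :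
    j (W.rot x) = V.rot (j x) := by
  obtain ⟨p, p', q, q', hp, hp', hq, hq', hpp, hpp', hqq, hqq', hx'⟩ := m.exists_aux
  rw [V.sameCycle_rot] at hv hw
  refine (hx' x ?_ ?_ ?_ ?_).1 <;> rintro rfl <;> tauto

/-- If the two strands of the separated diagram face the same region, every colouring of it extends
to the bigon. -/
theorem Separates.exists_coloring {v w : V.Dart} (m : Separates V W j v w)
    {p q : W.Dart} (hp : j p = V.rot (V.rot v)) (hq : j q = V.rot (V.rot w))
    {ψ : W.Dart → ZMod 2} (hψ : W.IsColoring ψ) (hpq : ψ p = ψ q) :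
    ∃ φ, V.IsColoring φ ∧ φ ∘ j = ψ ∧ V.cornerSum φ v = 0 ∧ V.cornerSum φ w = 0 := by
  classical
  obtain ⟨p₁, p', q₁, q', hp₁, hp', hq₁, hq', hpp, hpp', hqq, hqq', hx⟩ := m.exists_aux
  obtain rfl : p₁ = p := m.injective (hp₁.trans hp.symm)
  obtain rfl : q₁ = q := m.injective (hq₁.trans hq.symm)
  obtain ⟨a1, a2, a3, a4, a5, a6⟩ := ne_of_crossing m.cross_v
  obtain ⟨b1, b2, b3, b4, b5, b6⟩ := ne_of_crossing m.cross_w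
  obtain ⟨v0, v1, v2, v3⟩ := sameCycle_self v
  obtain ⟨w0, w1, w2, w3⟩ := sameCycle_self w
  have ne := fun {x y} => ne_of_not_sameCycle (x := x) (y := y) m.distinct
  let t := ψ p₁ + ψ p' + ψ q'
  let φ : V.Dart → ZMod 2 := fun y => if y = v ∨ y = w then t else if y = V.rot v then ψ p'
    else if y = V.rot w then ψ q' else Function.extend j ψ 0 y
  have hφj : ∀ x, φ (j x) = ψ x := by
    intro x
    obtain ⟨h1, h2, h3, h4⟩ := m.ne x
    simp only [φ, h1, h2, h3, h4, or_self, if_false, m.injective.extend_apply]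
  have e1 : φ v = t := by simp [φ]
  have e2 : φ w = t := by simp [φ]
  have e3 : φ (V.rot v) = ψ p' := by simp [φ, a1, ne v1 w0]
  have e4 : φ (V.rot w) = ψ q' := by simp [φ, b1, (ne v0 w1).symm, (ne v1 w1).symm]
  have key : ∀ a b c : ZMod 2, a + b + c + b + a + c = 0 := by decide
  refine ⟨φ, ?_, funext hφj, ?_, ?_⟩
  · intro y
    rcases m.cases y with rfl | rfl | rfl | rfl | ⟨x, rfl⟩
    · rw [m.edge_vw, ← hq', hφj, e4]
    · rw [V.rot_four, ← m.edge_wv, V.flip_flip, e1, e2]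
    · rw [m.edge_wv, ← hp', hφj, e3]
    · rw [V.rot_four, ← m.edge_vw, V.flip_flip, e1, e2]
    · rw [← m.flip_eq, hφj, ← hψ]
      by_cases h1 : x = p₁
      · subst h1
        rw [hp, V.rot_four, e3, hpp, hpp', hpp]
      by_cases h2 : x = p'
      · subst h2
        rw [hp', V.rot_four, ← hq, hφj, hpp', hpp, hpp', hpq]
      by_cases h3 : x = q₁
      · subst h3
        rw [hq, V.rot_four, e4, hqq, hqq', hqq]
      by_cases h4 : x = q'
      · subst h4
        rw [hq', V.rot_four, ← hp, hφj, hqq', hqq, hqq', hpq]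
      have hr : ∀ x, (x ≠ p₁ ∧ x ≠ p' ∧ x ≠ q₁ ∧ x ≠ q') →
          (W.rot x ≠ p₁ ∧ W.rot x ≠ p' ∧ W.rot x ≠ q₁ ∧ W.rot x ≠ q') := by
        rintro x ⟨h1, h2, h3, h4⟩
        refine ⟨fun e => h2 ?_, fun e => h1 ?_, fun e => h4 ?_, fun e => h3 ?_⟩
        · exact W.rot.injective (e.trans hpp'.symm)
        · exact W.rot.injective (e.trans hpp.symm)
        · exact W.rot.injective (e.trans hqq'.symm)
        · exact W.rot.injective (e.trans hqq.symm)
      have h5 := hr x ⟨h1, h2, h3, h4⟩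
      have h6 := hr _ h5
      rw [← (hx _ h1 h2 h3 h4).1, ← (hx _ h5.1 h5.2.1 h5.2.2.1 h5.2.2.2).1,
        ← (hx _ h6.1 h6.2.1 h6.2.2.1 h6.2.2.2).1, hφj]
  · unfold VirtualDiagram.cornerSum
    rw [e1, e3, ← hq', ← hp, hφj, hφj]
    exact key _ _ _
  · unfold VirtualDiagram.cornerSum
    rw [e2, e4, ← hp', ← hq, hφj, hφj, ← hpq]
    have : ∀ a b c : ZMod 2, a + b + c + c + a + b = 0 := by decide
    exact this _ _ _

open Classical in
/-- Changing the colour of a bigon exchanges the corner sums at its two corners. -/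
theorem Separates.toggle {v w : V.Dart} (m : Separates V W j v w) {φ : V.Dart → ZMod 2}
    (hφ : V.IsColoring φ) : ∃ φ', V.IsColoring φ' ∧ φ' ∘ j = φ ∘ j ∧
      (∀ x, V.cornerSum φ' x = V.cornerSum φ x + (if V.rot.SameCycle v x then 1 else 0) +
        (if V.rot.SameCycle w x then 1 else 0)) := by
  classical
  obtain ⟨a1, a2, a3, a4, a5, a6⟩ := ne_of_crossing m.cross_v
  obtain ⟨b1, b2, b3, b4, b5, b6⟩ := ne_of_crossing m.cross_w
  obtain ⟨v0, v1, v2, v3⟩ := sameCycle_self v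
  obtain ⟨w0, w1, w2, w3⟩ := sameCycle_self w
  have ne := fun {x y} => ne_of_not_sameCycle (x := x) (y := y) m.distinct
  let τ : V.Dart → ZMod 2 := fun y => if y = v ∨ y = w then 1 else 0
  have hface : ∀ y, τ (V.rot (V.rot (V.rot (V.flip y)))) = τ y := by
    intro y
    have hv : V.rot (V.rot (V.rot (V.flip y))) = v ↔ y = w := by
      constructor
      · intro h
        have h' := congrArg V.rot h
        rw [V.rot_four, ← m.edge_wv] at h'
        exact V.flip.injective h'
      · rintro rfl
        rw [m.edge_wv, V.rot_four]
    have hw : V.rot (V.rot (V.rot (V.flip y))) = w ↔ y = v := by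
      constructor
      · intro h
        have h' := congrArg V.rot h
        rw [V.rot_four, ← m.edge_vw] at h'
        exact V.flip.injective h'
      · rintro rfl
        rw [m.edge_vw, V.rot_four]
    simp only [τ, hv, hw, or_comm]
  have hτ : V.IsColoring τ := by
    intro y
    have := hface (V.flip y)
    rwa [V.flip_flip] at this
  refine ⟨φ + τ, V.colorings.add_mem hφ hτ, ?_, ?_⟩
  · funext x
    obtain ⟨h1, h2, h3, h4⟩ := m.ne x
    simp [τ, h1, h3]
  · have hSv : V.cornerSum τ v = 1 := by
      simp [VirtualDiagram.cornerSum, τ, a1, a2, a3, ne v1 w0, ne v2 w0, ne v3 w0]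
    have hSw : V.cornerSum τ w = 1 := by
      simp [VirtualDiagram.cornerSum, τ, b1, b2, b3, (ne v0 w1).symm, (ne v0 w2).symm,
        (ne v0 w3).symm]
    have hinv : ∀ x y, V.rot.SameCycle x y → V.cornerSum τ y = V.cornerSum τ x := by
      intro x y h
      rw [V.sameCycle_rot] at h
      rcases h with rfl | rfl | rfl | rfl <;> simp only [cornerSum_rot]
    intro x
    rw [cornerSum_add, add_assoc]
    congr 1
    by_cases hv : V.rot.SameCycle v x
    · have hw : ¬ V.rot.SameCycle w x := fun h => m.distinct (hv.trans h.symm)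
      rw [hinv _ _ hv, hSv, if_pos hv, if_neg hw, add_zero]
    · by_cases hw : V.rot.SameCycle w x
      · rw [hinv _ _ hw, hSw, if_neg hv, if_pos hw, zero_add]
      · rw [if_neg hv, if_neg hw]
        rw [V.sameCycle_rot] at hv hw
        have e : ∀ y, V.rot y ≠ v → V.rot y ≠ w → τ (V.rot y) = 0 := by
          intro y h1 h2
          simp [τ, h1, h2]
        have e0 : τ x = 0 := by simp [τ]; tauto
        have r : ∀ a y : V.Dart, V.rot y = a → y = V.rot (V.rot (V.rot a)) := by
          rintro a y rfl
          rw [V.rot_four]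
        have l1 : τ (V.rot x) = 0 := e _ (fun h => by have := r _ _ h; tauto)
          (fun h => by have := r _ _ h; tauto)
        have l2 : τ (V.rot (V.rot x)) = 0 := by
          refine e _ (fun h => ?_) (fun h => ?_)
          · have := r _ _ (r _ _ h)
            simp only [V.rot_four] at this
            tauto
          · have := r _ _ (r _ _ h)
            simp only [V.rot_four] at this
            tauto
        have l3 : τ (V.rot (V.rot (V.rot x))) = 0 := by
          refine e _ (fun h => ?_) (fun h => ?_)
          · have := r _ _ (r _ _ (r _ _ h))
            simp only [V.rot_four] at this
            tauto
          · have := r _ _ (r _ _ (r _ _ h))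
            simp only [V.rot_four] at this
            tauto
        unfold VirtualDiagram.cornerSum
        rw [e0, l1, l2, l3]
        rfl

end

end VirtualDiagram

namespace VirtualDiagram

section

variable {V W : VirtualDiagram}

/-! ### Colourings and the third move -/

theorem mem_triangle {a b c y : V.Dart} : y ∈ V.triangle a b c ↔
    y = a ∨ y = V.rot a ∨ y = b ∨ y = V.rot b ∨ y = c ∨ y = V.rot c := by
  simp only [triangle, Set.mem_insert_iff, Set.mem_singleton_iff]

/-- The configuration of the third move: three different crossings at the corners of a
triangular region. -/
structure IsTriangle (V : VirtualDiagram) (a b c : V.Dart) : Prop where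
  cross_a : V.rot (V.rot a) ≠ a
  cross_b : V.rot (V.rot b) ≠ b
  cross_c : V.rot (V.rot c) ≠ c
  distinct_ab : ¬ V.rot.SameCycle a b
  distinct_bc : ¬ V.rot.SameCycle b c
  distinct_ca : ¬ V.rot.SameCycle c a
  edge_ab : V.flip a = V.rot b
  edge_bc : V.flip b = V.rot c
  edge_ca : V.flip c = V.rot a

theorem Slides.isTriangle {j : W.Dart ≃ V.Dart} {a b c : V.Dart} (m : Slides V W j a b c) :
    IsTriangle V a b c :=
  ⟨m.cross_a, m.cross_b, m.cross_c, m.distinct_ab, m.distinct_bc, m.distinct_ca, m.edge_ab,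
    m.edge_bc, m.edge_ca⟩

namespace IsTriangle

variable {a b c : V.Dart}

theorem rotate (t : IsTriangle V a b c) : IsTriangle V b c a :=
  ⟨t.cross_b, t.cross_c, t.cross_a, t.distinct_bc, t.distinct_ca, t.distinct_ab, t.edge_bc,
    t.edge_ca, t.edge_ab⟩

theorem flip_rot (t : IsTriangle V a b c) : V.flip (V.rot a) = c := by
  rw [← t.edge_ca, V.flip_flip]

theorem flip_mem (t : IsTriangle V a b c) {y : V.Dart} (hy : y ∈ V.triangle a b c) :
    V.flip y ∈ V.triangle a b c := by
  rw [mem_triangle] at hy ⊢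
  rcases hy with rfl | rfl | rfl | rfl | rfl | rfl
  · rw [t.edge_ab]; simp
  · rw [t.flip_rot]; simp
  · rw [t.edge_bc]; simp
  · rw [t.rotate.flip_rot]; simp
  · rw [t.edge_ca]; simp
  · rw [t.rotate.rotate.flip_rot]; simp

theorem across_notMem (t : IsTriangle V a b c) {y : V.Dart} (hy : y ∈ V.triangle a b c) :
    V.rot (V.rot y) ∉ V.triangle a b c := by
  obtain ⟨a0, a1, a2, a3⟩ := sameCycle_self a
  obtain ⟨b0, b1, b2, b3⟩ := sameCycle_self b
  obtain ⟨c0, c1, c2, c3⟩ := sameCycle_self c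
  have ab := fun {x y} => ne_of_not_sameCycle (x := x) (y := y) t.distinct_ab
  have bc := fun {x y} => ne_of_not_sameCycle (x := x) (y := y) t.distinct_bc
  have ca := fun {x y} => ne_of_not_sameCycle (x := x) (y := y) t.distinct_ca
  obtain ⟨_, na2, na3, na4, na5, _⟩ := ne_of_crossing t.cross_a
  obtain ⟨_, nb2, nb3, nb4, nb5, _⟩ := ne_of_crossing t.cross_b
  obtain ⟨_, nc2, nc3, nc4, nc5, _⟩ := ne_of_crossing t.cross_c
  rw [mem_triangle] at hy ⊢
  rcases hy with rfl | rfl | rfl | rfl | rfl | rfl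
  · simp [na2, na4, ab a2 b0, ab a2 b1, (ca c0 a2).symm, (ca c1 a2).symm]
  · simp [na3, na5, ab a3 b0, ab a3 b1, (ca c0 a3).symm, (ca c1 a3).symm]
  · simp [nb2, nb4, bc b2 c0, bc b2 c1, (ab a0 b2).symm, (ab a1 b2).symm]
  · simp [nb3, nb5, bc b3 c0, bc b3 c1, (ab a0 b3).symm, (ab a1 b3).symm]
  · simp [nc2, nc4, ca c2 a0, ca c2 a1, (bc b0 c2).symm, (bc b1 c2).symm]
  · simp [nc3, nc5, ca c3 a0, ca c3 a1, (bc b0 c3).symm, (bc b1 c3).symm]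

theorem slide_of_mem {y : V.Dart} (hy : y ∈ V.triangle a b c) :
    V.slide a b c y = V.rot (V.rot (V.flip y)) := if_pos hy

theorem slide_across (t : IsTriangle V a b c) {y : V.Dart} (hy : y ∈ V.triangle a b c) :
    V.slide a b c (V.rot (V.rot y)) = V.flip y := by
  unfold slide
  rw [if_neg (t.across_notMem hy), V.rot_four, if_pos hy]

theorem slide_of_notMem {y : V.Dart} (h1 : y ∉ V.triangle a b c)
    (h2 : V.rot (V.rot y) ∉ V.triangle a b c) : V.slide a b c y = y := by
  unfold slide
  rw [if_neg h1, if_neg h2]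

theorem slide_slide (t : IsTriangle V a b c) (y : V.Dart) :
    V.slide a b c (V.slide a b c y) = y := by
  by_cases h1 : y ∈ V.triangle a b c
  · rw [slide_of_mem h1, t.slide_across (t.flip_mem h1), V.flip_flip]
  · by_cases h2 : V.rot (V.rot y) ∈ V.triangle a b c
    · have e := t.slide_across h2
      rw [V.rot_four] at e
      rw [e, slide_of_mem (t.flip_mem h2), V.flip_flip, V.rot_four]
    · rw [slide_of_notMem h1 h2, slide_of_notMem h1 h2]

theorem across_slide_notMem (t : IsTriangle V a b c) {y : V.Dart} (hy : y ∉ V.triangle a b c) :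
    V.rot (V.rot (V.slide a b c y)) ∉ V.triangle a b c := by
  by_cases h2 : V.rot (V.rot y) ∈ V.triangle a b c
  · have e := t.slide_across h2
    rw [V.rot_four] at e
    rw [e]
    exact t.across_notMem (t.flip_mem h2)
  · rwa [slide_of_notMem hy h2]

theorem flip_notMem (t : IsTriangle V a b c) {y : V.Dart} (hy : y ∉ V.triangle a b c) :
    V.flip y ∉ V.triangle a b c := by
  intro h
  have := t.flip_mem h
  rw [V.flip_flip] at this
  exact hy this

theorem mem (a b c : V.Dart) : a ∈ V.triangle a b c ∧ V.rot a ∈ V.triangle a b c ∧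
    b ∈ V.triangle a b c ∧ V.rot b ∈ V.triangle a b c ∧
    c ∈ V.triangle a b c ∧ V.rot c ∈ V.triangle a b c := by
  simp [mem_triangle]

end IsTriangle

theorem Slides.rot_symm {j : W.Dart ≃ V.Dart} {a b c : V.Dart} (m : Slides V W j a b c)
    (y : V.Dart) : W.rot (j.symm y) = j.symm (V.rot y) := by
  rw [Equiv.eq_symm_apply, m.rot_eq, j.apply_symm_apply]

theorem Slides.flip_symm {j : W.Dart ≃ V.Dart} {a b c : V.Dart} (m : Slides V W j a b c)
    (y : V.Dart) : W.flip (j.symm y) = j.symm (V.slide a b c (V.flip (V.slide a b c y))) := by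
  rw [Equiv.eq_symm_apply, m.flip_eq, j.apply_symm_apply]

theorem Slides.mem_triangle_symm {j : W.Dart ≃ V.Dart} {a b c : V.Dart} (m : Slides V W j a b c)
    (y : V.Dart) : j.symm y ∈ W.triangle (j.symm (V.rot (V.rot a))) (j.symm (V.rot (V.rot b)))
      (j.symm (V.rot (V.rot c))) ↔ V.rot (V.rot y) ∈ V.triangle a b c := by
  have rs := m.rot_symm
  have r : ∀ y z, y = V.rot (V.rot z) ↔ V.rot (V.rot y) = z := by
    intro y z
    constructor
    · rintro rfl
      rw [V.rot_four]
    · rintro rfl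
      rw [V.rot_four]
  simp only [mem_triangle, rs, j.symm.apply_eq_iff_eq]
  rw [r, r y b, r y c]
  rw [show (y = V.rot (V.rot (V.rot a))) ↔ _ from r y (V.rot a),
    show (y = V.rot (V.rot (V.rot b))) ↔ _ from r y (V.rot b),
    show (y = V.rot (V.rot (V.rot c))) ↔ _ from r y (V.rot c)]

theorem Slides.slide_symm {j : W.Dart ≃ V.Dart} {a b c : V.Dart} (m : Slides V W j a b c)
    (y : V.Dart) : W.slide (j.symm (V.rot (V.rot a))) (j.symm (V.rot (V.rot b)))
      (j.symm (V.rot (V.rot c))) (j.symm y) = j.symm (V.slide a b c y) := by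
  have t := m.isTriangle
  have rs := m.rot_symm
  have tri := m.mem_triangle_symm
  have edge : ∀ y, y ∈ V.triangle a b c →
      W.flip (j.symm (V.rot (V.rot y))) = j.symm (V.rot (V.rot (V.flip y))) := by
    intro y hy
    rw [m.flip_symm, t.slide_across hy, V.flip_flip, IsTriangle.slide_of_mem hy]
  by_cases h2 : V.rot (V.rot y) ∈ V.triangle a b c
  · rw [IsTriangle.slide_of_mem ((tri y).2 h2)]
    have e1 := t.slide_across h2
    rw [V.rot_four] at e1
    have e2 := edge _ h2
    rw [V.rot_four] at e2
    rw [e1, e2, rs, rs, V.rot_four]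
  · by_cases h1 : y ∈ V.triangle a b c
    · unfold slide
      rw [if_neg (fun h => h2 ((tri y).1 h)), if_pos h1, rs, rs, if_pos, edge y h1]
      rw [tri, V.rot_four]
      exact h1
    · rw [IsTriangle.slide_of_notMem h1 h2, IsTriangle.slide_of_notMem]
      · exact fun h => h2 ((tri y).1 h)
      · rw [rs, rs, tri, V.rot_four]
        exact h1

/-- The third move is its own inverse: it can be undone at the new triangle. -/
theorem Slides.symm {j : W.Dart ≃ V.Dart} {a b c : V.Dart} (m : Slides V W j a b c) :
    Slides W V j.symm (j.symm (V.rot (V.rot a))) (j.symm (V.rot (V.rot b)))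
      (j.symm (V.rot (V.rot c))) := by
  have t := m.isTriangle
  have rs := m.rot_symm
  have fs := m.flip_symm
  have cyc : ∀ y z, W.rot.SameCycle (j.symm y) (j.symm z) ↔ V.rot.SameCycle y z := by
    intro y z
    simp only [sameCycle_rot, rs, j.symm.apply_eq_iff_eq]
  have cyc2 : ∀ y z, W.rot.SameCycle (j.symm (V.rot (V.rot y))) (j.symm (V.rot (V.rot z))) ↔
      V.rot.SameCycle y z := by
    intro y z
    rw [cyc]
    simp
  have cr : ∀ y, V.rot (V.rot y) ≠ y →
      W.rot (W.rot (j.symm (V.rot (V.rot y)))) ≠ j.symm (V.rot (V.rot y)) := by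
    intro y hy
    rw [rs, rs, Ne, j.symm.apply_eq_iff_eq, V.rot_four]
    exact hy.symm
  obtain ⟨ma, ma', mb, mb', mc, mc'⟩ := IsTriangle.mem a b c
  have edge : ∀ y, y ∈ V.triangle a b c →
      W.flip (j.symm (V.rot (V.rot y))) = j.symm (V.rot (V.rot (V.flip y))) := by
    intro y hy
    rw [fs, t.slide_across hy, V.flip_flip, IsTriangle.slide_of_mem hy]
  have hu : ∀ y, V.rot (V.rot y) ≠ y → W.upper (j.symm y) = V.upper y := by
    intro y hy
    rw [m.upper_eq, j.apply_symm_apply]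
    rw [rs, rs, Ne, j.symm.apply_eq_iff_eq]
    exact hy
  have up2 : ∀ y, V.rot (V.rot y) ≠ y → V.upper (V.rot (V.rot y)) = V.upper y := by
    intro y hy
    rw [V.upper_rot, V.upper_rot _ hy, Bool.not_not]
    exact fun e => hy (V.rot.injective e)
  constructor
  · exact cr _ m.cross_a
  · exact cr _ m.cross_b
  · exact cr _ m.cross_c
  · rw [cyc2]; exact m.distinct_ab
  · rw [cyc2]; exact m.distinct_bc
  · rw [cyc2]; exact m.distinct_ca
  · rw [edge a ma, m.edge_ab, rs]
  · rw [edge b mb, m.edge_bc, rs]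
  · rw [edge c mc, m.edge_ca, rs]
  · have cr' : ∀ y, V.rot (V.rot y) ≠ y → V.rot (V.rot (V.rot (V.rot y))) ≠ V.rot (V.rot y) :=
      fun y hy e => hy (by rwa [V.rot_four, eq_comm] at e)
    rw [hu _ (cr' a m.cross_a), hu _ (cr' b m.cross_b), hu _ (cr' c m.cross_c), up2 a m.cross_a,
      up2 b m.cross_b, up2 c m.cross_c]
    exact m.not_cyclic
  · exact fun y hy => (hu y hy).symm
  · intro y
    rw [m.slide_symm, fs, m.slide_symm, t.slide_slide, t.slide_slide]
  · exact fun y => (rs y).symm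

end

end VirtualDiagram

namespace VirtualDiagram

section

variable {V W : VirtualDiagram}

set_option maxHeartbeats 1000000 in
open Classical in
/-- The third move transports colourings: a region away from the triangle keeps its colour, and the
colour of the new triangle is determined by the requirement that corner sums do not change. -/
theorem Slides.exists_coloring {j : W.Dart ≃ V.Dart} {a b c : V.Dart} (m : Slides V W j a b c)
    {φ : V.Dart → ZMod 2} (hφ : V.IsColoring φ) : ∃ ψ, W.IsColoring ψ ∧
      (∀ y, y ∉ V.triangle a b c → ψ (j.symm (V.slide a b c y)) = φ y) ∧
      (∀ x, W.cornerSum ψ x = V.cornerSum φ (j x)) := by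
  have t := m.isTriangle
  have rs : ∀ y, W.rot (j.symm y) = j.symm (V.rot y) := by
    intro y
    rw [Equiv.eq_symm_apply, m.rot_eq, j.apply_symm_apply]
  have fs : ∀ y, W.flip (j.symm y) = j.symm (V.slide a b c (V.flip (V.slide a b c y))) := by
    intro y
    rw [Equiv.eq_symm_apply, m.flip_eq, j.apply_symm_apply]
  obtain ⟨ma, ma', mb, mb', mc, mc'⟩ := IsTriangle.mem a b c
  obtain ⟨a0, a1, a2, a3⟩ := sameCycle_self a
  obtain ⟨b0, b1, b2, b3⟩ := sameCycle_self b
  obtain ⟨c0, c1, c2, c3⟩ := sameCycle_self c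
  have ab := fun {x y} => ne_of_not_sameCycle (x := x) (y := y) t.distinct_ab
  have bc := fun {x y} => ne_of_not_sameCycle (x := x) (y := y) t.distinct_bc
  have ca := fun {x y} => ne_of_not_sameCycle (x := x) (y := y) t.distinct_ca
  obtain ⟨na1, na2, na3, na4, na5, na6⟩ := ne_of_crossing t.cross_a
  obtain ⟨nb1, nb2, nb3, nb4, nb5, nb6⟩ := ne_of_crossing t.cross_b
  obtain ⟨nc1, nc2, nc3, nc4, nc5, nc6⟩ := ne_of_crossing t.cross_c
  -- The colours of the triangle, of the regions beyond its edges and of those beyond its corners.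
  have fab : φ a = φ b := by
    have := hφ.face a
    rw [m.edge_ab, V.rot_four] at this
    exact this.symm
  have fbc : φ b = φ c := by
    have := hφ.face b
    rw [m.edge_bc, V.rot_four] at this
    exact this.symm
  have ea : φ (V.rot (V.rot (V.rot a))) = φ (V.rot b) := by rw [hφ, m.edge_ab]
  have eb : φ (V.rot (V.rot (V.rot b))) = φ (V.rot c) := by rw [hφ, m.edge_bc]
  have ec : φ (V.rot (V.rot (V.rot c))) = φ (V.rot a) := by rw [hφ, m.edge_ca]
  let T := φ a + (φ (V.rot a) + φ (V.rot b) + φ (V.rot c)) +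
    (φ (V.rot (V.rot a)) + φ (V.rot (V.rot b)) + φ (V.rot (V.rot c)))
  let g : V.Dart → ZMod 2 := fun y =>
    if y = V.rot (V.rot a) ∨ y = V.rot (V.rot b) ∨ y = V.rot (V.rot c) then T
    else if y = V.rot (V.rot (V.rot a)) then φ (V.rot (V.rot b))
    else if y = V.rot (V.rot (V.rot b)) then φ (V.rot (V.rot c))
    else if y = V.rot (V.rot (V.rot c)) then φ (V.rot (V.rot a))
    else φ (V.slide a b c y)
  have ga2 : g (V.rot (V.rot a)) = T := by simp [g]
  have gb2 : g (V.rot (V.rot b)) = T := by simp [g]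
  have gc2 : g (V.rot (V.rot c)) = T := by simp [g]
  have ga3 : g (V.rot (V.rot (V.rot a))) = φ (V.rot (V.rot b)) := by
    simp [g, na6, ab a3 b2, (ca c2 a3).symm]
  have gb3 : g (V.rot (V.rot (V.rot b))) = φ (V.rot (V.rot c)) := by
    simp [g, nb6, (ab a2 b3).symm, bc b3 c2, (ab a3 b3).symm]
  have gc3 : g (V.rot (V.rot (V.rot c))) = φ (V.rot (V.rot a)) := by
    simp [g, nc6, (bc b2 c3).symm, ca c3 a2, ca c3 a3, (bc b3 c3).symm]
  have gn : ∀ y, V.rot (V.rot y) ∉ V.triangle a b c → g y = φ (V.slide a b c y) := by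
    intro y hy
    rw [mem_triangle] at hy
    have r : ∀ y z, y = V.rot (V.rot z) → V.rot (V.rot y) = z := by
      rintro y z rfl
      rw [V.rot_four]
    have n1 : y ≠ V.rot (V.rot a) := fun h => by have := r _ _ h; tauto
    have n2 : y ≠ V.rot (V.rot b) := fun h => by have := r _ _ h; tauto
    have n3 : y ≠ V.rot (V.rot c) := fun h => by have := r _ _ h; tauto
    have n4 : y ≠ V.rot (V.rot (V.rot a)) := fun h => by have := r _ _ h; tauto
    have n5 : y ≠ V.rot (V.rot (V.rot b)) := fun h => by have := r _ _ h; tauto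
    have n6 : y ≠ V.rot (V.rot (V.rot c)) := fun h => by have := r _ _ h; tauto
    simp only [g, n1, n2, n3, n4, n5, n6, or_self, if_false]
  have gs : ∀ y, y ∉ V.triangle a b c → g (V.slide a b c y) = φ y := by
    intro y hy
    rw [gn _ (t.across_slide_notMem hy), t.slide_slide]
  have gout : ∀ y, y ∉ V.triangle a b c → V.rot (V.rot y) ∉ V.triangle a b c → g y = φ y := by
    intro y h1 h2
    rw [gn _ h2, IsTriangle.slide_of_notMem h1 h2]
  have ga0 : g a = φ (V.rot (V.rot (V.rot b))) := by
    rw [gn _ (t.across_notMem ma), IsTriangle.slide_of_mem ma, m.edge_ab]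
  have gb0 : g b = φ (V.rot (V.rot (V.rot c))) := by
    rw [gn _ (t.across_notMem mb), IsTriangle.slide_of_mem mb, m.edge_bc]
  have gc0 : g c = φ (V.rot (V.rot (V.rot a))) := by
    rw [gn _ (t.across_notMem mc), IsTriangle.slide_of_mem mc, m.edge_ca]
  have ga1 : g (V.rot a) = φ (V.rot (V.rot c)) := by
    rw [gn _ (t.across_notMem ma'), IsTriangle.slide_of_mem ma', t.flip_rot]
  have gb1 : g (V.rot b) = φ (V.rot (V.rot a)) := by
    rw [gn _ (t.across_notMem mb'), IsTriangle.slide_of_mem mb', t.rotate.flip_rot]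
  have gc1 : g (V.rot c) = φ (V.rot (V.rot b)) := by
    rw [gn _ (t.across_notMem mc'), IsTriangle.slide_of_mem mc', t.rotate.rotate.flip_rot]
  refine ⟨g ∘ j, ?_, ?_, ?_⟩
  · intro x
    obtain ⟨y, rfl⟩ := j.symm.surjective x
    simp only [Function.comp, rs, fs, j.apply_symm_apply]
    -- An inner dart goes to an outer dart whose edge leads out of the picture.
    have outer : ∀ z, z ∈ V.triangle a b c → V.slide a b c z ∉ V.triangle a b c →
        g (V.slide a b c (V.flip (V.slide a b c z))) =
          φ (V.rot (V.rot (V.rot (V.slide a b c z)))) := by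
      intro z _ hz
      rw [gs _ (t.flip_notMem hz), hφ]
    have sl : ∀ z, z ∈ V.triangle a b c → V.slide a b c z ∉ V.triangle a b c := by
      intro z hz
      rw [IsTriangle.slide_of_mem hz]
      exact t.across_notMem (t.flip_mem hz)
    by_cases h1 : y ∈ V.triangle a b c
    · rw [outer y h1 (sl y h1), IsTriangle.slide_of_mem h1]
      rw [mem_triangle] at h1
      rcases h1 with rfl | rfl | rfl | rfl | rfl | rfl
      · rw [ga3, m.edge_ab, V.rot_four]
      · rw [V.rot_four, ga0, t.flip_rot, V.rot_four, eb]
      · rw [gb3, m.edge_bc, V.rot_four]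
      · rw [V.rot_four, gb0, t.rotate.flip_rot, V.rot_four, ec]
      · rw [gc3, m.edge_ca, V.rot_four]
      · rw [V.rot_four, gc0, t.rotate.rotate.flip_rot, V.rot_four, ea]
    · by_cases h2 : V.rot (V.rot y) ∈ V.triangle a b c
      · obtain ⟨z, rfl⟩ : ∃ z, y = V.rot (V.rot z) := ⟨_, (V.rot_four y).symm⟩
        rw [V.rot_four] at h2
        rw [t.slide_across h2, V.flip_flip, IsTriangle.slide_of_mem h2, V.rot_four]
        rw [mem_triangle] at h2
        rcases h2 with rfl | rfl | rfl | rfl | rfl | rfl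
        · rw [ga1, m.edge_ab, gb3]
        · rw [ga2, t.flip_rot, gc2]
        · rw [gb1, m.edge_bc, gc3]
        · rw [gb2, t.rotate.flip_rot, ga2]
        · rw [gc1, m.edge_ca, ga3]
        · rw [gc2, t.rotate.rotate.flip_rot, gb2]
      · rw [IsTriangle.slide_of_notMem h1 h2, gs _ (t.flip_notMem h1), ← hφ]
        by_cases h3 : V.rot (V.rot (V.rot y)) ∈ V.triangle a b c
        · exfalso
          rw [mem_triangle] at h3 h1 h2
          have r : ∀ z, V.rot (V.rot (V.rot y)) = z → y = V.rot z := by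
            rintro z rfl
            rw [V.rot_four]
          have r' : ∀ z, V.rot (V.rot (V.rot y)) = V.rot z → V.rot (V.rot y) = z :=
            fun z h => V.rot.injective h
          rcases h3 with h3 | h3 | h3 | h3 | h3 | h3
          · have := r _ h3; tauto
          · have := r' _ h3; tauto
          · have := r _ h3; tauto
          · have := r' _ h3; tauto
          · have := r _ h3; tauto
          · have := r' _ h3; tauto
        · refine gout _ h3 ?_
          rw [V.rot_four]
          intro h4
          rw [mem_triangle] at h1 h2 h4
          have r' : ∀ z, V.rot y = V.rot z → y = z := fun z h => V.rot.injective h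
          rcases h4 with h4 | h4 | h4 | h4 | h4 | h4
          · exact h2 (by rw [h4]; simp)
          · have := r' _ h4; tauto
          · exact h2 (by rw [h4]; simp)
          · have := r' _ h4; tauto
          · exact h2 (by rw [h4]; simp)
          · have := r' _ h4; tauto
  · intro y hy
    simp only [Function.comp, j.apply_symm_apply]
    exact gs y hy
  · intro x
    obtain ⟨y, rfl⟩ := j.symm.surjective x
    simp only [VirtualDiagram.cornerSum, Function.comp, rs, j.apply_symm_apply]
    have two : (2 : ZMod 2) = 0 := rfl
    have Sa : V.cornerSum g a = V.cornerSum φ a := by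
      unfold VirtualDiagram.cornerSum
      rw [ga0, ga1, ga2, ga3, ea, eb]
      simp only [T]
      linear_combination (φ (V.rot c) + φ (V.rot (V.rot c)) + φ (V.rot (V.rot b))) * two
    have Sb : V.cornerSum g b = V.cornerSum φ b := by
      unfold VirtualDiagram.cornerSum
      rw [gb0, gb1, gb2, gb3, eb, ec, ← fab]
      simp only [T]
      linear_combination (φ (V.rot a) + φ (V.rot (V.rot a)) + φ (V.rot (V.rot c))) * two
    have Sc : V.cornerSum g c = V.cornerSum φ c := by
      unfold VirtualDiagram.cornerSum
      rw [gc0, gc1, gc2, gc3, ec, ea, ← fbc, ← fab]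
      simp only [T]
      linear_combination (φ (V.rot b) + φ (V.rot (V.rot b)) + φ (V.rot (V.rot a))) * two
    have hinv : ∀ χ : V.Dart → ZMod 2, ∀ x y, V.rot.SameCycle x y →
        V.cornerSum χ y = V.cornerSum χ x := by
      intro χ x y h
      rw [V.sameCycle_rot] at h
      rcases h with rfl | rfl | rfl | rfl <;> simp only [cornerSum_rot]
    change V.cornerSum g y = V.cornerSum φ y
    by_cases ya : V.rot.SameCycle a y
    · rw [hinv g _ _ ya, hinv φ _ _ ya, Sa]
    by_cases yb : V.rot.SameCycle b y
    · rw [hinv g _ _ yb, hinv φ _ _ yb, Sb]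
    by_cases yc : V.rot.SameCycle c y
    · rw [hinv g _ _ yc, hinv φ _ _ yc, Sc]
    have far : ∀ y, ¬ V.rot.SameCycle a y → ¬ V.rot.SameCycle b y → ¬ V.rot.SameCycle c y →
        g y = φ y := by
      intro y ya yb yc
      refine gout y ?_ ?_
      · rw [V.sameCycle_rot] at ya yb yc
        rw [mem_triangle]
        tauto
      · have ya' : ¬ V.rot.SameCycle a (V.rot (V.rot y)) := by simpa using ya
        have yb' : ¬ V.rot.SameCycle b (V.rot (V.rot y)) := by simpa using yb
        have yc' : ¬ V.rot.SameCycle c (V.rot (V.rot y)) := by simpa using yc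
        rw [V.sameCycle_rot] at ya' yb' yc'
        rw [mem_triangle]
        tauto
    unfold VirtualDiagram.cornerSum
    rw [far y ya yb yc, far (V.rot y), far (V.rot (V.rot y)), far (V.rot (V.rot (V.rot y)))]
    all_goals simpa

end

end VirtualDiagram

namespace VirtualDiagram

/-! ### Planarity is inherited along moves -/

/-- What the moves that delete darts have in common: `j` is the inclusion of the remaining darts,
`B` marks the vertices of `V` that take part in the move (those that remain are auxiliary points of
`W`), and colourings of `V` restrict to `W` if their corner sums vanish there. -/
structure Restricts (V W : VirtualDiagram) (j : W.Dart → V.Dart) (B : V.Dart → Prop) : Prop where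
  injective : Function.Injective j
  bad_rot : ∀ y, B (V.rot y) ↔ B y
  cases : ∀ y, B y ∨ ∃ x, y = j x
  rot_eq : ∀ x, ¬ B (j x) → j (W.rot x) = V.rot (j x)
  bad_aux : ∀ x, B (j x) → W.rot (W.rot x) = x ∧ B (j (W.rot x))
  coloring : ∀ φ, V.IsColoring φ → (∀ y, B y → V.cornerSum φ y = 0) → W.IsColoring (φ ∘ j)
  flip_checkerboard : ∀ χ, V.IsColoring χ → (∀ y, χ (V.flip y) = χ y + 1) →
    ∀ x, χ (j (W.flip x)) = χ (j x) + 1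

section

variable {V W : VirtualDiagram} {j : W.Dart → V.Dart}

theorem cornerSum_of_sameCycle (φ : V.Dart → ZMod 2) {x y : V.Dart} (h : V.rot.SameCycle x y) :
    V.cornerSum φ y = V.cornerSum φ x := by
  rw [V.sameCycle_rot] at h
  rcases h with rfl | rfl | rfl | rfl <;> simp only [cornerSum_rot]

theorem cornerSum_checkerboard {χ : V.Dart → ZMod 2} (hχ : V.IsColoring χ)
    (hχ1 : ∀ x, χ (V.flip x) = χ x + 1) (x : V.Dart) : V.cornerSum χ x = 0 := by
  have h1 : ∀ x, χ (V.rot (V.rot (V.rot x))) = χ x + 1 := fun x => by rw [hχ, hχ1]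
  have h2 : ∀ x, χ (V.rot x) = χ x + 1 := by
    intro x
    have := h1 (V.rot x)
    rw [V.rot_four] at this
    have h3 : ∀ a b : ZMod 2, a = b + 1 → b = a + 1 := by decide
    exact h3 _ _ this
  simp only [cornerSum, h2]
  have : ∀ a : ZMod 2, a + (a + 1) + (a + 1 + 1) + (a + 1 + 1 + 1) = 0 := by decide
  exact this _

namespace Restricts

variable {B : V.Dart → Prop}

theorem bad_rot' (m : Restricts V W j B) (x : W.Dart) : B (j (W.rot x)) ↔ B (j x) := by
  by_cases h : B (j x)
  · exact ⟨fun _ => h, fun _ => (m.bad_aux x h).2⟩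
  · rw [m.rot_eq x h, m.bad_rot]

theorem cornerSum (m : Restricts V W j B) (φ : V.Dart → ZMod 2) {x : W.Dart} (hx : ¬ B (j x)) :
    W.cornerSum (φ ∘ j) x = V.cornerSum φ (j x) := by
  have h1 : ¬ B (j (W.rot x)) := by rwa [m.bad_rot']
  have h2 : ¬ B (j (W.rot (W.rot x))) := by rwa [m.bad_rot']
  simp only [VirtualDiagram.cornerSum, Function.comp]
  rw [m.rot_eq _ h2, m.rot_eq _ h1, m.rot_eq _ hx]

theorem cornerSum_bad (m : Restricts V W j B) (ψ : W.Dart → ZMod 2) {x : W.Dart} (hx : B (j x)) :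
    W.cornerSum ψ x = 0 := cornerSum_aux ψ (m.bad_aux x hx).1

/-- Data at the crossings of `W`, extended by zero to `V`. -/
theorem exists_transport (m : Restricts V W j B) {δ : W.Dart → ZMod 2}
    (h1 : ∀ x, δ (W.rot x) = δ x) (h2 : ∀ x, W.rot (W.rot x) = x → δ x = 0) :
    ∃ ε : V.Dart → ZMod 2, (∀ y, ε (V.rot y) = ε y) ∧ (∀ y, V.rot (V.rot y) = y → ε y = 0) ∧
      (∀ y, B y → ε y = 0) ∧ ∀ x, ¬ B (j x) → ε (j x) = δ x := by
  classical
  let ε : V.Dart → ZMod 2 := fun y => if B y then 0 else Function.extend j δ 0 y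
  have e0 : ∀ y, B y → ε y = 0 := fun y hy => if_pos hy
  have e1 : ∀ x, ¬ B (j x) → ε (j x) = δ x := by
    intro x hx
    simp only [ε, if_neg hx, m.injective.extend_apply]
  refine ⟨ε, ?_, ?_, e0, e1⟩
  · intro y
    by_cases hy : B y
    · rw [e0 y hy, e0 _ ((m.bad_rot y).2 hy)]
    · obtain h | ⟨x, rfl⟩ := m.cases y
      · exact absurd h hy
      · have h3 : ¬ B (j (W.rot x)) := by rwa [m.bad_rot']
        rw [← m.rot_eq x hy, e1 _ h3, e1 _ hy, h1]
  · intro y hy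
    by_cases hB : B y
    · exact e0 y hB
    · obtain h | ⟨x, rfl⟩ := m.cases y
      · exact absurd h hB
      · rw [e1 _ hB]
        apply h2
        apply m.injective
        have h3 : ¬ B (j (W.rot x)) := by rwa [m.bad_rot']
        rw [m.rot_eq _ h3, m.rot_eq _ hB, hy]

theorem planar (m : Restricts V W j B) (hV : V.Planar) : W.Planar := by
  obtain ⟨⟨χ, hχ, hχ1⟩, hδ⟩ := hV
  constructor
  · exact ⟨χ ∘ j, m.coloring χ hχ (fun y _ => cornerSum_checkerboard hχ hχ1 y),
      m.flip_checkerboard χ hχ hχ1⟩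
  · intro δ h1 h2
    obtain ⟨ε, e1, e2, e3, e4⟩ := m.exists_transport h1 h2
    obtain ⟨φ, hφ, rfl⟩ := hδ ε e1 e2
    refine ⟨φ ∘ j, m.coloring φ hφ e3, ?_⟩
    funext x
    by_cases hx : B (j x)
    · rw [m.cornerSum_bad _ hx, h2 x (m.bad_aux x hx).1]
    · rw [m.cornerSum φ hx, e4 x hx]

/-- If `V` is planar, colourings of `W` extend to `V`. -/
theorem exists_coloring (m : Restricts V W j B) (hV : V.Planar) {ψ : W.Dart → ZMod 2}
    (hψ : W.IsColoring ψ) : ∃ φ, V.IsColoring φ ∧ φ ∘ j = ψ ∧ (∀ y, B y → V.cornerSum φ y = 0) ∧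
      ∀ x, ¬ B (j x) → V.cornerSum φ (j x) = W.cornerSum ψ x := by
  obtain ⟨⟨χ, hχ, hχ1⟩, hδ⟩ := hV
  obtain ⟨ε, e1, e2, e3, e4⟩ := m.exists_transport (δ := W.cornerSum ψ)
    (cornerSum_rot ψ) (fun _ => cornerSum_aux ψ)
  obtain ⟨φ, hφ, rfl⟩ := hδ ε e1 e2
  have hφj := m.coloring φ hφ e3
  have hχj := m.coloring χ hχ (fun y _ => cornerSum_checkerboard hχ hχ1 y)
  have hχj1 := m.flip_checkerboard χ hχ hχ1
  -- The restriction of `φ` has the corner sums of `ψ`, so they differ by a constant or by a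
  -- checkerboard colouring, and these extend.
  have hS : ∀ x, W.cornerSum (φ ∘ j + ψ) x = 0 := by
    intro x
    rw [cornerSum_add]
    by_cases hx : B (j x)
    · rw [m.cornerSum_bad _ hx, m.cornerSum_bad _ hx, add_zero]
    · rw [m.cornerSum φ hx, e4 x hx, CharTwo.add_self_eq_zero]
  have hκ : W.IsColoring (φ ∘ j + ψ) := W.colorings.add_mem hφj hψ
  have hc : ∀ c : ZMod 2, V.IsColoring (fun _ => c) := fun _ _ => rfl
  have hcS : ∀ (c : ZMod 2) y, V.cornerSum (fun _ => c) y = 0 := by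
    intro c y
    unfold VirtualDiagram.cornerSum
    have : ∀ a : ZMod 2, a + a + a + a = 0 := by decide
    exact this c
  obtain ⟨x₀⟩ := W.nonempty
  by_cases h0 : (φ ∘ j + ψ) x₀ + (φ ∘ j + ψ) (W.flip x₀) = 0
  · have hconst := W.const_of_edgeSum hκ (fun x => by rw [W.edgeSum_const hκ hS x x₀, h0])
    have hS' : ∀ y, V.cornerSum (φ + fun _ => (φ ∘ j + ψ) x₀) y = V.cornerSum φ y := by
      intro y
      rw [cornerSum_add, hcS, add_zero]
    refine ⟨φ + fun _ => (φ ∘ j + ψ) x₀, V.colorings.add_mem hφ (hc _), ?_, ?_, ?_⟩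
    · funext x
      have := hconst x x₀
      simp only [Pi.add_apply, Function.comp] at this ⊢
      rw [← this, ← add_assoc, CharTwo.add_self_eq_zero, zero_add]
    · intro y hy
      rw [hS', e3 y hy]
    · intro x hx
      rw [hS', e4 x hx]
  · have h1 : (φ ∘ j + ψ) x₀ + (φ ∘ j + ψ) (W.flip x₀) = 1 := by
      have : ∀ a : ZMod 2, a ≠ 0 → a = 1 := by decide
      exact this _ h0
    have hκ' : W.IsColoring (φ ∘ j + ψ + χ ∘ j) := W.colorings.add_mem hκ hχj
    have hconst := W.const_of_edgeSum hκ' (fun x => by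
      have h2 := W.edgeSum_const hκ hS x x₀
      rw [h1] at h2
      have h3 := hχj1 x
      simp only [Pi.add_apply, Function.comp] at h2 ⊢
      rw [h3]
      have : ∀ a b c : ZMod 2, a + b = 1 → a + c + (b + (c + 1)) = 0 := by decide
      exact this _ _ _ h2)
    have hS' : ∀ y, V.cornerSum (φ + χ + fun _ => (φ ∘ j + ψ + χ ∘ j) x₀) y =
        V.cornerSum φ y := by
      intro y
      rw [cornerSum_add, cornerSum_add, hcS, cornerSum_checkerboard hχ hχ1, add_zero, add_zero]
    refine ⟨φ + χ + fun _ => (φ ∘ j + ψ + χ ∘ j) x₀,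
      V.colorings.add_mem (V.colorings.add_mem hφ hχ) (hc _), ?_, ?_, ?_⟩
    · funext x
      have := hconst x x₀
      simp only [Pi.add_apply, Function.comp] at this ⊢
      rw [← this]
      have : ∀ a b c : ZMod 2, a + b + (a + c + b) = c := by decide
      exact this _ _ _
    · intro y hy
      rw [hS', e3 y hy]
    · intro x hx
      rw [hS', e4 x hx]

end Restricts

theorem Erases.restricts {k : V.Dart} (m : Erases V W j k) :
    Restricts V W j (fun y => y = k ∨ y = V.rot k) where
  injective := m.injective
  bad_rot y := by
    have h1 : V.rot y = k ↔ y = V.rot k := by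
      nth_rw 1 [← m.aux]
      exact V.rot.apply_eq_iff_eq
    rw [V.rot.apply_eq_iff_eq, h1, or_comm]
  cases y := by
    have := m.cases y
    tauto
  rot_eq x _ := m.rot_eq x
  bad_aux x hx := by
    have := m.ne x
    tauto
  coloring φ hφ _ := m.coloring hφ
  flip_checkerboard χ hχ hχ1 x := by
    have h1 : ∀ y, χ (V.rot (V.rot (V.rot y))) = χ y + 1 := fun y => by rw [hχ, hχ1]
    rw [m.flip_eq]
    split_ifs with h h
    · rw [hχ1]
      have h2 := h1 k
      rw [m.aux] at h2
      rw [h2, ← h, hχ1]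
      ring_nf
      rw [show (3 : ZMod 2) = 1 from rfl]
    · have h2 := h1 k
      rw [m.aux, ← h, hχ1] at h2
      rw [hχ1]
      have : ∀ a b : ZMod 2, a + 1 = b + 1 → b + 1 = a + 1 := by decide
      exact this _ _ h2
    · exact hχ1 _

theorem Untwists.restricts {h : V.Dart} (m : Untwists V W j h) :
    Restricts V W j (fun y => V.rot.SameCycle h y) where
  injective := m.injective
  bad_rot y := by simp
  cases y := by
    rw [V.sameCycle_rot]
    have := m.cases y
    tauto
  rot_eq x hx := by
    rw [V.sameCycle_rot] at hx
    rw [m.rot_eq, if_neg, if_neg] <;> tauto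
  bad_aux x hx := by
    obtain ⟨p, q, hp, hq, hpq, hqp, hx'⟩ := m.exists_aux
    obtain rfl | rfl : x = p ∨ x = q := by
      by_contra h'
      push Not at h'
      exact (hx' x h'.1 h'.2).2 hx
    · rw [hpq, hqp, hq]
      exact ⟨rfl, (sameCycle_self h).2.2.2⟩
    · rw [hqp, hpq, hp]
      exact ⟨rfl, (sameCycle_self h).2.2.1⟩
  coloring φ hφ _ := m.coloring hφ
  flip_checkerboard χ hχ hχ1 x := by rw [m.flip_eq, hχ1]

theorem Separates.restricts {v w : V.Dart} (m : Separates V W j v w) :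
    Restricts V W j (fun y => V.rot.SameCycle v y ∨ V.rot.SameCycle w y) where
  injective := m.injective
  bad_rot y := by simp
  cases y := by
    rw [V.sameCycle_rot, V.sameCycle_rot]
    have := m.cases y
    tauto
  rot_eq x hx := by
    push Not at hx
    exact m.rot_of_not x hx.1 hx.2
  bad_aux x hx := by
    obtain ⟨p, p', q, q', hp, hp', hq, hq', hpp, hpp', hqq, hqq', hx'⟩ := m.exists_aux
    obtain rfl | rfl | rfl | rfl : x = p ∨ x = p' ∨ x = q ∨ x = q' := by
      by_contra h'
      push Not at h'
      have := (hx' x h'.1 h'.2.1 h'.2.2.1 h'.2.2.2).2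
      tauto
    · rw [hpp, hpp', hp']
      exact ⟨rfl, Or.inr (sameCycle_self w).2.2.2⟩
    · rw [hpp', hpp, hp]
      exact ⟨rfl, Or.inl (sameCycle_self v).2.2.1⟩
    · rw [hqq, hqq', hq']
      exact ⟨rfl, Or.inl (sameCycle_self v).2.2.2⟩
    · rw [hqq', hqq, hq]
      exact ⟨rfl, Or.inr (sameCycle_self w).2.2.1⟩
  coloring φ hφ h := by
    apply m.coloring hφ
    rw [h v (Or.inl (sameCycle_self v).1), h w (Or.inr (sameCycle_self w).1)]
  flip_checkerboard χ hχ hχ1 x := by rw [m.flip_eq, hχ1]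

theorem IsIso.planar {j : W.Dart ≃ V.Dart} (m : IsIso V W j) (hV : V.Planar) : W.Planar := by
  obtain ⟨⟨χ, hχ, hχ1⟩, hδ⟩ := hV
  refine ⟨⟨χ ∘ j, m.coloring hχ, fun x => ?_⟩, fun δ h1 h2 => ?_⟩
  · simp only [Function.comp, m.flip_eq, hχ1]
  · have key' : ∃ φ, V.IsColoring φ ∧ V.cornerSum φ = δ ∘ j.symm := by
      apply hδ (δ ∘ j.symm)
      · intro y
        simp only [Function.comp]
        rw [← h1 (j.symm y)]
        congr 1
        rw [Equiv.symm_apply_eq, m.rot_eq, j.apply_symm_apply]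
      · intro y hy
        apply h2
        apply j.injective
        rw [m.rot_eq, m.rot_eq, j.apply_symm_apply, hy]
    obtain ⟨φ, hφ, e⟩ := key'
    refine ⟨φ ∘ j, m.coloring hφ, ?_⟩
    funext x
    rw [m.cornerSum, e]
    simp

theorem Slides.planar {j : W.Dart ≃ V.Dart} {a b c : V.Dart} (m : Slides V W j a b c)
    (hV : V.Planar) : W.Planar := by
  obtain ⟨⟨χ, hχ, hχ1⟩, hδ⟩ := hV
  have key : ∀ δ : W.Dart → ZMod 2, (∀ x, δ (W.rot x) = δ x) →
      (∀ x, W.rot (W.rot x) = x → δ x = 0) → ∃ φ, W.IsColoring φ ∧ W.cornerSum φ = δ := by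
    intro δ h1 h2
    have key' : ∃ φ, V.IsColoring φ ∧ V.cornerSum φ = δ ∘ j.symm := by
      apply hδ (δ ∘ j.symm)
      · intro y
        simp only [Function.comp]
        rw [← h1 (j.symm y)]
        congr 1
        rw [Equiv.symm_apply_eq, m.rot_eq, j.apply_symm_apply]
      · intro y hy
        apply h2
        apply j.injective
        rw [m.rot_eq, m.rot_eq, j.apply_symm_apply, hy]
    obtain ⟨φ, hφ, e⟩ := key'
    obtain ⟨ψ, hψ, -, hS⟩ := m.exists_coloring hφ
    refine ⟨ψ, hψ, ?_⟩
    funext x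
    rw [hS, e]
    simp
  obtain ⟨ψ, hψ, hout, hS⟩ := m.exists_coloring hχ
  -- It suffices to see that `ψ` changes across one edge; an edge with outer darts will do.
  have t := m.isTriangle
  obtain ⟨ma, -⟩ := IsTriangle.mem a b c
  have h0 := t.across_notMem ma
  have h1 := t.flip_notMem h0
  have e1 := hout _ h0
  have e2 := hout _ h1
  have e3 : W.flip (j.symm (V.slide a b c (V.rot (V.rot a)))) =
      j.symm (V.slide a b c (V.flip (V.rot (V.rot a)))) := by
    rw [Equiv.eq_symm_apply, m.flip_eq, j.apply_symm_apply, t.slide_slide]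
  refine ⟨⟨ψ, hψ, fun x => ?_⟩, key⟩
  have h2 := W.edgeSum_const hψ (fun x => by rw [hS, cornerSum_checkerboard hχ hχ1]) x
    (j.symm (V.slide a b c (V.rot (V.rot a))))
  rw [e3, e1, e2, hχ1] at h2
  have : ∀ a b c : ZMod 2, a + b = c + (c + 1) → b = a + 1 := by decide
  exact this _ _ _ h2

/-- Inserting an auxiliary point keeps the surface a sphere. -/
theorem Erases.planar_of {k : V.Dart} (m : Erases V W j k) (hW : W.Planar) : V.Planar := by
  obtain ⟨⟨χ, hχ, hχ1⟩, hδ⟩ := hW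
  constructor
  · obtain ⟨φ, hφ, e⟩ := m.exists_coloring hχ
    refine ⟨φ, hφ, fun y => ?_⟩
    have hS : ∀ y, V.cornerSum φ y = 0 := by
      intro y
      rcases m.cases y with rfl | rfl | ⟨x, rfl⟩
      · exact cornerSum_aux _ m.aux
      · rw [cornerSum_rot]
        exact cornerSum_aux _ m.aux
      · rw [← m.cornerSum, e, cornerSum_checkerboard hχ hχ1]
    -- The edge of `k` is contained in an edge of `W`.
    obtain ⟨x, hx⟩ : ∃ x, V.flip k = j x := by
      rcases m.cases (V.flip k) with h | h | h
      · exact absurd h (V.flip_ne k)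
      · exact absurd h m.not_circle
      · exact h
    have h1 := V.edgeSum_const hφ hS y k
    have h2 : φ k = φ (j (W.flip x)) := by
      rw [m.flip_eq, if_pos (by rw [← hx, V.flip_flip]), ← hφ (V.rot k), V.rot_four]
    rw [hx, h2] at h1
    have h3 : φ (j (W.flip x)) = φ (j x) + 1 := by
      have := hχ1 x
      rw [← e] at this
      exact this
    rw [h3] at h1
    have : ∀ a b c : ZMod 2, a + b = c + 1 + c → b = a + 1 := by decide
    exact this _ _ _ h1
  · intro δ h1 h2
    obtain ⟨ψ, hψ, e⟩ := hδ (δ ∘ j) (fun x => by simp only [Function.comp, m.rot_eq, h1])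
      (fun x hx => h2 _ (by rw [← m.rot_eq, ← m.rot_eq, hx]))
    obtain ⟨φ, hφ, rfl⟩ := m.exists_coloring hψ
    refine ⟨φ, hφ, ?_⟩
    funext y
    rcases m.cases y with rfl | rfl | ⟨x, rfl⟩
    · rw [h2 _ m.aux]
      exact cornerSum_aux _ m.aux
    · rw [h1, h2 _ m.aux, cornerSum_rot]
      exact cornerSum_aux _ m.aux
    · rw [← m.cornerSum, e]
      rfl

/-- Undoing a second move keeps the surface a sphere if the two strands face the same region, and
the regions on the two far sides of the bigon can be told apart by a colouring. -/
theorem Separates.planar_of {v w : V.Dart} (m : Separates V W j v w)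
    {p q : W.Dart} (hp : j p = V.rot (V.rot v)) (hq : j q = V.rot (V.rot w))
    (hpq : ∀ ψ, W.IsColoring ψ → ψ p = ψ q) {τ : V.Dart → ZMod 2} (hτ : V.IsColoring τ)
    (hτS : V.cornerSum τ v ≠ V.cornerSum τ w) (hW : W.Planar) : V.Planar := by
  classical
  obtain ⟨⟨χ, hχ, hχ1⟩, hδ⟩ := hW
  have r := m.restricts
  have hvv := (sameCycle_self v).1
  have hww := (sameCycle_self w).1
  have hnvw : ¬ V.rot.SameCycle w v := fun h => m.distinct h.symm
  have lift : ∀ ψ, W.IsColoring ψ → ∃ φ, V.IsColoring φ ∧ φ ∘ j = ψ ∧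
      V.cornerSum φ v = 0 ∧ V.cornerSum φ w = 0 := fun ψ hψ =>
    m.exists_coloring hp hq hψ (hpq ψ hψ)
  constructor
  · obtain ⟨φ, hφ, e, ev, ew⟩ := lift χ hχ
    refine ⟨φ, hφ, fun y => ?_⟩
    have hS : ∀ y, V.cornerSum φ y = 0 := by
      intro y
      by_cases hB : V.rot.SameCycle v y ∨ V.rot.SameCycle w y
      · rcases hB with h | h
        · rw [cornerSum_of_sameCycle _ h, ev]
        · rw [cornerSum_of_sameCycle _ h, ew]
      · obtain h | ⟨x, rfl⟩ := r.cases y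
        · exact absurd h hB
        · rw [← r.cornerSum _ hB, e, cornerSum_checkerboard hχ hχ1]
    have h1 := V.edgeSum_const hφ hS y (j p)
    have h2 : φ (V.flip (j p)) = φ (j p) + 1 := by
      have := hχ1 p
      rw [← e] at this
      simp only [Function.comp] at this
      rw [← m.flip_eq, this]
    rw [h2] at h1
    have : ∀ a b c : ZMod 2, a + b = c + (c + 1) → b = a + 1 := by decide
    exact this _ _ _ h1
  · -- Adjust the corner sums at `v` and `w` with `τ` and the colour of the bigon.
    intro δ h1 h2
    have hadj : ∀ s t : ZMod 2, ∃ σ, V.IsColoring σ ∧ V.cornerSum σ v = s ∧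
        V.cornerSum σ w = t := by
      intro s t
      have base : ∃ σ, V.IsColoring σ ∧ V.cornerSum σ v + V.cornerSum σ w = s + t := by
        by_cases hst : s + t = 0
        · refine ⟨0, V.colorings.zero_mem, ?_⟩
          simp [VirtualDiagram.cornerSum, hst]
        · refine ⟨τ, hτ, ?_⟩
          have : ∀ a b c : ZMod 2, a ≠ b → c ≠ 0 → a + b = c := by decide
          exact this _ _ _ hτS hst
      obtain ⟨σ, hσ, e⟩ := base
      by_cases hs : V.cornerSum σ v = s
      · refine ⟨σ, hσ, hs, ?_⟩
        rw [hs] at e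
        exact add_left_cancel e
      · obtain ⟨σ', hσ', -, hS⟩ := m.toggle hσ
        refine ⟨σ', hσ', ?_, ?_⟩
        · rw [hS, if_pos hvv, if_neg hnvw]
          have : ∀ a b : ZMod 2, a ≠ b → a + 1 + 0 = b := by decide
          exact this _ _ hs
        · rw [hS, if_neg m.distinct, if_pos hww]
          have : ∀ a b c d : ZMod 2, a ≠ b → a + c = b + d → c + 0 + 1 = d := by decide
          exact this _ _ _ _ hs e
    obtain ⟨σ, hσ, sv, sw⟩ := hadj (δ v) (δ w)
    -- What remains to be realised comes from `W`.
    let ε : W.Dart → ZMod 2 := fun x =>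
      if V.rot.SameCycle v (j x) ∨ V.rot.SameCycle w (j x) then 0
      else δ (j x) + V.cornerSum σ (j x)
    have key' : ∃ φ, W.IsColoring φ ∧ W.cornerSum φ = ε := by
      apply hδ ε
      · intro x
        have hb := r.bad_rot' x
        by_cases hB : V.rot.SameCycle v (j x) ∨ V.rot.SameCycle w (j x)
        · simp only [ε, if_pos hB, if_pos (hb.2 hB)]
        · simp only [ε, if_neg hB, if_neg (fun h => hB (hb.1 h))]
          rw [r.rot_eq x hB, h1, cornerSum_rot]
      · intro x hx
        by_cases hB : V.rot.SameCycle v (j x) ∨ V.rot.SameCycle w (j x)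
        · simp only [ε, if_pos hB]
        · simp only [ε, if_neg hB]
          have hB' := fun h => hB ((r.bad_rot' x).1 h)
          have : V.rot (V.rot (j x)) = j x := by
            rw [← r.rot_eq x hB, ← r.rot_eq _ hB', hx]
          rw [h2 _ this, cornerSum_aux _ this, add_zero]
    obtain ⟨ψ, hψ, e⟩ := key'
    obtain ⟨φ, hφ, e', ev, ew⟩ := lift ψ hψ
    refine ⟨φ + σ, V.colorings.add_mem hφ hσ, ?_⟩
    have hδinv : ∀ x y, V.rot.SameCycle x y → δ y = δ x := by
      intro x y h
      rw [V.sameCycle_rot] at h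
      rcases h with rfl | rfl | rfl | rfl <;> simp only [h1]
    funext y
    by_cases hB : V.rot.SameCycle v y ∨ V.rot.SameCycle w y
    · rcases hB with h | h
      · rw [cornerSum_of_sameCycle _ h, cornerSum_add, ev, sv, zero_add, hδinv _ _ h]
      · rw [cornerSum_of_sameCycle _ h, cornerSum_add, ew, sw, zero_add, hδinv _ _ h]
    · obtain h | ⟨x, rfl⟩ := r.cases y
      · exact absurd h hB
      · rw [cornerSum_add, ← r.cornerSum _ hB, e', e]
        simp only [ε, if_neg hB]
        rw [add_assoc, CharTwo.add_self_eq_zero, add_zero]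

end

end VirtualDiagram

namespace KnotDiagram

/-! ### Punctures on the two sides of an edge -/

/-- The regions on the left and on the right of a dart, as the places of two punctures. -/
def sides (D : KnotDiagram) (g : D.Dart) : Bool → D.Region
  | true => D.leftRegion g
  | false => D.leftRegion (D.flip g)

theorem leftRegion_eq (D : KnotDiagram) {x y : D.Dart} (h : D.flip x = D.rot y) :
    D.leftRegion x = D.leftRegion y := by
  apply Quotient.sound
  refine ⟨1, ?_⟩
  change D.rot⁻¹ (D.flip x) = y
  rw [h]
  exact D.rot.symm_apply_apply y

end KnotDiagram

theorem ElementaryMove.reindex {ι κ : Type} (f : κ → ι) {P Q : PuncturedDiagram ι}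
    (h : ElementaryMove P Q) :
    ElementaryMove ⟨P.diagram, P.place ∘ f⟩ ⟨Q.diagram, Q.place ∘ f⟩ := by
  cases h with
  | homeo D E p q j h1 h2 h3 h4 => exact .homeo D E _ _ j h1 h2 h3 fun i => h4 (f i)
  | erase D E p q j k h1 h2 h3 h4 h5 h6 => exact .erase D E _ _ j k h1 h2 h3 h4 h5 fun i => h6 (f i)
  | reidemeister1 D E p q j h h1 h2 h3 h4 h5 h6 =>
    exact .reidemeister1 D E _ _ j h h1 h2 h3 h4 h5 fun i => h6 (f i)
  | reidemeister2 D E p q j v w h1 h2 h3 h4 h5 h6 h7 h8 h9 h10 =>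
    exact .reidemeister2 D E _ _ j v w h1 h2 h3 h4 h5 h6 h7 h8 h9 fun i => h10 (f i)
  | reidemeister3 D E p q j a b c h1 h2 h3 h4 h5 h6 h7 h8 h9 h10 h11 h12 h13 h14 =>
    exact .reidemeister3 D E _ _ j a b c h1 h2 h3 h4 h5 h6 h7 h8 h9 h10 h11 h12 h13
      fun i => h14 (f i)

theorem eqvGen_reindex {ι κ : Type} (f : κ → ι) {P Q : PuncturedDiagram ι}
    (h : Relation.EqvGen ElementaryMove P Q) :
    Relation.EqvGen ElementaryMove (⟨P.diagram, P.place ∘ f⟩ : PuncturedDiagram κ)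
      ⟨Q.diagram, Q.place ∘ f⟩ := by
  induction h with
  | rel _ _ h => exact .rel _ _ (h.reindex f)
  | refl _ => exact .refl _
  | symm _ _ _ ih => exact .symm _ _ ih
  | trans _ _ _ _ _ h1 h2 => exact .trans _ _ _ h1 h2

namespace VirtualDiagram

/-- Two planar diagrams are linked at given darts if they are related by moves on the sphere that
is punctured on both sides of the dart. -/
def Linked (V : VirtualDiagram) (g : V.Dart) (W : VirtualDiagram) (k : W.Dart) : Prop :=
  ∃ (hV : V.Planar) (hW : W.Planar), Relation.EqvGen ElementaryMove
    ⟨V.toKnot hV, (V.toKnot hV).sides g⟩ ⟨W.toKnot hW, (W.toKnot hW).sides k⟩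

section

variable {V W U : VirtualDiagram} {g : V.Dart} {k : W.Dart} {l : U.Dart}

theorem Linked.refl (hV : V.Planar) (g : V.Dart) : Linked V g V g := ⟨hV, hV, .refl _⟩

theorem Linked.symm (h : Linked V g W k) : Linked W k V g :=
  let ⟨hV, hW, e⟩ := h
  ⟨hW, hV, .symm _ _ e⟩

theorem Linked.trans (h : Linked V g W k) (h' : Linked W k U l) : Linked V g U l :=
  let ⟨hV, _, e⟩ := h
  let ⟨_, hU, e'⟩ := h'
  ⟨hV, hU, .trans _ _ _ e e'⟩

theorem Linked.left_planar (h : Linked V g W k) : V.Planar := h.1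

theorem Linked.right_planar (h : Linked V g W k) : W.Planar := h.2.1

theorem sides_flip (V : VirtualDiagram) (hV : V.Planar) (g : V.Dart) :
    (V.toKnot hV).sides (V.flip g) = (V.toKnot hV).sides g ∘ not := by
  funext b
  cases b
  · change (V.toKnot hV).leftRegion (V.flip (V.flip g)) = _
    rw [V.flip_flip]
    rfl
  · rfl

/-- The two punctures may be exchanged. -/
theorem Linked.flip (h : Linked V g W k) : Linked V (V.flip g) W (W.flip k) := by
  obtain ⟨hV, hW, e⟩ := h
  refine ⟨hV, hW, ?_⟩
  rw [sides_flip, sides_flip]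
  exact eqvGen_reindex not e

/-- On the two sides of an auxiliary point one has the same two regions. -/
theorem linked_rot (hV : V.Planar) {x : V.Dart} (hx : V.rot (V.rot x) = x) :
    Linked V x V (V.flip (V.rot x)) := by
  refine ⟨hV, hV, ?_⟩
  have : (V.toKnot hV).sides (V.flip (V.rot x)) = (V.toKnot hV).sides x := by
    funext b
    cases b
    · change (V.toKnot hV).leftRegion (V.flip (V.flip (V.rot x))) =
        (V.toKnot hV).leftRegion (V.flip x)
      symm
      apply KnotDiagram.leftRegion_eq
      change V.flip (V.flip x) = V.rot (V.flip (V.flip (V.rot x)))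
      rw [V.flip_flip, V.flip_flip, hx]
    · change (V.toKnot hV).leftRegion (V.flip (V.rot x)) = (V.toKnot hV).leftRegion x
      apply KnotDiagram.leftRegion_eq
      change V.flip (V.flip (V.rot x)) = V.rot x
      rw [V.flip_flip]
  rw [this]
  exact .refl _

/-! ### Moves do not depend on the position of the two punctures -/

theorem IsIso.linked {j : W.Dart ≃ V.Dart} (m : IsIso V W j) (hV : V.Planar) (x : W.Dart) :
    Linked V (j x) W x := by
  refine ⟨hV, m.planar hV, .rel _ _ (.homeo _ _ _ _ j m.upper_eq m.flip_eq m.rot_eq ?_)⟩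
  intro i
  cases i
  · refine ⟨W.flip x, ?_, rfl⟩
    change _ = (V.toKnot hV).leftRegion (j (W.flip x))
    have := m.flip_eq x
    exact congrArg (V.toKnot hV).leftRegion this.symm
  · exact ⟨x, rfl, rfl⟩

theorem Erases.linked' {j : W.Dart → V.Dart} {k : V.Dart} (m : Erases V W j k) (hV : V.Planar)
    (hW : W.Planar) (x : W.Dart) : Linked V (j x) W x := by
  refine ⟨hV, hW, .rel _ _ (.erase _ _ _ _ j k (not_not.2 m.aux) m.not_circle
    ⟨m.injective, m.range_eq, m.upper_eq⟩ m.flip_eq m.rot_eq ?_)⟩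
  intro i
  cases i
  · refine ⟨W.flip x, ?_, rfl⟩
    rw [m.flip_eq]
    change (V.toKnot hV).leftRegion (V.flip (j x)) = _
    split_ifs with h1 h2
    · symm
      apply KnotDiagram.leftRegion_eq
      change V.flip (V.flip (V.rot k)) = V.rot (V.flip (j x))
      rw [V.flip_flip, h1]
    · symm
      apply KnotDiagram.leftRegion_eq
      change V.flip (V.flip k) = V.rot (V.flip (j x))
      rw [V.flip_flip, h2, m.aux]
    · rfl
  · exact ⟨x, rfl, rfl⟩

theorem Erases.linked {j : W.Dart → V.Dart} {k : V.Dart} (m : Erases V W j k)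
    (h : V.Planar ∨ W.Planar) (x : W.Dart) : Linked V (j x) W x := by
  rcases h with h | h
  · exact m.linked' h (m.restricts.planar h) x
  · exact m.linked' (m.planar_of h) h x

theorem Untwists.linked {j : W.Dart → V.Dart} {h : V.Dart} (m : Untwists V W j h) (hV : V.Planar)
    (x : W.Dart) : Linked V (j x) W x := by
  refine ⟨hV, m.restricts.planar hV, .rel _ _ (.reidemeister1 _ _ _ _ j h m.cross m.monogon
    ⟨m.injective, m.range_eq, m.upper_eq⟩ m.flip_eq m.rot_eq ?_)⟩
  intro i
  cases i
  · refine ⟨W.flip x, ?_, rfl⟩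
    have := m.flip_eq x
    exact congrArg (V.toKnot hV).leftRegion this.symm
  · exact ⟨x, rfl, rfl⟩

theorem Separates.linked {j : W.Dart → V.Dart} {v w : V.Dart} (m : Separates V W j v w)
    (hV : V.Planar) (x : W.Dart) : Linked V (j x) W x := by
  refine ⟨hV, m.restricts.planar hV, .rel _ _ (.reidemeister2 _ _ _ _ j v w m.cross_v m.cross_w
    m.distinct m.edge_vw m.edge_wv m.upper_both
    ⟨m.injective, m.range_eq, m.upper_eq⟩ m.flip_eq m.rot_eq ?_)⟩
  intro i
  cases i
  · refine ⟨W.flip x, ?_, rfl⟩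
    have := m.flip_eq x
    exact congrArg (V.toKnot hV).leftRegion this.symm
  · exact ⟨x, rfl, rfl⟩

theorem Slides.linked {j : W.Dart ≃ V.Dart} {a b c : V.Dart} (m : Slides V W j a b c)
    (hV : V.Planar) {y : V.Dart} (hy : y ∉ V.triangle a b c) :
    Linked V y W (j.symm (V.slide a b c y)) := by
  have t := m.isTriangle
  refine ⟨hV, m.planar hV, .rel _ _ (.reidemeister3 _ _ _ _ j a b c m.cross_a m.cross_b m.cross_c
    m.distinct_ab m.distinct_bc m.distinct_ca m.edge_ab m.edge_bc m.edge_ca m.not_cyclic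
    m.upper_eq m.flip_eq m.rot_eq ?_)⟩
  intro i
  cases i
  · refine ⟨V.flip y, t.flip_notMem hy, rfl, ?_⟩
    have e : W.flip (j.symm (V.slide a b c y)) = j.symm (V.slide a b c (V.flip y)) := by
      rw [Equiv.eq_symm_apply, m.flip_eq, j.apply_symm_apply, t.slide_slide]
    exact congrArg (W.toKnot _).leftRegion e
  · exact ⟨y, hy, rfl, rfl⟩

end

end VirtualDiagram

/-- A move can be carried out in the complement of two punctures on the two sides of a suitable
edge. -/
theorem ElementaryMove.exists_linked {ι : Type} {P Q : PuncturedDiagram ι}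
    (h : ElementaryMove P Q) : ∃ x y,
    VirtualDiagram.Linked P.diagram.toVirtual x Q.diagram.toVirtual y := by
  cases h with
  | homeo D E p q j h1 h2 h3 h4 =>
    obtain ⟨x⟩ := E.nonempty
    have m : VirtualDiagram.IsIso D.toVirtual E.toVirtual j := ⟨h1, h2, h3⟩
    exact ⟨_, x, m.linked D.planar x⟩
  | erase D E p q j k h1 h2 h3 h4 h5 h6 =>
    obtain ⟨x⟩ := E.nonempty
    have m : VirtualDiagram.Erases D.toVirtual E.toVirtual j k :=
      ⟨not_not.1 h1, h2, h3.1, h3.2, h3.3, h4, h5⟩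
    exact ⟨_, x, m.linked (Or.inl D.planar) x⟩
  | reidemeister1 D E p q j h h1 h2 h3 h4 h5 h6 =>
    obtain ⟨x⟩ := E.nonempty
    have m : VirtualDiagram.Untwists D.toVirtual E.toVirtual j h :=
      ⟨h1, h2, h3.1, h3.2, h3.3, h4, h5⟩
    exact ⟨_, x, m.linked D.planar x⟩
  | reidemeister2 D E p q j v w h1 h2 h3 h4 h5 h6 h7 h8 h9 h10 =>
    obtain ⟨x⟩ := E.nonempty
    have m : VirtualDiagram.Separates D.toVirtual E.toVirtual j v w :=
      ⟨h1, h2, h3, h4, h5, h6, h7.1, h7.2, h7.3, h8, h9⟩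
    exact ⟨_, x, m.linked D.planar x⟩
  | reidemeister3 D E p q j a b c h1 h2 h3 h4 h5 h6 h7 h8 h9 h10 h11 h12 h13 h14 =>
    have m : VirtualDiagram.Slides D.toVirtual E.toVirtual j a b c :=
      ⟨h1, h2, h3, h4, h5, h6, h7, h8, h9, h10, h11, h12, h13⟩
    have hy := m.isTriangle.across_notMem (VirtualDiagram.IsTriangle.mem (V := D.toVirtual) a b c).1
    exact ⟨_, _, m.linked D.planar hy⟩

namespace VirtualDiagram

/-! ### Inserting auxiliary points and crossings -/

section

variable {α : Type} {f : α → α}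

open Classical in
/-- The matching of half-edges after a point has been inserted on the edge of `d`; before, it was
`f`. -/
noncomputable def subFlip (f : α → α) (d : α) : α ⊕ Bool → α ⊕ Bool
  | .inl y => if y = d then .inr false else if y = f d then .inr true else .inl (f y)
  | .inr b => .inl (if b then f d else d)

theorem subFlip_subFlip (hf : ∀ x, f (f x) = x) (hne : ∀ x, f x ≠ x) (d : α) (x : α ⊕ Bool) :
    subFlip f d (subFlip f d x) = x := by
  have h := hne d
  rcases x with y | b
  · by_cases h1 : y = d
    · simp [subFlip, h1]
    · by_cases h2 : y = f d
      · simp [subFlip, h2, h]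
      · have h3 : f y ≠ d := fun e => h2 (by rw [← e, hf])
        have h4 : f y ≠ f d := fun e => h1 (by rw [← hf y, e, hf])
        simp [subFlip, h1, h2, h3, h4, hf]
  · cases b <;> simp [subFlip, h]

@[simp] theorem subFlip_inr_false (d : α) : subFlip f d (.inr false) = .inl d := rfl

@[simp] theorem subFlip_inr_true (d : α) : subFlip f d (.inr true) = .inl (f d) := rfl

@[simp] theorem subFlip_self (d : α) : subFlip f d (.inl d) = .inr false := by simp [subFlip]

theorem subFlip_flip {d : α} (h : f d ≠ d) : subFlip f d (.inl (f d)) = .inr true := by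
  simp [subFlip, h]

theorem subFlip_flip' {d y : α} (h : y ≠ d) (hy : y = f d) : subFlip f d (.inl y) = .inr true := by
  simp [subFlip, h, hy.symm]

theorem subFlip_inl {d y : α} (h1 : y ≠ d) (h2 : y ≠ f d) :
    subFlip f d (.inl y) = .inl (f y) := by simp [subFlip, h1, h2]

open Classical in
/-- The half of an edge, subdivided by the new crossing if it is the edge of `q`, that starts where
`y` starts if `y ≠ q`; for `q` itself, the half beyond the crossing. -/
noncomputable def crossPort (q : α) (y : α) : α ⊕ Fin 4 :=
  if y = q then .inr 1 else .inl y

open Classical in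
/-- The dart joined to `crossPort q y`. -/
noncomputable def crossFar (f : α → α) (g q : α) (y : α) : α ⊕ Fin 4 :=
  if y = g then .inr 2 else if y = f g then .inr 0 else crossPort q (f y)

open Classical in
/-- The matching of half-edges after the edge of `g` has been rerouted across the half-edge `q`;
before, it was `f`. -/
noncomputable def crossFlip (f : α → α) (g q : α) : α ⊕ Fin 4 → α ⊕ Fin 4
  | .inl y => if y = q then .inr 3 else crossFar f g q y
  | .inr i => if i = 3 then .inl q else if i = 2 then crossPort q g
      else if i = 1 then crossFar f g q q else crossPort q (f g)

theorem crossPort_injective (q : α) : Function.Injective (crossPort q) := by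
  intro a b h
  unfold crossPort at h
  split_ifs at h with h1 h2
  · rw [h1, h2]
  · exact Sum.inl_injective h

@[simp] theorem crossPort_self (q : α) : crossPort q q = .inr 1 := by simp [crossPort]

theorem crossPort_of_ne {q y : α} (h : y ≠ q) : crossPort q y = .inl y := by
  simp [crossPort, h]

@[simp] theorem crossFar_self (g q : α) : crossFar f g q g = .inr 2 := by simp [crossFar]

theorem crossFar_flip {g : α} (h : f g ≠ g) (q : α) : crossFar f g q (f g) = .inr 0 := by
  simp [crossFar, h]

theorem crossFar_flip' {g q y : α} (h : y ≠ g) (hy : y = f g) : crossFar f g q y = .inr 0 := by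
  simp [crossFar, h, hy.symm]

theorem crossFar_of_ne {g q y : α} (h1 : y ≠ g) (h2 : y ≠ f g) :
    crossFar f g q y = crossPort q (f y) := by
  simp [crossFar, h1, h2]

@[simp] theorem crossFlip_three (g q : α) : crossFlip f g q (.inr 3) = .inl q := rfl

@[simp] theorem crossFlip_two (g q : α) : crossFlip f g q (.inr 2) = crossPort q g := rfl

@[simp] theorem crossFlip_one (g q : α) : crossFlip f g q (.inr 1) = crossFar f g q q := rfl

@[simp] theorem crossFlip_zero (g q : α) : crossFlip f g q (.inr 0) = crossPort q (f g) := rfl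

@[simp] theorem crossFlip_self (g q : α) : crossFlip f g q (.inl q) = .inr 3 := by
  simp [crossFlip]

theorem crossFlip_inl {g q y : α} (h : y ≠ q) : crossFlip f g q (.inl y) = crossFar f g q y := by
  simp [crossFlip, h]

theorem crossFlip_port (g q y : α) : crossFlip f g q (crossPort q y) = crossFar f g q y := by
  by_cases h : y = q
  · subst h; simp
  · rw [crossPort_of_ne h, crossFlip_inl h]

theorem crossFlip_far (hf : ∀ x, f (f x) = x) (g q y : α) :
    crossFlip f g q (crossFar f g q y) = crossPort q y := by
  unfold crossFar
  split_ifs with h1 h2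
  · subst h1; simp
  · subst h2; simp
  · rw [crossFlip_port, crossFar_of_ne, hf]
    · exact fun h => h2 (by rw [← h, hf])
    · exact fun h => h1 (by rw [← hf y, h, hf])

theorem inr_cases {p : α ⊕ Fin 4 → Prop} (h : ∀ y, p (.inl y)) (h0 : p (.inr 0))
    (h1 : p (.inr 1)) (h2 : p (.inr 2)) (h3 : p (.inr 3)) : ∀ x, p x := by
  rintro (y | i)
  · exact h y
  · obtain rfl | rfl | rfl | rfl : i = 0 ∨ i = 1 ∨ i = 2 ∨ i = 3 := by revert i; decide
    exacts [h0, h1, h2, h3]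

theorem crossFlip_crossFlip (hf : ∀ x, f (f x) = x) (hne : ∀ x, f x ≠ x) (g q : α) :
    ∀ x : α ⊕ Fin 4, crossFlip f g q (crossFlip f g q x) = x := by
  apply inr_cases
  · intro y
    by_cases h : y = q
    · subst h; simp
    · rw [← crossPort_of_ne h, crossFlip_port, crossFlip_far hf]
  · rw [crossFlip_zero, crossFlip_port, crossFar_flip (hne g)]
  · rw [crossFlip_one, crossFlip_far hf, crossPort_self]
  · rw [crossFlip_two, crossFlip_port, crossFar_self]
  · rw [crossFlip_three, crossFlip_self]

theorem crossFar_ne (hne : ∀ x, f x ≠ x) (g q y : α) : crossFar f g q y ≠ crossPort q y := by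
  unfold crossFar
  split_ifs with h1 h2
  · unfold crossPort; split_ifs <;> simp
  · unfold crossPort; split_ifs <;> simp
  · exact fun h => hne y (crossPort_injective q h)

theorem crossFlip_ne (hne : ∀ x, f x ≠ x) (g q : α) : ∀ x : α ⊕ Fin 4, crossFlip f g q x ≠ x := by
  have hp : ∀ y i, i ≠ 1 → crossPort q y ≠ .inr i := by
    intro y i hi
    unfold crossPort
    split_ifs
    · simpa using hi.symm
    · simp
  apply inr_cases
  · intro y
    by_cases h : y = q
    · subst h; simp
    · rw [← crossPort_of_ne h, crossFlip_port]
      exact crossFar_ne hne g q y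
  · exact hp _ _ (by decide)
  · rw [← crossPort_self, crossFlip_port]
    exact crossFar_ne hne g q q
  · exact hp _ _ (by decide)
  · simp

end

section

variable (V : VirtualDiagram)

/-- A new auxiliary point on the edge of `d`: the dart `Sum.inr false` is joined to `d`, and
`Sum.inr true` is joined to `V.flip d`. -/
@[reducible] noncomputable def sub (d : V.Dart) : VirtualDiagram where
  Dart := V.Dart ⊕ Bool
  finite := have := V.finite; inferInstance
  nonempty := ⟨.inr true⟩
  rot := Equiv.sumCongr V.rot Equiv.boolNot
  flip := ⟨subFlip V.flip d, subFlip V.flip d, subFlip_subFlip V.flip_flip V.flip_ne d,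
    subFlip_subFlip V.flip_flip V.flip_ne d⟩
  upper := Sum.elim V.upper fun _ => false
  rot_ne x := by
    rcases x with y | b
    · simp [V.rot_ne]
    · simp
  rot_four x := by
    rcases x with y | b
    · simp [V.rot_four]
    · simp
  flip_ne x := by
    rcases x with y | b
    · simp only [Equiv.coe_fn_mk, subFlip]
      split_ifs <;> simp [V.flip_ne]
    · simp [subFlip]
  flip_flip x := subFlip_subFlip V.flip_flip V.flip_ne d x
  upper_rot x := by
    rcases x with y | b
    · simpa using V.upper_rot y
    · simp
  along := by
    classical
    intro P h1 h2 h3 h k hP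
    simp only [Equiv.coe_fn_mk] at h1
    have hf : P (.inr false) ↔ P (.inr true) :=
      ⟨h2 (.inr false) (by simp), h2 (.inr true) (by simp)⟩
    have hd : P (.inl d) ↔ P (.inr false) := by
      have e : subFlip V.flip d (.inl d) = .inr false := by simp [subFlip]
      exact ⟨fun h => e ▸ h1 _ h, fun h => by simpa [subFlip] using h1 _ h⟩
    have hd' : P (.inl (V.flip d)) ↔ P (.inr true) := by
      have e : subFlip V.flip d (.inl (V.flip d)) = .inr true := by simp [subFlip, V.flip_ne]
      exact ⟨fun h => e ▸ h1 _ h, fun h => by simpa [subFlip] using h1 _ h⟩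
    have key : ∀ y z, P (.inl y) → P (.inl z) := by
      apply V.along (fun y => P (.inl y))
      · intro y hy
        by_cases e1 : y = d
        · subst e1; exact hd'.2 (hf.1 (hd.1 hy))
        · by_cases e2 : y = V.flip d
          · subst e2
            rw [V.flip_flip]; exact hd.2 (hf.2 (hd'.1 hy))
          · simpa [subFlip, e1, e2] using h1 _ hy
      · intro a ha hy
        exact h2 (.inl a) (by simpa using ha) hy
      · intro a ha hy
        exact h3 (.inl a) (by simpa using ha) hy
    have all : P (.inl d) := by
      rcases h with y | _ | _
      · exact key _ _ hP
      · exact hd.2 hP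
      · exact hd.2 (hf.2 hP)
    rcases k with y | _ | _
    · exact key _ _ all
    · exact hd.1 all
    · exact hf.1 (hd.1 all)

variable {V}

theorem sub_erases (d : V.Dart) : Erases (V.sub d) V Sum.inl (.inr false) where
  aux := rfl
  not_circle h := nomatch h
  injective := Sum.inl_injective
  range_eq := by
    ext x
    rcases x with y | _ | _ <;> simp
  upper_eq _ _ := rfl
  flip_eq x := by
    by_cases h1 : x = d
    · subst h1; simp
    · by_cases h2 : x = V.flip d
      · subst h2; simp [V.flip_flip, subFlip_flip (V.flip_ne d)]
      · simp [subFlip_inl h1 h2]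
  rot_eq _ := rfl

theorem sub_linked (d : V.Dart) (h : (V.sub d).Planar ∨ V.Planar) (x : V.Dart) :
    Linked (V.sub d) (.inl x) V x := (sub_erases d).linked h x

variable (V)

/-- The strand through the edge of `g` is rerouted so as to cross the edge of `q` once, near the
vertex of `q`, which then lies on its right; the dart `Sum.inr i` at the new crossing points
forward, left, backward, right for `i = 0, 1, 2, 3`.  This changes the surface in general. -/
@[reducible] noncomputable def cross (g q : V.Dart) (u : Bool) : VirtualDiagram where
  Dart := V.Dart ⊕ Fin 4
  finite := have := V.finite; inferInstance
  nonempty := ⟨.inr 0⟩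
  rot := Equiv.sumCongr V.rot (Equiv.addRight 1)
  flip := ⟨crossFlip V.flip g q, crossFlip V.flip g q, crossFlip_crossFlip V.flip_flip V.flip_ne g q,
    crossFlip_crossFlip V.flip_flip V.flip_ne g q⟩
  upper := Sum.elim V.upper fun i => if i = 0 ∨ i = 2 then u else !u
  rot_ne := by
    apply inr_cases
    · simp [V.rot_ne]
    all_goals simp
  rot_four := by
    apply inr_cases
    · simp [V.rot_four]
    all_goals rfl
  flip_ne := crossFlip_ne V.flip_ne g q
  flip_flip := crossFlip_crossFlip V.flip_flip V.flip_ne g q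
  upper_rot := by
    apply inr_cases
    · intro y
      simpa using V.upper_rot y
    all_goals
      intro _
      cases u <;> rfl
  along := by
    intro P h1 h2 h3
    simp only [Equiv.coe_fn_mk] at h1
    have hflip : ∀ x, P (crossFlip V.flip g q x) ↔ P x := fun x =>
      ⟨fun h => by simpa only [crossFlip_crossFlip V.flip_flip V.flip_ne] using h1 _ h, h1 x⟩
    have h02 : P (.inr 0) ↔ P (.inr 2) := ⟨h3 (.inr 0) (by simp), h3 (.inr 2) (by simp)⟩
    have h13 : P (.inr 1) ↔ P (.inr 3) := ⟨h3 (.inr 1) (by simp), h3 (.inr 3) (by simp)⟩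
    have hq : P (.inl q) ↔ P (.inr 3) := hflip (.inr 3)
    have hport : ∀ y, P (crossPort q y) ↔ P (.inl y) := by
      intro y
      unfold crossPort
      split_ifs with h
      · rw [h13, h, hq]
      · rfl
    have hg : P (.inl g) ↔ P (.inr 2) := by
      rw [← hport, ← hflip, crossFlip_port, crossFar_self]
    have hg' : P (.inl (V.flip g)) ↔ P (.inr 0) := by
      rw [← hport, ← hflip, crossFlip_port, crossFar_flip (V.flip_ne g)]
    have key : ∀ y z, P (.inl y) → P (.inl z) := by
      apply V.along (fun y => P (.inl y))
      · intro y hy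
        by_cases e1 : y = g
        · subst e1; exact hg'.2 (h02.2 (hg.1 hy))
        · by_cases e2 : y = V.flip g
          · subst e2; rw [V.flip_flip]; exact hg.2 (h02.1 (hg'.1 hy))
          · rw [← hport, ← hflip, crossFlip_port] at hy
            simp only [crossFar, e1, e2, if_false] at hy
            rwa [hport] at hy
      · intro a ha hy
        exact h2 (.inl a) (by simpa using ha) hy
      · intro a ha hy
        exact h3 (.inl a) (by simpa using ha) hy
    have tog : ∀ x, P x → P (.inl q) := by
      apply inr_cases
      · exact fun y => key _ _
      · exact fun h => key _ _ (hg'.2 h)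
      · exact fun h => hq.2 (h13.1 h)
      · exact fun h => key _ _ (hg.2 h)
      · exact hq.2
    have back : ∀ x, P (.inl q) → P x := by
      apply inr_cases
      · exact fun y => key _ _
      · exact fun h => hg'.1 (key _ _ h)
      · exact fun h => h13.2 (hq.1 h)
      · exact fun h => hg.1 (key _ _ h)
      · exact hq.1
    exact fun h k hP => back k (tog h hP)

end

end VirtualDiagram

namespace VirtualDiagram

section

variable {T : VirtualDiagram} {g d : T.Dart} {u : Bool}

/-! ### Kinks and bigons at new crossings -/

/-- A strand that crosses the edge of its own first half-edge `g` has a kink there. -/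
theorem cross_self_untwists : Untwists (T.cross g g u) (T.sub g)
    (Sum.elim Sum.inl fun b => .inr (if b then 0 else 3)) (.inr 1) where
  cross := by simp
  monogon := by simp [crossFar_self]
  injective := by
    rintro (x | _ | _) (y | _ | _) <;> simp
  range_eq := by
    ext x
    revert x
    apply inr_cases <;> simp
  upper_eq x hx := by
    rcases x with x | _ | _
    · rfl
    · simp at hx
    · simp at hx
  flip_eq x := by
    have hg := T.flip_ne g
    rcases x with x | _ | _
    · by_cases h1 : x = g
      · subst h1; simp
      · by_cases h2 : x = T.flip g
        · subst h2; simp [crossFlip_inl h1, crossFar_flip hg, subFlip_flip hg]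
        · have h3 : T.flip x ≠ g := fun h => h2 (by rw [← h, T.flip_flip])
          simp [crossFlip_inl h1, subFlip_inl h1 h2, crossFar_of_ne h1 h2, crossPort_of_ne h3]
    · simp
    · simp [crossPort_of_ne hg]
  rot_eq x := by
    rcases x with x | _ | _ <;> simp

theorem cross_self_linked (h : (T.cross g g u).Planar) (x : T.Dart) :
    Linked (T.cross g g u) (.inl x) T x :=
  (cross_self_untwists.linked h (.inl x)).trans
    (sub_linked g (.inl (cross_self_untwists.restricts.planar h)) x)

/-- A strand that crosses the half-edge at which it ends has a kink there. -/
theorem cross_flip_untwists : Untwists (T.cross g (T.flip g) u) (T.sub g)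
    (Sum.elim Sum.inl fun b => .inr (if b then 3 else 2)) (.inr 0) where
  cross := by simp
  monogon := by simp
  injective := by
    rintro (x | _ | _) (y | _ | _) <;> simp
  range_eq := by
    ext x
    revert x
    apply inr_cases <;> simp
  upper_eq x hx := by
    rcases x with x | _ | _
    · rfl
    · simp at hx
    · simp at hx
  flip_eq x := by
    have hg := (T.flip_ne g).symm
    rcases x with x | _ | _
    · by_cases h1 : x = g
      · subst h1; simp [crossFlip_inl hg, crossFar_self]
      · by_cases h2 : x = T.flip g
        · subst h2; simp [subFlip_flip hg.symm]
        · have h3 : T.flip x ≠ T.flip g := fun h => h1 (T.flip.injective h)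
          simp [crossFlip_inl h2, subFlip_inl h1 h2, crossFar_of_ne h1 h2, crossPort_of_ne h3]
    · simp [crossPort_of_ne hg]
    · simp
  rot_eq x := by
    rcases x with x | _ | _ <;> simp

theorem cross_flip_linked (h : (T.cross g (T.flip g) u).Planar) (x : T.Dart) :
    Linked (T.cross g (T.flip g) u) (.inl x) T x :=
  (cross_flip_untwists.linked h (.inl x)).trans
    (sub_linked g (.inl (cross_flip_untwists.restricts.planar h)) x)

/-- The strand of `g` crosses the edge of `d` and comes back, between the first crossing and the
vertex of `d`. -/
@[reducible] noncomputable def finger (T : VirtualDiagram) (g d : T.Dart) (u : Bool) :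
    VirtualDiagram :=
  (T.cross g d u).cross (.inr 0) (.inr 3) u

/-- The inclusion of the darts that remain after the finger has been pulled back. -/
def fingerInc (T : VirtualDiagram) : (T.Dart ⊕ Bool) ⊕ Bool → (T.Dart ⊕ Fin 4) ⊕ Fin 4
  | .inl (.inl y) => .inl (.inl y)
  | .inl (.inr false) => .inl (.inr 2)
  | .inl (.inr true) => .inr 0
  | .inr false => .inr 1
  | .inr true => .inl (.inr 1)

/-- Pulling back a finger leaves an auxiliary point on each of the two edges. -/
theorem finger_separates (h1 : d ≠ g) (h2 : d ≠ T.flip g) :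
    Separates (T.finger g d u) ((T.sub g).sub (.inl d)) T.fingerInc
      (.inl (.inr 3)) (.inr 2) where
  cross_v := by simp
  cross_w := by simp
  distinct := by
    rw [sameCycle_rot]
    simp
  edge_vw := by simp
  edge_wv := by simp [crossPort_of_ne]
  upper_both := by cases u <;> simp
  injective := by
    rintro ((x | _ | _) | _ | _) ((y | _ | _) | _ | _) <;> simp [fingerInc]
  range_eq := by
    ext x
    revert x
    apply inr_cases
    · apply inr_cases <;> simp [fingerInc]
    all_goals simp [fingerInc]
  upper_eq x hx := by
    rcases x with (x | _ | _) | _ | _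
    · rfl
    all_goals simp at hx
  flip_eq x := by
    have hg := T.flip_ne g
    have hd := T.flip_ne d
    have h3 : T.flip d ≠ g := fun h => h2 (by rw [← h, T.flip_flip])
    have h4 : T.flip d ≠ T.flip g := fun h => h1 (T.flip.injective h)
    have e : crossFar T.flip g d d = .inl (T.flip d) := by
      rw [crossFar_of_ne h1 h2, crossPort_of_ne hd]
    rcases x with (x | _ | _) | _ | _
    · by_cases e1 : x = d
      · subst e1
        simp [fingerInc, subFlip, crossFlip, crossFar, crossPort, h2, h2.symm]
      by_cases e2 : x = T.flip d
      · subst e2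
        simp [fingerInc, subFlip, crossFlip, crossFar, crossPort, h1, h2, h2.symm, h3, h4,
          hd, T.flip_flip]
      have e5 : T.flip x ≠ d := fun h => e2 (by rw [← h, T.flip_flip])
      by_cases e3 : x = g
      · subst e3
        simp [fingerInc, subFlip, crossFlip, crossFar, crossPort_of_ne h2.symm,
          crossPort_of_ne (q := (Sum.inr 3 : T.Dart ⊕ Fin 4)), h1, h2, h1.symm, h3.symm, hg.symm]
      by_cases e4 : x = T.flip g
      · subst e4
        simp [fingerInc, subFlip, crossFlip, crossFar, crossPort, h1, h2, h2.symm,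
          h4.symm, hg]
      have e6 : T.flip x ≠ T.flip d := fun h => e1 (T.flip.injective h)
      simp [fingerInc, subFlip, crossFlip, crossFar, crossPort, h1, h2, h2.symm, e1, e2,
        e3,
        e4, e5]
    · simp [fingerInc, subFlip, crossFlip, crossFar, crossPort, h1, h2, h1.symm, h2.symm]
    · simp [fingerInc, subFlip, crossPort, h1, h2, h2.symm]
    · simp [fingerInc, crossFar, crossPort, h2.symm]
    · simp only [fingerInc, Equiv.coe_fn_mk, subFlip_inr_true, subFlip_inl h1 h2]
      rw [crossFlip_inl (by simp), crossFar_of_ne (by simp) (by simp [crossPort_of_ne h2.symm]),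
        crossFlip_one, e]
      simp [crossPort]
  rot_eq x := by
    rcases x with (x | _ | _) | _ | _ <;> simp [fingerInc]

theorem finger_linked (h1 : d ≠ g) (h2 : d ≠ T.flip g) (h : (T.finger g d u).Planar)
    (x : T.Dart) : Linked (T.finger g d u) (.inl (.inl x)) T x := by
  have m := finger_separates (u := u) h1 h2
  have h' := m.restricts.planar h
  have h'' := (sub_erases (V := T.sub g) (.inl d)).restricts.planar h'
  exact ((m.linked h (.inl (.inl x))).trans (sub_linked (V := T.sub g) (.inl d) (.inl h') (.inl x))
    ).trans (sub_linked g (.inl h'') x)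

/-- A finger may be made between two strands on the boundary of the same region. -/
theorem finger_planar (h1 : d ≠ g) (h2 : d ≠ T.flip g) (hT : T.Planar)
    (hgd : ∀ ψ, T.IsColoring ψ → ψ d = ψ g) {τ : (T.finger g d u).Dart → ZMod 2}
    (hτ : (T.finger g d u).IsColoring τ)
    (hτS : (T.finger g d u).cornerSum τ (.inl (.inr 3)) ≠
      (T.finger g d u).cornerSum τ (.inr 2)) : (T.finger g d u).Planar := by
  have m := finger_separates (u := u) h1 h2
  have e1 := sub_erases (V := T) g
  have e2 := sub_erases (V := T.sub g) (.inl d)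
  refine m.planar_of (p := .inr true) (q := .inl (.inr true)) rfl rfl ?_ hτ hτS
    (e2.planar_of (e1.planar_of hT))
  intro ψ hψ
  have e := hgd _ (e1.coloring (e2.coloring hψ))
  have f1 := hψ (.inr false)
  have f2 := hψ (.inl (.inr false))
  simp only [Function.comp] at e
  have g1 : ((T.sub g).sub (.inl d)).flip (.inl (.inr false)) = .inl (.inl g) := by
    simp [subFlip, h1, h2]
  rw [g1] at f2
  exact f1.trans (e.trans f2.symm)

/-- Crossing an edge and then crossing it back. -/
theorem finger_isIso (h1 : d ≠ g) (h2 : d ≠ T.flip g) :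
    IsIso ((T.cross g d u).cross (.inr 0) (.inl (T.flip d)) u) (T.finger (T.flip g) d u)
      ⟨Sum.elim (Sum.elim (fun t => .inl (.inl t)) fun i => .inr (i + 2)) fun i => .inl (.inr (i + 2)),
       Sum.elim (Sum.elim (fun t => .inl (.inl t)) fun i => .inr (i + 2)) fun i => .inl (.inr (i + 2)),
       by rintro ((x | i) | i) <;> simp [add_assoc],
       by rintro ((x | i) | i) <;> simp [add_assoc]⟩ where
  upper_eq := by
    apply inr_cases
    · apply inr_cases
      · exact fun _ _ => rfl
      all_goals exact fun _ => rfl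
    all_goals exact fun _ => rfl
  rot_eq := by
    apply inr_cases
    · apply inr_cases
      · exact fun _ => rfl
      all_goals rfl
    all_goals rfl
  flip_eq := by
    have hg := T.flip_ne g
    have hd := T.flip_ne d
    have h3 : T.flip d ≠ g := fun h => h2 (by rw [← h, T.flip_flip])
    have h4 : T.flip d ≠ T.flip g := fun h => h1 (T.flip.injective h)
    have h5 := h1.symm
    have h6 := h2.symm
    have h7 := hg.symm
    have h8 := hd.symm
    have h9 := h3.symm
    have h10 := h4.symm
    have ff := T.flip_flip
    apply inr_cases
    · apply inr_cases
      · intro x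
        by_cases he : x = d ∨ x = T.flip d ∨ x = g ∨ x = T.flip g
        · rcases he with e | e | e | e <;> rw [e] <;>
            simp (maxDischargeDepth := 6) [crossFlip_inl, crossFar_of_ne, crossFar_flip',
              crossPort_of_ne, *]
        push Not at he
        obtain ⟨e1, e2, e3, e4⟩ := he
        have e5 : T.flip x ≠ d := fun h => e2 (by rw [← h, T.flip_flip])
        have e6 : T.flip x ≠ T.flip d := fun h => e1 (T.flip.injective h)
        simp (maxDischargeDepth := 6) [crossFlip_inl, crossFar_of_ne,
          crossPort_of_ne, *]
      all_goals simp (maxDischargeDepth := 6) [crossFlip_inl, crossFar_of_ne,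
        crossPort_of_ne, *]
    all_goals simp (maxDischargeDepth := 6) [crossFlip_inl, crossFar_of_ne,
      crossPort_of_ne, *]

end

end VirtualDiagram

namespace VirtualDiagram

section

variable {T : VirtualDiagram} {g d : T.Dart} {u : Bool}

/-- A second move removes two successive crossings with the same edge. -/
theorem cross_cross_linked (h1 : d ≠ g) (h2 : d ≠ T.flip g)
    (h : ((T.cross g d u).cross (.inr 0) (.inl (T.flip d)) u).Planar) (x : T.Dart) :
    Linked ((T.cross g d u).cross (.inr 0) (.inl (T.flip d)) u) (.inl (.inl x)) T x := by
  have m := finger_isIso (u := u) h1 h2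
  exact (m.linked h (.inl (.inl x))).trans
    (finger_linked h2 (by rwa [T.flip_flip]) (m.planar h) x)

/-- The same crossing, described with both strands reversed. -/
theorem cross_flip_flip_isIso (h1 : d ≠ g) (h2 : d ≠ T.flip g) :
    IsIso (T.cross g d u) (T.cross (T.flip g) (T.flip d) u)
      ⟨Sum.elim .inl fun i => .inr (i + 2), Sum.elim .inl fun i => .inr (i + 2),
       by rintro (x | i) <;> simp [add_assoc], by rintro (x | i) <;> simp [add_assoc]⟩ where
  upper_eq := by
    apply inr_cases
    · exact fun _ _ => rfl
    all_goals exact fun _ => rfl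
  rot_eq := by
    apply inr_cases
    · exact fun _ => rfl
    all_goals rfl
  flip_eq := by
    have hg := T.flip_ne g
    have hd := T.flip_ne d
    have h3 : T.flip d ≠ g := fun h => h2 (by rw [← h, T.flip_flip])
    have h4 : T.flip d ≠ T.flip g := fun h => h1 (T.flip.injective h)
    have h5 := h1.symm
    have h6 := h2.symm
    have h7 := hg.symm
    have h8 := hd.symm
    have h9 := h3.symm
    have h10 := h4.symm
    have ff := T.flip_flip
    apply inr_cases
    · intro x
      by_cases he : x = d ∨ x = T.flip d ∨ x = g ∨ x = T.flip g
      · rcases he with e | e | e | e <;> rw [e] <;>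
          simp [crossFlip_inl, crossFar_of_ne, crossFar_flip', *]
      push Not at he
      obtain ⟨e1, e2, e3, e4⟩ := he
      have e5 : T.flip x ≠ d := fun h => e2 (by rw [← h, T.flip_flip])
      have e6 : T.flip x ≠ T.flip d := fun h => e1 (T.flip.injective h)
      simp [crossFlip_inl, crossFar_of_ne, crossPort_of_ne, *]
    all_goals simp [crossFar_of_ne, crossPort_of_ne, *]

/-! ### Pushing a strand across an auxiliary point -/

open Classical in
/-- Exchange an auxiliary point `k` of `T` with a new one. -/
noncomputable def auxSwap (T : VirtualDiagram) (k : T.Dart) :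
    (T.Dart ⊕ Fin 4) ⊕ Bool → (T.Dart ⊕ Fin 4) ⊕ Bool
  | .inl (.inl t) => if t = k then .inr false else if t = T.rot k then .inr true else .inl (.inl t)
  | .inl (.inr i) => .inl (.inr i)
  | .inr false => .inl (.inl k)
  | .inr true => .inl (.inl (T.rot k))

theorem auxSwap_auxSwap (k : T.Dart) (x : (T.Dart ⊕ Fin 4) ⊕ Bool) :
    T.auxSwap k (T.auxSwap k x) = x := by
  have h := T.rot_ne k
  rcases x with (t | i) | _ | _
  · by_cases h1 : t = k
    · simp [auxSwap, h1]
    · by_cases h2 : t = T.rot k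
      · simp [auxSwap, h2, h]
      · simp [auxSwap, h1, h2]
  all_goals simp [auxSwap, h]

@[simp] theorem auxSwap_inr (k : T.Dart) (i : Fin 4) :
    T.auxSwap k (.inl (.inr i)) = .inl (.inr i) := rfl

@[simp] theorem auxSwap_false (k : T.Dart) : T.auxSwap k (.inr false) = .inl (.inl k) := rfl

@[simp] theorem auxSwap_true (k : T.Dart) : T.auxSwap k (.inr true) = .inl (.inl (T.rot k)) := rfl

@[simp] theorem auxSwap_self (k : T.Dart) : T.auxSwap k (.inl (.inl k)) = .inr false := by
  simp [auxSwap]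

@[simp] theorem auxSwap_rot (k : T.Dart) : T.auxSwap k (.inl (.inl (T.rot k))) = .inr true := by
  simp [auxSwap, T.rot_ne]

theorem auxSwap_of_ne {k t : T.Dart} (h1 : t ≠ k) (h2 : t ≠ T.rot k) :
    T.auxSwap k (.inl (.inl t)) = .inl (.inl t) := by
  simp [auxSwap, h1, h2]

/-- Crossing an edge before or behind an auxiliary point gives the same diagram, up to the position
of auxiliary points. -/
theorem auxSwap_isIso {k : T.Dart} (hk : T.rot (T.rot k) = k) (hrk : T.flip k ≠ T.rot k)
    (h1 : k ≠ g) (h2 : k ≠ T.flip g) :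
    IsIso ((T.cross g (T.flip k) u).sub (.inl (T.flip k))) ((T.cross g (T.rot k) u).sub (.inr 1))
      ⟨T.auxSwap k, T.auxSwap k, T.auxSwap_auxSwap k, T.auxSwap_auxSwap k⟩ where
  upper_eq x := by
    have hr : T.rot k ≠ k := T.rot_ne k
    rcases x with (t | i) | _ | _
    · by_cases e1 : t = k
      · subst e1; simp [hk]
      by_cases e2 : t = T.rot k
      · subst e2; simp [hk]
      intro _
      simp [auxSwap_of_ne e1 e2]
    · exact fun _ => rfl
    · simp
    · simp
  rot_eq x := by
    rcases x with (t | i) | _ | _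
    · by_cases e1 : t = k
      · subst e1; simp
      by_cases e2 : t = T.rot k
      · subst e2; simp [hk]
      have e3 : T.rot t ≠ k := fun h => e2 (T.rot.injective (h.trans hk.symm))
      have e4 : T.rot t ≠ T.rot k := fun h => e1 (T.rot.injective h)
      simp [auxSwap_of_ne, *]
    · rfl
    · simp
    · simp [hk]
  flip_eq x := by
    have hg := T.flip_ne g
    have hd := T.flip_ne k
    have h3 : T.flip k ≠ g := fun h => h2 (by rw [← h, T.flip_flip])
    have h4 : T.flip k ≠ T.flip g := fun h => h1 (T.flip.injective h)
    have hr : T.rot k ≠ k := T.rot_ne k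
    have hr2 : T.flip (T.rot k) ≠ T.rot k := T.flip_ne _
    have hr3 : T.flip (T.rot k) ≠ k := fun h => hrk (by rw [← T.flip_flip (T.rot k), h])
    have hr4 : T.flip (T.rot k) ≠ T.flip k := fun h => hr (T.flip.injective h)
    have hg1 := h1.symm
    have hg2 := h2.symm
    have h7 := hg.symm
    have h8 := hd.symm
    have h9 := h3.symm
    have h10 := h4.symm
    have i1 := hr.symm
    have i2 := hr2.symm
    have i3 := hr3.symm
    have i4 := hr4.symm
    have i5 := hrk.symm
    have ff := T.flip_flip
    obtain c | c | ⟨c, c'⟩ : g = T.rot k ∨ g = T.flip (T.rot k) ∨ (g ≠ T.rot k ∧ g ≠ T.flip (T.rot k)) := by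
      tauto
    · subst c
      revert x
      rintro ((t | i) | _ | _)
      · by_cases e1 : t = k
        · subst e1
          simp (maxDischargeDepth := 6) [crossFlip_inl, crossFar_of_ne,
            crossPort_of_ne, subFlip_inl, auxSwap_of_ne, *]
        by_cases he : t = T.rot k ∨ t = T.flip k ∨ t = T.flip (T.rot k)
        · rcases he with e | e | e <;> rw [e] <;>
            simp (maxDischargeDepth := 6) [crossFlip_inl, crossFar_of_ne, crossFar_flip',
              crossPort_of_ne, subFlip_inl, auxSwap_of_ne, *]
        push Not at he
        obtain ⟨e2, e3, e4⟩ := he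
        have f1 : T.flip t ≠ k := fun h => e3 (by rw [← h, T.flip_flip])
        have f2 : T.flip t ≠ T.rot k := fun h => e4 (by rw [← h, T.flip_flip])
        simp (maxDischargeDepth := 6) [crossFlip_inl, crossFar_of_ne,
          crossPort_of_ne, subFlip_inl, auxSwap_of_ne, *]
      · obtain rfl | rfl | rfl | rfl : i = 0 ∨ i = 1 ∨ i = 2 ∨ i = 3 := by revert i; decide
        all_goals simp (maxDischargeDepth := 6) [crossFar_of_ne,
          crossPort_of_ne, subFlip_inl, subFlip_flip', auxSwap_of_ne, *]
      · simp (maxDischargeDepth := 6) [crossFlip_inl, crossFar_of_ne,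
          subFlip_inl, *]
      · simp (maxDischargeDepth := 6) [crossFlip_inl,
          subFlip_inl, *]
    · subst c
      revert x
      rintro ((t | i) | _ | _)
      · by_cases e1 : t = k
        · subst e1
          simp (maxDischargeDepth := 6) [crossFlip_inl, crossFar_of_ne, crossFar_flip',
            crossPort_of_ne, subFlip_inl, auxSwap_of_ne, *]
        by_cases he : t = T.rot k ∨ t = T.flip k ∨ t = T.flip (T.rot k)
        · rcases he with e | e | e <;> rw [e] <;>
            simp (maxDischargeDepth := 6) [crossFlip_inl, crossFar_of_ne, crossFar_flip',
              crossPort_of_ne, subFlip_inl, auxSwap_of_ne, *]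
        push Not at he
        obtain ⟨e2, e3, e4⟩ := he
        have f1 : T.flip t ≠ k := fun h => e3 (by rw [← h, T.flip_flip])
        have f2 : T.flip t ≠ T.rot k := fun h => e4 (by rw [← h, T.flip_flip])
        simp (maxDischargeDepth := 6) [crossFlip_inl, crossFar_of_ne, crossFar_flip',
          crossPort_of_ne, subFlip_inl, auxSwap_of_ne, *]
      · obtain rfl | rfl | rfl | rfl : i = 0 ∨ i = 1 ∨ i = 2 ∨ i = 3 := by revert i; decide
        all_goals simp (maxDischargeDepth := 6) [crossFar_of_ne, crossFar_flip',
          crossPort_of_ne, subFlip_inl, subFlip_flip', auxSwap_of_ne, *]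
      · simp (maxDischargeDepth := 6) [crossFlip_inl, crossFar_of_ne,
          subFlip_inl, *]
      · simp (maxDischargeDepth := 6) [crossFlip_inl, crossFar_flip',
          subFlip_inl, *]
    · have c1 := c.symm
      have c1' := c'.symm
      have c2 : T.flip g ≠ T.rot k := fun h => c' (by rw [← h, T.flip_flip])
      have c2' := c2.symm
      have c3 : T.flip g ≠ T.flip (T.rot k) := fun h => c (T.flip.injective h)
      have c3' := c3.symm
      revert x
      rintro ((t | i) | _ | _)
      · by_cases e1 : t = k
        · subst e1
          simp (maxDischargeDepth := 6) [crossFlip_inl, crossFar_of_ne,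
            crossPort_of_ne, subFlip_inl, auxSwap_of_ne, *]
        by_cases he : t = T.rot k ∨ t = T.flip k ∨ t = T.flip (T.rot k) ∨ t = g ∨ t = T.flip g
        · rcases he with e | e | e | e | e <;> rw [e] <;>
            simp (maxDischargeDepth := 6) [crossFlip_inl, crossFar_of_ne, crossFar_flip',
              crossPort_of_ne, subFlip_inl, subFlip_flip', auxSwap_of_ne, *]
        push Not at he
        obtain ⟨e2, e3, e4, e5, e6⟩ := he
        have f1 : T.flip t ≠ k := fun h => e3 (by rw [← h, T.flip_flip])
        have f2 : T.flip t ≠ T.rot k := fun h => e4 (by rw [← h, T.flip_flip])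
        simp (maxDischargeDepth := 6) [crossFlip_inl, crossFar_of_ne,
          crossPort_of_ne, subFlip_inl, auxSwap_of_ne, *]
      · obtain rfl | rfl | rfl | rfl : i = 0 ∨ i = 1 ∨ i = 2 ∨ i = 3 := by revert i; decide
        all_goals simp (maxDischargeDepth := 6) [crossFar_of_ne,
          crossPort_of_ne, subFlip_inl, subFlip_flip', auxSwap_of_ne, *]
      · simp (maxDischargeDepth := 6) [crossFlip_inl, crossFar_of_ne,
          subFlip_inl, *]
      · simp (maxDischargeDepth := 6) [crossFlip_inl, crossFar_of_ne,
          crossPort_of_ne, subFlip_inl, auxSwap_of_ne, *]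

/-- A strand may be pushed across an auxiliary point. -/
theorem cross_aux_linked {k x : T.Dart} (hk : T.rot (T.rot k) = k) (hrk : T.flip k ≠ T.rot k)
    (h1 : k ≠ g) (h2 : k ≠ T.flip g) (hx : x ≠ k) (hx' : x ≠ T.rot k)
    (h : (T.cross g (T.flip k) u).Planar) :
    Linked (T.cross g (T.flip k) u) (.inl x) (T.cross g (T.rot k) u) (.inl x) := by
  have m := auxSwap_isIso (u := u) hk hrk h1 h2
  have l1 := sub_linked (V := T.cross g (T.flip k) u) (.inl (T.flip k)) (.inr h) (.inl x)
  have l2 := m.linked l1.left_planar (.inl (.inl x))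
  have l3 := sub_linked (V := T.cross g (T.rot k) u) (.inr 1) (.inl l2.right_planar) (.inl x)
  have e : T.auxSwap k (.inl (.inl x)) = .inl (.inl x) := auxSwap_of_ne hx hx'
  change Linked ((T.cross g (T.flip k) u).sub (.inl (T.flip k)))
    (T.auxSwap k (.inl (.inl x))) _ _ at l2
  rw [e] at l2
  exact (l1.symm.trans l2).trans l3

end

end VirtualDiagram

namespace VirtualDiagram

/-! ### Pushing a strand across a crossing -/

section

variable {T : VirtualDiagram} {g k : T.Dart} {u : Bool}

/-- The strand of `g` crosses the edge of `k` at its far end, and a finger of it crosses the next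
edge at the vertex of `k` twice. -/
@[reducible] noncomputable def pushStart (T : VirtualDiagram) (g k : T.Dart) (u : Bool) :
    VirtualDiagram :=
  (T.cross g (T.flip k) u).finger (.inr 0) (.inl (T.flip (T.rot k))) u

/-- The strand of `g` crosses the other three edges at the vertex of `k`. -/
@[reducible] noncomputable def pushEnd (T : VirtualDiagram) (g k : T.Dart) (u : Bool) :
    VirtualDiagram :=
  ((T.cross g (T.rot (T.rot (T.rot k))) u).cross (.inr 0) (.inl (T.rot (T.rot k))) u).cross
    (.inr 0) (.inl (.inl (T.rot k))) u

/-- The strand of `g` is far enough from the crossing `k`, and `k` has no loops. -/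
structure Pushable (T : VirtualDiagram) (g k : T.Dart) : Prop where
  cross : T.rot (T.rot k) ≠ k
  flip_notMem : ∀ x, T.rot.SameCycle k x → ¬ T.rot.SameCycle k (T.flip x)
  left_notMem : ¬ T.rot.SameCycle k g
  right_notMem : ¬ T.rot.SameCycle k (T.flip g)

/-- The correspondence of darts: the strand of `g` meets the first two edges in the opposite order
after the third move. -/
def pushEquiv (T : VirtualDiagram) :
    ((T.Dart ⊕ Fin 4) ⊕ Fin 4) ⊕ Fin 4 ≃ ((T.Dart ⊕ Fin 4) ⊕ Fin 4) ⊕ Fin 4 where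
  toFun := Sum.elim (Sum.elim (Sum.elim (fun t => .inl (.inl (.inl t))) fun i => .inl (.inr i))
    fun i => .inl (.inl (.inr i))) .inr
  invFun := Sum.elim (Sum.elim (Sum.elim (fun t => .inl (.inl (.inl t))) fun i => .inl (.inr i))
    fun i => .inl (.inl (.inr i))) .inr
  left_inv := by rintro (((x | i) | i) | i) <;> rfl
  right_inv := by rintro (((x | i) | i) | i) <;> rfl

theorem Pushable.nodup (h : Pushable T g k) : [k, T.rot k, T.rot (T.rot k), T.rot (T.rot (T.rot k)),
    T.flip k, T.flip (T.rot k), T.flip (T.rot (T.rot k)), T.flip (T.rot (T.rot (T.rot k))),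
    g, T.flip g].Nodup := by
  have hS : ∀ {x y}, T.rot.SameCycle k x → ¬ T.rot.SameCycle k y → x ≠ y := by
    rintro x _ hx hy rfl
    exact hy hx
  obtain ⟨s0, s1, s2, s3⟩ := sameCycle_self k
  have f0 := h.flip_notMem _ s0
  have f1 := h.flip_notMem _ s1
  have f2 := h.flip_notMem _ s2
  have f3 := h.flip_notMem _ s3
  have hf : ∀ {x y}, T.rot.SameCycle k x → ¬ T.rot.SameCycle k (T.flip y) → T.flip x ≠ y := by
    rintro x _ hx hy rfl
    rw [T.flip_flip] at hy
    exact hy hx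
  have hf' : ∀ {x y}, T.rot.SameCycle k x → ¬ T.rot.SameCycle k y → T.flip x ≠ T.flip y := by
    intro x y hx hy e
    exact hS hx hy (T.flip.injective e)
  have l := h.left_notMem
  have r := h.right_notMem
  obtain ⟨n1, n2, n3, n4, n5, n6⟩ := ne_of_crossing h.cross
  have ng := (T.flip_ne g).symm
  have n1' := n1.symm
  have n2' := n2.symm
  have n3' := n3.symm
  have n4' := n4.symm
  have n5' := n5.symm
  have n6' := n6.symm
  simp only [List.nodup_cons, List.mem_cons, List.not_mem_nil, or_false, not_or,
    T.flip.injective.eq_iff, not_false_eq_true, List.nodup_nil, and_true]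
  refine ⟨⟨n1', n2', n3', hS s0 f0, hS s0 f1, hS s0 f2, hS s0 f3, hS s0 l, hS s0 r⟩,
    ⟨n4', n5', hS s1 f0, hS s1 f1, hS s1 f2, hS s1 f3, hS s1 l, hS s1 r⟩,
    ⟨n6', hS s2 f0, hS s2 f1, hS s2 f2, hS s2 f3, hS s2 l, hS s2 r⟩,
    ⟨hS s3 f0, hS s3 f1, hS s3 f2, hS s3 f3, hS s3 l, hS s3 r⟩,
    ⟨n1', n2', n3', hf s0 r, hS s0 l⟩, ⟨n4', n5', hf s1 r, hS s1 l⟩,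
    ⟨n6', hf s2 r, hS s2 l⟩, ⟨hf s3 r, hS s3 l⟩, ng⟩

theorem Pushable.ne (h : Pushable T g k) : ([k, T.rot k, T.rot (T.rot k), T.rot (T.rot (T.rot k)),
    T.flip k, T.flip (T.rot k), T.flip (T.rot (T.rot k)), T.flip (T.rot (T.rot (T.rot k))),
    g, T.flip g].Nodup) ∧ ([k, T.rot k, T.rot (T.rot k), T.rot (T.rot (T.rot k)),
    T.flip k, T.flip (T.rot k), T.flip (T.rot (T.rot k)), T.flip (T.rot (T.rot (T.rot k))),
    g, T.flip g].reverse.Nodup) := ⟨h.nodup, List.nodup_reverse.2 h.nodup⟩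

open Classical in
/-- A triangular region coloured by 1, and all other regions by 0. -/
theorem IsTriangle.isColoring {V : VirtualDiagram} {a b c : V.Dart} (t : IsTriangle V a b c) :
    V.IsColoring fun y => if y = a ∨ y = b ∨ y = c then 1 else 0 := by
  have key : ∀ {a b c : V.Dart}, IsTriangle V a b c → ∀ x,
      V.rot (V.rot (V.rot x)) = a ↔ V.flip x = c := by
    intro a b c t x
    rw [← V.rot.apply_eq_iff_eq, V.rot_four, ← t.edge_ca, ← V.flip.apply_eq_iff_eq, V.flip_flip]
  intro x
  have e : V.rot (V.rot (V.rot x)) = a ∨ V.rot (V.rot (V.rot x)) = b ∨ V.rot (V.rot (V.rot x)) = c ↔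
      V.flip x = a ∨ V.flip x = b ∨ V.flip x = c := by
    rw [key t, key t.rotate, key t.rotate.rotate]
    tauto
  simp only [e]

theorem pushStart_isTriangle (h : Pushable T g k) :
    IsTriangle (T.pushStart g k u) (.inl (.inl (.inr 0))) (.inl (.inr 1)) (.inl (.inl (.inl k))) := by
  have hne := h.ne
  simp only [List.reverse_cons, List.reverse_nil, List.nil_append, List.cons_append,
    List.nodup_cons, List.mem_cons, List.not_mem_nil, or_false, not_or, not_false_eq_true,
    List.nodup_nil, and_true] at hne
  have ff := T.flip_flip
  constructor
  · simp
  · simp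
  · simpa using h.cross
  · rw [sameCycle_rot]; simp
  · rw [sameCycle_rot]; simp
  · rw [sameCycle_rot]; simp
  all_goals
    simp (maxDischargeDepth := 6) [crossFlip_inl, crossFar_of_ne, crossPort_of_ne,
      *]

/-- The finger made before the push keeps the surface a sphere; the colouring that is 1 on the
triangle only has different corner sums at the two corners of the new bigon. -/
theorem pushStart_planar (h : Pushable T g k) (hT : (T.cross g (T.flip k) u).Planar) :
    (T.pushStart g k u).Planar := by
  have t := pushStart_isTriangle (u := u) h
  have hne := h.ne
  simp only [List.reverse_cons, List.reverse_nil, List.nil_append, List.cons_append,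
    List.nodup_cons, List.mem_cons, List.not_mem_nil, or_false, not_or, not_false_eq_true,
    List.nodup_nil, and_true] at hne
  have ff := T.flip_flip
  classical
  refine finger_planar ?_ ?_ hT ?_ t.isColoring ?_
  · simp
  · simp (maxDischargeDepth := 6) [crossPort_of_ne,
      *]
  · intro ψ hψ
    have e1 := hψ (.inr 1)
    have e2 := hψ (.inl (T.rot k))
    have e3 : (T.cross g (T.flip k) u).flip (.inr 1) = .inl k := by
      simp (maxDischargeDepth := 6) [crossFar_of_ne,
        crossPort_of_ne, *]
    have e4 : (T.cross g (T.flip k) u).flip (.inl (T.rot k)) = .inl (T.flip (T.rot k)) := by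
      simp (maxDischargeDepth := 6) [crossFlip_inl, crossFar_of_ne,
        crossPort_of_ne, *]
    rw [e3] at e1
    rw [e4] at e2
    change ψ (.inr 0) = _ at e1
    change ψ (.inl (T.rot (T.rot (T.rot (T.rot k))))) = _ at e2
    rw [T.rot_four] at e2
    exact e2.symm.trans e1.symm
  · simp [VirtualDiagram.cornerSum]

/-- The push itself is a third move at the triangle between the strand and the crossing `k`. -/
theorem pushStart_slides (h : Pushable T g k) :
    Slides (T.pushStart g k u) (T.pushEnd g k u) T.pushEquiv
      (.inl (.inl (.inr 0))) (.inl (.inr 1)) (.inl (.inl (.inl k))) := by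
  have t := pushStart_isTriangle (u := u) h
  have hne := h.ne
  simp only [List.reverse_cons, List.reverse_nil, List.nil_append, List.cons_append,
    List.nodup_cons, List.mem_cons, List.not_mem_nil, or_false, not_or, not_false_eq_true,
    List.nodup_nil, and_true] at hne
  have ff := T.flip_flip
  have r4 := T.rot_four
  obtain ⟨m1, m2, m3, m4, m5, m6⟩ := IsTriangle.mem (V := T.pushStart g k u)
    (.inl (.inl (.inr 0))) (.inl (.inr 1)) (.inl (.inl (.inl k)))
  have p1 := IsTriangle.slide_of_mem m1
  have p2 := IsTriangle.slide_of_mem m2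
  have p3 := IsTriangle.slide_of_mem m3
  have p4 := IsTriangle.slide_of_mem m4
  have p5 := IsTriangle.slide_of_mem m5
  have p6 := IsTriangle.slide_of_mem m6
  have q1 := t.slide_across m1
  have q2 := t.slide_across m2
  have q3 := t.slide_across m3
  have q4 := t.slide_across m4
  have q5 := t.slide_across m5
  have q6 := t.slide_across m6
  simp (maxDischargeDepth := 6) [crossFlip_inl, crossFar_of_ne,
    crossPort_of_ne, hne, ff] at p1 p2 p3 p4 p5 p6 q1 q2 q3 q4 q5 q6
  have s1 : ∀ x, x ≠ k → x ≠ T.rot k → x ≠ T.rot (T.rot k) → x ≠ T.rot (T.rot (T.rot k)) →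
      (T.pushStart g k u).slide (.inl (.inl (.inr 0))) (.inl (.inr 1)) (.inl (.inl (.inl k)))
        (.inl (.inl (.inl x))) = .inl (.inl (.inl x)) := by
    intro x h0 h1 h2 h3
    have h4 : T.rot (T.rot x) ≠ k := fun h => h2 (by rw [← h, T.rot_four])
    have h5 : T.rot (T.rot x) ≠ T.rot k := fun h => h3 (by rw [← h, T.rot_four])
    apply IsTriangle.slide_of_notMem <;> rw [mem_triangle] <;> simp [*]
  have s2 : ∀ i, (T.pushStart g k u).slide (.inl (.inl (.inr 0))) (.inl (.inr 1))
      (.inl (.inl (.inl k))) (.inr i) = .inr i := by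
    intro i
    apply IsTriangle.slide_of_notMem <;> rw [mem_triangle] <;> simp
  clear m1 m2 m3 m4 m5 m6 h
  refine ⟨t.1, t.2, t.3, t.4, t.5, t.6, t.7, t.8, t.9, ?_, ?_, ?_, ?_⟩
  · cases u <;> simp
  · rintro (((x | i) | i) | i) _ <;> rfl
  · rintro (((x | i) | i) | i)
    · by_cases e0 : x = k
      · rw [e0]
        simp (maxDischargeDepth := 6) [pushEquiv, crossFlip_inl,
          crossFar_of_ne, crossPort_of_ne, *]
      by_cases he : x = T.rot k ∨ x = T.rot (T.rot k) ∨ x = T.rot (T.rot (T.rot k)) ∨ x = T.flip k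
          ∨ x = T.flip (T.rot k) ∨ x = T.flip (T.rot (T.rot k)) ∨ x = T.flip (T.rot (T.rot (T.rot
          k))) ∨ x = g ∨ x = T.flip g
      · rcases he with e | e | e | e | e | e | e | e | e <;> rw [e] <;>
          simp (maxDischargeDepth := 6) [pushEquiv, crossFlip_inl, crossFar_of_ne, crossFar_flip',
            crossPort_of_ne, *]
      push Not at he
      obtain ⟨e1, e2, e3, e4, e5, e6, e7, e8, e9⟩ := he
      have e10 : T.flip x ≠ k := fun h => e4 (by rw [← h, T.flip_flip])
      have e11 : T.flip x ≠ T.rot k := fun h => e5 (by rw [← h, T.flip_flip])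
      have e12 : T.flip x ≠ T.rot (T.rot k) := fun h => e6 (by rw [← h, T.flip_flip])
      have e13 : T.flip x ≠ T.rot (T.rot (T.rot k)) := fun h => e7 (by rw [← h, T.flip_flip])
      simp (maxDischargeDepth := 6) [pushEquiv, crossFlip_inl,
        crossFar_of_ne, crossPort_of_ne, *]
    · obtain rfl | rfl | rfl | rfl : i = 0 ∨ i = 1 ∨ i = 2 ∨ i = 3 := by revert i; decide
      all_goals
        simp (maxDischargeDepth := 6) [pushEquiv, crossFlip_inl,
          crossFar_of_ne, crossPort_of_ne, *]
    · obtain rfl | rfl | rfl | rfl : i = 0 ∨ i = 1 ∨ i = 2 ∨ i = 3 := by revert i; decide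
      all_goals
        simp (maxDischargeDepth := 6) [pushEquiv, crossFlip_inl,
          crossFar_of_ne, crossPort_of_ne, *]
    · obtain rfl | rfl | rfl | rfl : i = 0 ∨ i = 1 ∨ i = 2 ∨ i = 3 := by revert i; decide
      all_goals
        simp (maxDischargeDepth := 6) [pushEquiv, crossFlip_inl,
          crossFar_of_ne, crossPort_of_ne, *]
  · rintro (((x | i) | i) | i) <;> rfl

/-- A strand may be pushed across a crossing. -/
theorem Pushable.linked (h : Pushable T g k) (hT : (T.cross g (T.flip k) u).Planar) {x : T.Dart}
    (hx : ¬ T.rot.SameCycle k x) :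
    Linked (T.cross g (T.flip k) u) (.inl x) (T.pushEnd g k u) (.inl (.inl (.inl x))) := by
  have hP := pushStart_planar h hT
  have m := pushStart_slides (u := u) h
  have hne := h.ne
  simp only [List.reverse_cons, List.reverse_nil, List.nil_append, List.cons_append,
    List.nodup_cons, List.mem_cons, List.not_mem_nil, or_false, not_or, not_false_eq_true,
    List.nodup_nil, and_true] at hne
  rw [sameCycle_rot] at hx
  push Not at hx
  obtain ⟨h0, h1, h2, h3⟩ := hx
  have h4 : T.rot (T.rot x) ≠ k := fun h => h2 (by rw [← h, T.rot_four])
  have h5 : T.rot (T.rot x) ≠ T.rot k := fun h => h3 (by rw [← h, T.rot_four])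
  have n1 : (.inl (.inl (.inl x)) : (T.pushStart g k u).Dart) ∉ (T.pushStart g k u).triangle
      (.inl (.inl (.inr 0))) (.inl (.inr 1)) (.inl (.inl (.inl k))) := by
    rw [mem_triangle]; simp [*]
  have n2 : (T.pushStart g k u).rot ((T.pushStart g k u).rot (.inl (.inl (.inl x)))) ∉
      (T.pushStart g k u).triangle
      (.inl (.inl (.inr 0))) (.inl (.inr 1)) (.inl (.inl (.inl k))) := by
    rw [mem_triangle]; simp [*]
  have l2 := m.linked hP n1
  rw [IsTriangle.slide_of_notMem n1 n2] at l2
  refine (finger_linked (T := T.cross g (T.flip k) u) ?_ ?_ hP (.inl x)).symm.trans l2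
  · simp
  · simp [crossPort_of_ne, *]

end

end VirtualDiagram

namespace VirtualDiagram

/-! ### A strand that crosses a list of half-edges -/

section

variable {T M N : VirtualDiagram} {α : T.Dart} {u : Bool} {ds A C : List T.Dart}
  {r : T.Dart → M.Dart} {c : T.Dart → Fin 4 → M.Dart}

open Classical in
/-- The half of the edge of `d` that leads to the other end of the edge: it starts at the crossing
with the strand if there is one on the half-edge `d`. -/
noncomputable def threadPort (ds : List T.Dart) (r : T.Dart → M.Dart) (c : T.Dart → Fin 4 → M.Dart)
    (d : T.Dart) : M.Dart :=
  if d ∈ ds then c d 1 else r d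

/-- The dart that points forward along the strand, after the crossings with `A`. -/
noncomputable def threadFwd (α : T.Dart) (ds : List T.Dart) (r : T.Dart → M.Dart)
    (c : T.Dart → Fin 4 → M.Dart) (A : List T.Dart) : M.Dart :=
  match A.getLast? with
  | none => threadPort ds r c α
  | some a => c a 0

/-- The dart that points backward along the strand, before the crossings with `C`. -/
noncomputable def threadBwd (α : T.Dart) (ds : List T.Dart) (r : T.Dart → M.Dart)
    (c : T.Dart → Fin 4 → M.Dart) (C : List T.Dart) : M.Dart :=
  match C.head? with
  | none => threadPort ds r c (T.flip α)
  | some a => c a 2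

/-- `M` arises from `T` by rerouting the edge from `α` to `T.flip α`, as a strand that crosses the
half-edges in `ds` one after the other, each of them close to its vertex and with that vertex on
the right of the strand.  The strand is the upper one at these crossings if `u` is true.
The darts of `T` are included in `M` by `r`, and `c d i`, for `i = 0, 1, 2, 3`, are the darts at the
crossing with the half-edge `d` in the directions forward, left, backward, right. -/
structure Threaded (T : VirtualDiagram) (α : T.Dart) (u : Bool) (ds : List T.Dart)
    (M : VirtualDiagram) (r : T.Dart → M.Dart) (c : T.Dart → Fin 4 → M.Dart) : Prop where
  nodup : ds.Nodup
  r_inj : Function.Injective r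
  c_inj : ∀ d ∈ ds, ∀ d' ∈ ds, ∀ i i', c d i = c d' i' → d = d' ∧ i = i'
  r_ne : ∀ x, ∀ d ∈ ds, ∀ i, r x ≠ c d i
  cases : ∀ y, (∃ x, y = r x) ∨ ∃ d ∈ ds, ∃ i, y = c d i
  rot_r : ∀ x, M.rot (r x) = r (T.rot x)
  rot_c : ∀ d ∈ ds, ∀ i, M.rot (c d i) = c d (i + 1)
  upper_r : ∀ x, M.upper (r x) = T.upper x
  upper_c : ∀ d ∈ ds, ∀ i, M.upper (c d i) = if i = 0 ∨ i = 2 then u else !u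
  flip_near : ∀ d ∈ ds, M.flip (c d 3) = r d
  flip_port : ∀ d, d ≠ α → d ≠ T.flip α →
    M.flip (threadPort ds r c d) = threadPort ds r c (T.flip d)
  flip_thread : ∀ A C, ds = A ++ C → M.flip (threadFwd α ds r c A) = threadBwd α ds r c C

theorem threadPort_of_mem {d : T.Dart} (h : d ∈ ds) : threadPort ds r c d = c d 1 := if_pos h

theorem threadPort_of_notMem {d : T.Dart} (h : d ∉ ds) : threadPort ds r c d = r d := if_neg h

@[simp] theorem threadFwd_nil : threadFwd α ds r c [] = threadPort ds r c α := rfl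

@[simp] theorem threadBwd_nil : threadBwd α ds r c [] = threadPort ds r c (T.flip α) := rfl

@[simp] theorem threadFwd_concat (A : List T.Dart) (a : T.Dart) :
    threadFwd α ds r c (A ++ [a]) = c a 0 := by
  simp [threadFwd]

@[simp] theorem threadBwd_cons (a : T.Dart) (C : List T.Dart) :
    threadBwd α ds r c (a :: C) = c a 2 := rfl

/-- Every prefix is empty or ends with an element of the list. -/
theorem eq_nil_or_concat_mem (h : ds = A ++ C) : A = [] ∨ ∃ A' a, A = A' ++ [a] ∧ a ∈ ds := by
  rcases List.eq_nil_or_concat' A with rfl | ⟨A', a, rfl⟩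
  · exact Or.inl rfl
  · exact Or.inr ⟨A', a, rfl, by simp [h]⟩

theorem eq_nil_or_cons_mem (h : ds = A ++ C) : C = [] ∨ ∃ a C', C = a :: C' ∧ a ∈ ds := by
  cases C with
  | nil => exact Or.inl rfl
  | cons a C' => exact Or.inr ⟨a, C', rfl, by simp [h]⟩

namespace Threaded

theorem refl (T : VirtualDiagram) (α : T.Dart) (u : Bool) :
    Threaded T α u [] T id fun d _ => d where
  nodup := List.nodup_nil
  r_inj := Function.injective_id
  c_inj := by simp
  r_ne := by simp
  cases y := Or.inl ⟨y, rfl⟩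
  rot_r _ := rfl
  rot_c := by simp
  upper_r _ := rfl
  upper_c := by simp
  flip_near := by simp
  flip_port d _ _ := by simp [threadPort]
  flip_thread A C h := by
    obtain ⟨rfl, rfl⟩ := List.append_eq_nil_iff.1 h.symm
    simp [threadPort]

theorem port_inj (H : Threaded T α u ds M r c) {d e : T.Dart}
    (h : threadPort ds r c d = threadPort ds r c e) : d = e := by
  unfold threadPort at h
  split_ifs at h with h1 h2 h2
  · exact (H.c_inj d h1 e h2 _ _ h).1
  · exact absurd h.symm (H.r_ne _ _ h1 _)
  · exact absurd h (H.r_ne _ _ h2 _)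
  · exact H.r_inj h

theorem port_ne (H : Threaded T α u ds M r c) (d : T.Dart) {a : T.Dart} (ha : a ∈ ds) {i : Fin 4}
    (hi : i ≠ 1) : threadPort ds r c d ≠ c a i := by
  intro h
  unfold threadPort at h
  split_ifs at h with h1
  · exact hi (H.c_inj _ h1 _ ha _ _ h).2.symm
  · exact H.r_ne _ _ ha _ h

theorem c_ne (H : Threaded T α u ds M r c) {a b : T.Dart} (ha : a ∈ ds) (hb : b ∈ ds) {i j : Fin 4}
    (h : i ≠ j) : c a i ≠ c b j := fun e => h (H.c_inj a ha b hb _ _ e).2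

theorem fwd_ne_bwd (H : Threaded T α u ds M r c) {A' C' : List T.Dart} (h : ds = A ++ C)
    (h' : ds = A' ++ C') : threadFwd α ds r c A ≠ threadBwd α ds r c C' := by
  obtain rfl | ⟨A, a, rfl, ha⟩ := eq_nil_or_concat_mem h <;>
    obtain rfl | ⟨b, C', rfl, hb⟩ := eq_nil_or_cons_mem h'
  · intro e
    exact T.flip_ne α (H.port_inj e).symm
  · exact H.port_ne _ hb (by decide)
  · rw [threadFwd_concat]
    exact (H.port_ne _ ha (by decide)).symm
  · rw [threadFwd_concat]
    exact H.c_ne ha hb (by decide)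

theorem port_ne_fwd (H : Threaded T α u ds M r c) (h : ds = A ++ C) {d : T.Dart} (hd : d ≠ α) :
    threadPort ds r c d ≠ threadFwd α ds r c A := by
  obtain rfl | ⟨A, a, rfl, ha⟩ := eq_nil_or_concat_mem h
  · exact fun e => hd (H.port_inj e)
  · rw [threadFwd_concat]
    exact H.port_ne _ ha (by decide)

theorem port_ne_bwd (H : Threaded T α u ds M r c) (h : ds = A ++ C) {d : T.Dart}
    (hd : d ≠ T.flip α) : threadPort ds r c d ≠ threadBwd α ds r c C := by
  obtain rfl | ⟨a, C, rfl, ha⟩ := eq_nil_or_cons_mem h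
  · exact fun e => hd (H.port_inj e)
  · exact H.port_ne _ ha (by decide)

theorem c_three_ne_fwd (H : Threaded T α u ds M r c) (h : ds = A ++ C) {d : T.Dart} (hd : d ∈ ds) :
    c d 3 ≠ threadFwd α ds r c A := by
  obtain rfl | ⟨A, a, rfl, ha⟩ := eq_nil_or_concat_mem h
  · exact (H.port_ne _ hd (by decide)).symm
  · rw [threadFwd_concat]
    exact H.c_ne hd ha (by decide)

theorem c_three_ne_bwd (H : Threaded T α u ds M r c) (h : ds = A ++ C) {d : T.Dart} (hd : d ∈ ds) :
    c d 3 ≠ threadBwd α ds r c C := by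
  obtain rfl | ⟨a, C, rfl, ha⟩ := eq_nil_or_cons_mem h
  · exact (H.port_ne _ hd (by decide)).symm
  · exact H.c_ne hd ha (by decide)

theorem fwd_inj (H : Threaded T α u ds M r c) {A' C' : List T.Dart} (h : ds = A ++ C)
    (h' : ds = A' ++ C') (e : threadFwd α ds r c A = threadFwd α ds r c A') : A = A' := by
  obtain rfl | ⟨A, a, rfl, ha⟩ := eq_nil_or_concat_mem h <;>
    obtain rfl | ⟨A', b, rfl, hb⟩ := eq_nil_or_concat_mem h'
  · rfl
  · rw [threadFwd_concat] at e
    exact absurd e (H.port_ne _ hb (by decide))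
  · rw [threadFwd_concat] at e
    exact absurd e.symm (H.port_ne _ ha (by decide))
  · rw [threadFwd_concat, threadFwd_concat] at e
    obtain rfl := (H.c_inj _ ha _ hb _ _ e).1
    have hn := H.nodup
    simp only [List.append_assoc, List.singleton_append] at h h'
    rw [h, List.nodup_middle, List.nodup_cons, List.mem_append, not_or] at hn
    rw [((List.append_cons_inj_of_notMem hn.1.1 hn.1.2).1 (h.symm.trans h')).1]

theorem r_ne_fwd (H : Threaded T α u ds M r c) (h : ds = A ++ C) {x : T.Dart} (hx : x ≠ α) :
    r x ≠ threadFwd α ds r c A := by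
  obtain rfl | ⟨A, a, rfl, ha⟩ := eq_nil_or_concat_mem h
  · rw [threadFwd_nil, threadPort]
    split_ifs with h'
    · exact H.r_ne _ _ h' _
    · exact fun e => hx (H.r_inj e)
  · rw [threadFwd_concat]
    exact H.r_ne _ _ ha _

theorem r_ne_bwd (H : Threaded T α u ds M r c) (h : ds = A ++ C) {x : T.Dart}
    (hx : x ≠ T.flip α) : r x ≠ threadBwd α ds r c C := by
  obtain rfl | ⟨a, C, rfl, ha⟩ := eq_nil_or_cons_mem h
  · rw [threadBwd_nil, threadPort]
    split_ifs with h'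
    · exact H.r_ne _ _ h' _
    · exact fun e => hx (H.r_inj e)
  · exact H.r_ne _ _ ha _

open Classical in
/-- The darts at the crossings after a crossing with `d` has been added. -/
noncomputable def insertDarts (c : T.Dart → Fin 4 → M.Dart) (d e : T.Dart) (i : Fin 4) :
    M.Dart ⊕ Fin 4 :=
  if e = d then .inr i else .inl (c e i)

@[simp] theorem insertDarts_self (c : T.Dart → Fin 4 → M.Dart) (d : T.Dart) (i : Fin 4) :
    insertDarts c d d i = .inr i := if_pos rfl

theorem insertDarts_of_ne {e d : T.Dart} (h : e ≠ d) (i : Fin 4) :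
    insertDarts c d e i = .inl (c e i) := if_neg h

theorem port_insert (H : Threaded T α u (A ++ C) M r c) {d : T.Dart} (hd : d ∉ A ++ C)
    (e : T.Dart) :
    threadPort (M := M.cross (threadFwd α (A ++ C) r c A) (r d) u) (A ++ d :: C)
      (fun x => .inl (r x)) (insertDarts c d) e = crossPort (r d) (threadPort (A ++ C) r c e) := by
  by_cases h : e = d
  · subst h
    rw [threadPort_of_mem (by simp), threadPort_of_notMem hd, crossPort_self, insertDarts_self]
  · by_cases h' : e ∈ A ++ C
    · rw [threadPort_of_mem h', threadPort_of_mem, insertDarts_of_ne h,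
        crossPort_of_ne (H.r_ne _ _ h' _).symm]
      simp only [List.mem_append, List.mem_cons] at h' ⊢
      tauto
    · rw [threadPort_of_notMem h', threadPort_of_notMem, crossPort_of_ne fun e => h (H.r_inj e)]
      simp only [List.mem_append, List.mem_cons] at h' ⊢
      tauto

/-- Adding one crossing to the strand. -/
theorem insert (H : Threaded T α u (A ++ C) M r c) {d : T.Dart} (hd : d ∉ A ++ C)
    {g q : M.Dart} (hg : g = threadFwd α (A ++ C) r c A) (hq : q = r d) :
    Threaded T α u (A ++ d :: C) (M.cross g q u) (fun x => .inl (r x)) (insertDarts c d) := by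
  subst hg hq
  have hmem : ∀ {e}, e ∈ A ++ d :: C → e = d ∨ e ≠ d ∧ e ∈ A ++ C := by
    intro e he
    by_cases h : e = d
    · exact Or.inl h
    · simp only [List.mem_append, List.mem_cons] at he ⊢
      tauto
  have hthread := H.flip_thread A C rfl
  have hfwd : ∀ X Y, A ++ C = X ++ Y →
      threadFwd (M := M.cross (threadFwd α (A ++ C) r c A) (r d) u) α (A ++ d :: C)
        (fun x => .inl (r x)) (insertDarts c d) X =
      crossPort (r d) (threadFwd α (A ++ C) r c X) := by
    intro X Y h
    obtain rfl | ⟨X, a, rfl, ha⟩ := eq_nil_or_concat_mem h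
    · exact H.port_insert hd _
    · rw [threadFwd_concat, threadFwd_concat, insertDarts_of_ne (ne_of_mem_of_not_mem ha hd),
        crossPort_of_ne (H.r_ne _ _ ha _).symm]
  have hbwd : ∀ X Y, A ++ C = X ++ Y →
      threadBwd (M := M.cross (threadFwd α (A ++ C) r c A) (r d) u) α (A ++ d :: C)
        (fun x => .inl (r x)) (insertDarts c d) Y =
      crossPort (r d) (threadBwd α (A ++ C) r c Y) := by
    intro X Y h
    obtain rfl | ⟨a, Y, rfl, ha⟩ := eq_nil_or_cons_mem h
    · exact H.port_insert hd _
    · rw [threadBwd_cons, threadBwd_cons, insertDarts_of_ne (ne_of_mem_of_not_mem ha hd),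
        crossPort_of_ne (H.r_ne _ _ ha _).symm]
  have hother : ∀ X Y, A ++ C = X ++ Y → X ≠ A →
      (M.cross (threadFwd α (A ++ C) r c A) (r d) u).flip
        (crossPort (r d) (threadFwd α (A ++ C) r c X)) =
      crossPort (r d) (threadBwd α (A ++ C) r c Y) := by
    intro X Y h hX
    refine (crossFlip_port _ _ _).trans ?_
    rw [crossFar_of_ne, H.flip_thread X Y h]
    · exact fun e => hX (H.fwd_inj h rfl e)
    · rw [hthread]
      exact H.fwd_ne_bwd h rfl
  constructor
  · have := H.nodup
    rw [List.nodup_middle, List.nodup_cons]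
    exact ⟨hd, this⟩
  · exact fun x y e => H.r_inj (Sum.inl_injective e)
  · intro e he e' he' i i' h
    rcases hmem he with rfl | ⟨he, he1⟩ <;> rcases hmem he' with rfl | ⟨he', he1'⟩
    · rw [insertDarts_self, insertDarts_self] at h
      exact ⟨rfl, Sum.inr_injective h⟩
    · rw [insertDarts_self, insertDarts_of_ne he'] at h
      exact nomatch h
    · rw [insertDarts_self, insertDarts_of_ne he] at h
      exact nomatch h
    · rw [insertDarts_of_ne he', insertDarts_of_ne he] at h
      exact H.c_inj _ he1 _ he1' _ _ (Sum.inl_injective h)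
  · intro x e he i h
    rcases hmem he with rfl | ⟨he, he1⟩
    · rw [insertDarts_self] at h
      exact nomatch h
    · rw [insertDarts_of_ne he] at h
      exact H.r_ne _ _ he1 _ (Sum.inl_injective h)
  · rintro (y | i)
    · rcases H.cases y with ⟨x, rfl⟩ | ⟨e, he, i, rfl⟩
      · exact Or.inl ⟨x, rfl⟩
      · refine Or.inr ⟨e, ?_, i, ?_⟩
        · simp only [List.mem_append, List.mem_cons] at he ⊢
          tauto
        · rw [insertDarts_of_ne (ne_of_mem_of_not_mem he hd)]
    · exact Or.inr ⟨d, by simp, i, by rw [insertDarts_self]⟩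
  · intro x
    exact congrArg Sum.inl (H.rot_r x)
  · intro e he i
    rcases hmem he with rfl | ⟨he, he1⟩
    · rw [insertDarts_self, insertDarts_self]
      rfl
    · rw [insertDarts_of_ne he, insertDarts_of_ne he]
      exact congrArg Sum.inl (H.rot_c e he1 i)
  · exact H.upper_r
  · intro e he i
    rcases hmem he with rfl | ⟨he, he1⟩
    · rw [insertDarts_self]
      rfl
    · rw [insertDarts_of_ne he]
      exact H.upper_c e he1 i
  · intro e he
    rcases hmem he with rfl | ⟨he, he1⟩
    · rw [insertDarts_self]
      rfl
    · rw [insertDarts_of_ne he]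
      refine (crossFlip_inl (H.r_ne _ _ he1 _).symm).trans ?_
      rw [crossFar_of_ne (H.c_three_ne_fwd rfl he1), H.flip_near e he1,
        crossPort_of_ne fun h => he (H.r_inj h)]
      rw [hthread]
      exact H.c_three_ne_bwd rfl he1
  · intro e h1 h2
    rw [H.port_insert hd, H.port_insert hd, ← H.flip_port e h1 h2]
    refine (crossFlip_port _ _ _).trans (crossFar_of_ne (H.port_ne_fwd rfl h1) ?_)
    rw [hthread]
    exact H.port_ne_bwd rfl h2
  · intro X Y h
    rcases List.append_eq_append_iff.1 h with ⟨E, rfl, h'⟩ | ⟨E, rfl, rfl⟩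
    · cases E with
      | nil =>
        obtain rfl : d :: C = Y := h'
        rw [List.append_nil, hfwd A C rfl, threadBwd_cons, insertDarts_self]
        exact (crossFlip_port _ _ _).trans (crossFar_self _ _)
      | cons e E =>
        simp only [List.cons_append, List.cons.injEq] at h'
        obtain ⟨rfl, rfl⟩ := h'
        rcases List.eq_nil_or_concat' E with rfl | ⟨E, a, rfl⟩
        · rw [threadFwd_concat, insertDarts_self, hbwd A Y (by simp)]
          exact congrArg (crossPort _) hthread
        · have ha : a ∈ A ++ (E ++ [a] ++ Y) := by simp
          have k := hother ((A ++ E) ++ [a]) Y (by simp) fun e => by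
            have := congrArg List.length e
            simp only [List.length_append, List.length_singleton] at this
            omega
          rw [threadFwd_concat, crossPort_of_ne (H.r_ne _ _ ha _).symm] at k
          have e : A ++ d :: (E ++ [a]) = (A ++ d :: E) ++ [a] := by simp
          rw [e, threadFwd_concat, insertDarts_of_ne (ne_of_mem_of_not_mem ha hd),
            hbwd ((A ++ E) ++ [a]) Y (by simp)]
          exact k
    · cases E with
      | nil =>
        have k := hfwd X C (by simp)
        rw [k, List.nil_append, threadBwd_cons, insertDarts_self]
        have e : threadFwd α (X ++ [] ++ C) r c X = threadFwd α (X ++ [] ++ C) r c (X ++ []) := by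
          rw [List.append_nil]
        rw [e]
        exact (crossFlip_port _ _ _).trans (crossFar_self _ _)
      | cons e E =>
        have k := hother X (e :: E ++ C) (by simp) fun h => by
          have := congrArg List.length h
          simp only [List.length_append, List.length_cons] at this
          omega
        have he : e ∈ X ++ e :: E ++ C := by simp
        rw [hfwd X (e :: E ++ C) (by simp), k]
        simp only [List.cons_append, threadBwd_cons]
        rw [insertDarts_of_ne (ne_of_mem_of_not_mem he hd), crossPort_of_ne (H.r_ne _ _ he _).symm]

theorem exists_of_nodup (T : VirtualDiagram) (α : T.Dart) (u : Bool) (ds : List T.Dart)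
    (h : ds.Nodup) : ∃ M r c, Threaded T α u ds M r c := by
  induction ds using List.reverseRecOn with
  | nil => exact ⟨_, _, _, refl T α u⟩
  | append_singleton A d ih =>
    rw [List.nodup_append] at h
    obtain ⟨M, r, c, H⟩ := ih h.1
    have hd : d ∉ A ++ [] := by
      rw [List.append_nil]
      exact fun h' => h.2.2 d h' d (by simp) rfl
    rw [← List.append_nil A] at H
    exact ⟨_, _, _, H.insert hd rfl rfl⟩

/-- Every dart is one of those whose partner is prescribed. -/
theorem flip_cases (H : Threaded T α u ds M r c) {P : M.Dart → Prop}
    (near : ∀ d ∈ ds, P (c d 3)) (far : ∀ d ∈ ds, P (r d))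
    (port : ∀ d, d ≠ α → d ≠ T.flip α → P (threadPort ds r c d))
    (fwd : ∀ A C, ds = A ++ C → P (threadFwd α ds r c A))
    (bwd : ∀ A C, ds = A ++ C → P (threadBwd α ds r c C)) (y : M.Dart) : P y := by
  have hport : ∀ d, P (threadPort ds r c d) := by
    intro d
    by_cases h1 : d = α
    · exact h1 ▸ fwd [] ds rfl
    · by_cases h2 : d = T.flip α
      · exact h2 ▸ bwd ds [] (by simp)
      · exact port d h1 h2
  rcases H.cases y with ⟨x, rfl⟩ | ⟨d, hd, i, rfl⟩
  · by_cases h : x ∈ ds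
    · exact far x h
    · have := hport x
      rwa [threadPort_of_notMem h] at this
  · obtain ⟨A, C, h⟩ := List.append_of_mem hd
    obtain rfl | rfl | rfl | rfl : i = 0 ∨ i = 1 ∨ i = 2 ∨ i = 3 := by revert i; decide
    · have := fwd (A ++ [d]) C (by simp [h])
      rwa [threadFwd_concat] at this
    · have := hport d
      rwa [threadPort_of_mem hd] at this
    · exact bwd A (d :: C) h
    · exact near d hd

theorem flip_bwd (H : Threaded T α u ds M r c) (h : ds = A ++ C) :
    M.flip (threadBwd α ds r c C) = threadFwd α ds r c A := by
  rw [← H.flip_thread A C h, M.flip_flip]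

theorem flip_far (H : Threaded T α u ds M r c) {d : T.Dart} (h : d ∈ ds) :
    M.flip (r d) = c d 3 := by
  rw [← H.flip_near d h, M.flip_flip]

/-- The diagram is determined by the list. -/
theorem exists_isIso (H : Threaded T α u ds M r c) {s : T.Dart → N.Dart}
    {e : T.Dart → Fin 4 → N.Dart} (H' : Threaded T α u ds N s e) :
    ∃ j : N.Dart ≃ M.Dart, IsIso M N j ∧ ∀ x, j (s x) = r x := by
  have hex : ∀ y : N.Dart, ∃ z : M.Dart, (∀ x, y = s x → z = r x) ∧
      ∀ d ∈ ds, ∀ i, y = e d i → z = c d i := by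
    intro y
    rcases H'.cases y with ⟨x, rfl⟩ | ⟨d, hd, i, rfl⟩
    · exact ⟨r x, fun x' h => by rw [H'.r_inj h], fun d hd i h => absurd h (H'.r_ne _ _ hd _)⟩
    · refine ⟨c d i, fun x' h => absurd h.symm (H'.r_ne _ _ hd _), fun d' hd' i' h => ?_⟩
      obtain ⟨rfl, rfl⟩ := H'.c_inj _ hd _ hd' _ _ h
      rfl
  choose f hf1 hf2 using hex
  have fr : ∀ x, f (s x) = r x := fun x => hf1 _ x rfl
  have fc : ∀ d ∈ ds, ∀ i, f (e d i) = c d i := fun d hd i => hf2 _ d hd i rfl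
  have hbij : Function.Bijective f := by
    constructor
    · intro y z h
      rcases H'.cases y with ⟨x, rfl⟩ | ⟨d, hd, i, rfl⟩ <;>
        rcases H'.cases z with ⟨x', rfl⟩ | ⟨d', hd', i', rfl⟩
      · rw [fr, fr] at h
        rw [H.r_inj h]
      · rw [fr, fc d' hd'] at h
        exact absurd h (H.r_ne _ _ hd' _)
      · rw [fr, fc d hd] at h
        exact absurd h.symm (H.r_ne _ _ hd _)
      · rw [fc d hd, fc d' hd'] at h
        obtain ⟨rfl, rfl⟩ := H.c_inj _ hd _ hd' _ _ h
        rfl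
    · intro y
      rcases H.cases y with ⟨x, rfl⟩ | ⟨d, hd, i, rfl⟩
      · exact ⟨_, fr x⟩
      · exact ⟨_, fc d hd i⟩
  have fport : ∀ d, f (threadPort ds s e d) = threadPort ds r c d := by
    intro d
    unfold threadPort
    split_ifs with h
    · exact fc d h 1
    · exact fr d
  have ffwd : ∀ A C, ds = A ++ C → f (threadFwd α ds s e A) = threadFwd α ds r c A := by
    intro A C h
    obtain rfl | ⟨A, a, rfl, ha⟩ := eq_nil_or_concat_mem h
    · exact fport _
    · rw [threadFwd_concat, threadFwd_concat, fc a ha]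
  have fbwd : ∀ A C, ds = A ++ C → f (threadBwd α ds s e C) = threadBwd α ds r c C := by
    intro A C h
    obtain rfl | ⟨a, C, rfl, ha⟩ := eq_nil_or_cons_mem h
    · exact fport _
    · exact fc a ha 2
  refine ⟨Equiv.ofBijective f hbij, ⟨?_, ?_, ?_⟩, fr⟩
  · intro y _
    change _ = M.upper (f y)
    rcases H'.cases y with ⟨x, rfl⟩ | ⟨d, hd, i, rfl⟩
    · rw [fr, H.upper_r, H'.upper_r]
    · rw [fc d hd, H.upper_c d hd, H'.upper_c d hd]
  · intro y
    change f (N.flip y) = M.flip (f y)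
    refine H'.flip_cases (P := fun y => f (N.flip y) = M.flip (f y)) ?_ ?_ ?_ ?_ ?_ y
    · intro d hd
      rw [H'.flip_near d hd, fr, fc d hd, H.flip_near d hd]
    · intro d hd
      rw [H'.flip_far hd, fr, fc d hd, H.flip_far hd]
    · intro d h1 h2
      rw [H'.flip_port d h1 h2, fport, fport, H.flip_port d h1 h2]
    · intro A C h
      rw [H'.flip_thread A C h, fbwd A C h, ffwd A C h, H.flip_thread A C h]
    · intro A C h
      rw [H'.flip_bwd h, fbwd A C h, ffwd A C h, H.flip_bwd h]
  · intro y
    change f (N.rot y) = M.rot (f y)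
    rcases H'.cases y with ⟨x, rfl⟩ | ⟨d, hd, i, rfl⟩
    · rw [H'.rot_r, fr, fr, H.rot_r]
    · rw [H'.rot_c d hd, fc d hd, fc d hd, H.rot_c d hd]

end Threaded

end

end VirtualDiagram

namespace VirtualDiagram

/-! ### Moving the strand -/

section

variable {T S : VirtualDiagram} {α k₀ : T.Dart} {u : Bool} {s : S.Dart} {ds A C : List T.Dart}

/-- The diagram `S`, punctured on both sides of `s`, can be transformed into `T` with the strand
crossing `ds`, punctured on both sides of `k₀`. -/
def Reaches (T : VirtualDiagram) (α k₀ : T.Dart) (u : Bool) (S : VirtualDiagram) (s : S.Dart)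
    (ds : List T.Dart) : Prop :=
  ∃ M r c, Threaded T α u ds M r c ∧ Linked S s M (r k₀)

namespace Reaches

theorem linked (h : Reaches T α k₀ u S s ds) {M : VirtualDiagram} {r : T.Dart → M.Dart}
    {c : T.Dart → Fin 4 → M.Dart} (H : Threaded T α u ds M r c) : Linked S s M (r k₀) := by
  obtain ⟨N, r', c', H', l⟩ := h
  obtain ⟨j, m, hj⟩ := H'.exists_isIso H
  have := m.linked l.right_planar (r k₀)
  rw [hj] at this
  exact l.trans this

theorem nodup (h : Reaches T α k₀ u S s ds) : ds.Nodup :=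
  let ⟨_, _, _, H, _⟩ := h
  H.nodup

/-- The situation before a move of the strand near one of its crossings. -/
theorem exists_cross {d : T.Dart} (h : Reaches T α k₀ u S s (A ++ d :: C)) :
    d ∉ A ++ C ∧ ∃ M r c, Threaded T α u (A ++ C) M r c ∧
      Linked S s (M.cross (threadFwd α (A ++ C) r c A) (r d) u) (.inl (r k₀)) := by
  have hn := h.nodup
  rw [List.nodup_middle, List.nodup_cons] at hn
  obtain ⟨M, r, c, H⟩ := Threaded.exists_of_nodup T α u (A ++ C) hn.2
  exact ⟨hn.1, M, r, c, H, h.linked (H.insert hn.1 rfl rfl)⟩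

/-- Push the strand across an auxiliary point. -/
theorem push_aux {d : T.Dart} (h : Reaches T α k₀ u S s (A ++ d :: C))
    (hk : T.rot (T.rot (T.flip d)) = T.flip d) (hrk : d ≠ T.rot (T.flip d))
    (h1 : d ≠ α) (h2 : d ≠ T.flip α) (hds : T.flip d ∉ A ++ C) (hds' : T.rot (T.flip d) ∉ A ++ C)
    (h3 : k₀ ≠ T.flip d) (h4 : k₀ ≠ T.rot (T.flip d)) :
    Reaches T α k₀ u S s (A ++ T.rot (T.flip d) :: C) := by
  obtain ⟨hd, M, r, c, H, l⟩ := h.exists_cross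
  refine ⟨_, _, _, H.insert hds' rfl rfl, l.trans ?_⟩
  have h5 : T.flip d ≠ α := fun e => h2 (by rw [← e, T.flip_flip])
  have h6 : T.flip d ≠ T.flip α := fun e => h1 (T.flip.injective e)
  have e : M.flip (r (T.flip d)) = r d := by
    have := H.flip_port _ h5 h6
    rwa [T.flip_flip, threadPort_of_notMem hds, threadPort_of_notMem hd] at this
  have lp := l.right_planar
  rw [← e] at lp ⊢
  rw [← H.rot_r]
  refine cross_aux_linked ?_ ?_ (H.r_ne_fwd rfl h5) ?_ ?_ ?_ lp
  · rw [H.rot_r, H.rot_r, hk]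
  · rw [e, H.rot_r]
    exact fun e => hrk (H.r_inj e)
  · rw [H.flip_thread A C rfl]
    exact H.r_ne_bwd rfl h6
  · exact fun e => h3 (H.r_inj e)
  · rw [H.rot_r]
    exact fun e => h4 (H.r_inj e)

/-- Push the strand across a crossing. -/
theorem push_crossing {d : T.Dart} (h : Reaches T α k₀ u S s (A ++ d :: C))
    (hk : T.rot (T.rot (T.flip d)) ≠ T.flip d)
    (hflip : ∀ x, T.rot.SameCycle (T.flip d) x → ¬ T.rot.SameCycle (T.flip d) (T.flip x))
    (h1 : ¬ T.rot.SameCycle (T.flip d) α) (h2 : ¬ T.rot.SameCycle (T.flip d) (T.flip α))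
    (hds : ∀ x, T.rot.SameCycle (T.flip d) x → x ∉ A ++ C)
    (h3 : ¬ T.rot.SameCycle (T.flip d) k₀) :
    Reaches T α k₀ u S s (A ++ T.rot (T.rot (T.rot (T.flip d))) :: T.rot (T.rot (T.flip d)) ::
      T.rot (T.flip d) :: C) := by
  obtain ⟨hd, M, r, c, H, l⟩ := h.exists_cross
  obtain ⟨s0, s1, s2, s3⟩ := sameCycle_self (T.flip d)
  have h5 : T.flip d ≠ α := fun e => h1 (e ▸ s0)
  have h6 : T.flip d ≠ T.flip α := fun e => h2 (e ▸ s0)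
  have e : M.flip (r (T.flip d)) = r d := by
    have := H.flip_port _ h5 h6
    rwa [T.flip_flip, threadPort_of_notMem (hds _ s0), threadPort_of_notMem hd] at this
  have hS : ∀ {y}, M.rot.SameCycle (r (T.flip d)) y → ∃ x, T.rot.SameCycle (T.flip d) x ∧ y = r x := by
    intro y hy
    rw [M.sameCycle_rot] at hy
    simp only [H.rot_r] at hy
    rcases hy with rfl | rfl | rfl | rfl
    exacts [⟨_, s0, rfl⟩, ⟨_, s1, rfl⟩, ⟨_, s2, rfl⟩, ⟨_, s3, rfl⟩]
  obtain ⟨n1, n2, n3, n4, n5, n6⟩ := ne_of_crossing hk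
  have hP : Pushable M (threadFwd α (A ++ C) r c A) (r (T.flip d)) := by
    refine ⟨?_, ?_, ?_, ?_⟩
    · rw [H.rot_r, H.rot_r]
      exact fun e => hk (H.r_inj e)
    · intro y hy hy'
      obtain ⟨x, hx, rfl⟩ := hS hy
      have hxα : x ≠ α := fun e => h1 (e ▸ hx)
      have hxβ : x ≠ T.flip α := fun e => h2 (e ▸ hx)
      rw [← threadPort_of_notMem (r := r) (c := c) (hds x hx), H.flip_port x hxα hxβ] at hy'
      obtain ⟨z, hz, e⟩ := hS hy'
      rw [← threadPort_of_notMem (r := r) (c := c) (hds z hz)] at e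
      exact hflip x hx (H.port_inj e ▸ hz)
    · intro hy
      obtain ⟨x, hx, e⟩ := hS hy
      exact H.r_ne_fwd (C := C) rfl (fun e => h1 (e ▸ hx)) e.symm
    · intro hy
      obtain ⟨x, hx, e⟩ := hS hy
      rw [H.flip_thread A C rfl] at e
      exact H.r_ne_bwd (A := A) rfl (fun e => h2 (e ▸ hx)) e.symm
  have lp := l.right_planar
  rw [← e] at lp l
  have l' := hP.linked lp (x := r k₀) fun hy => by
    obtain ⟨x, hx, e⟩ := hS hy
    exact h3 (H.r_inj e ▸ hx)
  have e1 : M.rot (r (T.flip d)) = r (T.rot (T.flip d)) := H.rot_r _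
  have e2 : M.rot (M.rot (r (T.flip d))) = r (T.rot (T.rot (T.flip d))) := by
    rw [H.rot_r, H.rot_r]
  have e3 : M.rot (M.rot (M.rot (r (T.flip d)))) = r (T.rot (T.rot (T.rot (T.flip d)))) := by
    rw [H.rot_r, H.rot_r, H.rot_r]
  have H1 := H.insert (hds _ s3) rfl e3
  rw [List.append_cons] at H1
  have hm2 : T.rot (T.rot (T.flip d)) ∉ A ++ [T.rot (T.rot (T.rot (T.flip d)))] ++ C := by
    have := hds _ s2
    simp only [List.mem_append, List.mem_singleton] at this ⊢
    tauto
  have H2 := H1.insert (g := .inr 0) hm2 (by rw [threadFwd_concat, Threaded.insertDarts_self])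
    (congrArg Sum.inl e2)
  rw [List.append_cons] at H2
  have hm1 : T.rot (T.flip d) ∉ A ++ [T.rot (T.rot (T.rot (T.flip d)))] ++
      [T.rot (T.rot (T.flip d))] ++ C := by
    have := hds _ s1
    have n4' := n4.symm
    have n5' := n5.symm
    simp only [List.mem_append, List.mem_singleton] at this ⊢
    tauto
  have H3 := H2.insert (g := .inr 0) hm1 (by rw [threadFwd_concat, Threaded.insertDarts_self])
    (congrArg (fun y => Sum.inl (Sum.inl y)) e1)
  have hlist : A ++ [T.rot (T.rot (T.rot (T.flip d)))] ++ [T.rot (T.rot (T.flip d))] ++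
      T.rot (T.flip d) :: C = A ++ T.rot (T.rot (T.rot (T.flip d))) :: T.rot (T.rot (T.flip d)) ::
        T.rot (T.flip d) :: C := by simp
  rw [hlist] at H3
  exact ⟨_, _, _, H3, l.trans l'⟩

/-- Two successive crossings with the same edge can be removed. -/
theorem cancel {d : T.Dart} (h : Reaches T α k₀ u S s (A ++ d :: T.flip d :: C))
    (h1 : d ≠ α) (h2 : d ≠ T.flip α) : Reaches T α k₀ u S s (A ++ C) := by
  have hn := h.nodup
  rw [List.nodup_middle, List.nodup_cons, List.nodup_middle, List.nodup_cons] at hn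
  obtain ⟨hd, hd', hn⟩ := hn
  have hd1 : d ∉ A ++ C := fun h => hd (by simp only [List.mem_append, List.mem_cons] at h ⊢; tauto)
  obtain ⟨M, r, c, H⟩ := Threaded.exists_of_nodup T α u (A ++ C) hn
  have H1 := H.insert hd1 rfl rfl
  rw [List.append_cons] at H1
  have hm : T.flip d ∉ A ++ [d] ++ C := by
    have := T.flip_ne d
    simp only [List.mem_append, List.mem_singleton] at hd' ⊢
    tauto
  have e : M.flip (r d) = r (T.flip d) := by
    have := H.flip_port d h1 h2
    rwa [threadPort_of_notMem hd1, threadPort_of_notMem hd'] at this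
  have H2 := H1.insert (g := .inr 0) hm (by rw [threadFwd_concat, Threaded.insertDarts_self])
    (congrArg Sum.inl e)
  rw [List.append_assoc, List.singleton_append] at H2
  have l := h.linked H2
  refine ⟨M, r, c, H, l.trans ?_⟩
  refine cross_cross_linked (H.r_ne_fwd rfl h1) ?_ l.right_planar (r k₀)
  rw [H.flip_thread A C rfl]
  exact H.r_ne_bwd rfl h2

/-- A kink at the beginning of the strand can be removed. -/
theorem first (h : Reaches T α k₀ u S s (α :: C)) : Reaches T α k₀ u S s C := by
  obtain ⟨hd, M, r, c, H, l⟩ := exists_cross (A := []) h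
  have e : threadFwd α C r c [] = r α := threadPort_of_notMem hd
  have lp := l.right_planar
  change (M.cross (threadFwd α C r c []) (r α) u).Planar at lp
  change Linked S s (M.cross (threadFwd α C r c []) (r α) u) (.inl (r k₀)) at l
  rw [e] at l lp
  exact ⟨M, r, c, H, l.trans (cross_self_linked lp _)⟩

/-- A kink at the end of the strand can be removed. -/
theorem last (h : Reaches T α k₀ u S s (A ++ [T.flip α])) : Reaches T α k₀ u S s A := by
  obtain ⟨hd, M, r, c, H, l⟩ := h.exists_cross
  have e : M.flip (threadFwd α (A ++ []) r c A) = r (T.flip α) := by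
    rw [H.flip_thread A [] rfl]
    exact threadPort_of_notMem hd
  have lp := l.right_planar
  rw [← e] at l lp
  have H' := H
  rw [List.append_nil] at H'
  exact ⟨M, r, c, H', l.trans (cross_flip_linked lp _)⟩

end Reaches

end

end VirtualDiagram

namespace VirtualDiagram

/-! ### Closed curves bound -/

section

/-- On a sphere every cycle modulo 2 is the boundary of a set of regions. -/
theorem Planar.exists_potential {V : VirtualDiagram} (hV : V.Planar) {z : V.Dart → ZMod 2}
    (hflip : ∀ x, z (V.flip x) = z x) (haux : ∀ x, V.rot (V.rot x) = x → z (V.rot x) = z x)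
    (hsum : ∀ x, V.rot (V.rot x) ≠ x →
      z x + z (V.rot x) + z (V.rot (V.rot x)) + z (V.rot (V.rot (V.rot x))) = 0) :
    ∃ φ, V.IsColoring φ ∧ ∀ x, φ x + φ (V.flip x) = z x := by
  classical
  obtain ⟨⟨χ, hχ, hχ1⟩, hδ⟩ := hV
  -- The corner sum of the colouring tells whether the cycle turns or goes straight on.
  obtain ⟨φ, hφ, e⟩ : ∃ φ, V.IsColoring φ ∧
      V.cornerSum φ = fun x => if V.rot (V.rot x) = x then 0 else z x + z (V.rot (V.rot x)) := by
    apply hδ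
    · intro x
      simp only [V.rot.apply_eq_iff_eq]
      split_ifs with h
      · rfl
      · have := hsum x h
        have h2 : ∀ a b c d : ZMod 2, a + b + c + d = 0 → b + d = a + c := by decide
        exact h2 _ _ _ _ this
    · intro x hx
      simp [hx]
  have hconst : ∀ x y, φ y + φ (V.flip y) + z y = φ x + φ (V.flip x) + z x := by
    intro x
    refine fun y => V.along (fun y => φ y + φ (V.flip y) + z y = φ x + φ (V.flip x) + z x)
      ?_ ?_ ?_ x y rfl
    · intro a ha
      rw [← ha, V.flip_flip, hflip, add_comm (φ a)]
    · intro a h ha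
      rw [← ha, ← hφ (V.rot a), ← hφ a, V.rot_four, h, haux a h, add_comm (φ (V.rot a))]
    · intro a h ha
      have e1 := congrFun e a
      simp only [cornerSum, if_neg h] at e1
      have e2 := V.rot_four (V.rot a)
      rw [← ha, ← hφ (V.rot (V.rot a)), ← hφ a, e2]
      have h2 : ∀ a b c d y z : ZMod 2, a + b + c + d = y + z → c + b + z = a + d + y := by decide
      exact h2 _ _ _ _ _ _ e1
  obtain ⟨x⟩ := V.nonempty
  by_cases h : φ x + φ (V.flip x) + z x = 0
  · refine ⟨φ, hφ, fun y => ?_⟩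
    have := hconst x y
    rw [h] at this
    exact CharTwo.add_eq_zero.1 this
  · refine ⟨φ + χ, V.colorings.add_mem hφ hχ, fun y => ?_⟩
    have h1 := hconst x y
    rw [← h1] at h
    simp only [Pi.add_apply, hχ1]
    have h2 : ∀ a b c d : ZMod 2, a + b + c ≠ 0 → a + d + (b + (d + 1)) = c := by decide
    exact h2 _ _ _ _ h

variable {T M : VirtualDiagram} {α : T.Dart} {u : Bool} {ds A C : List T.Dart}
  {r : T.Dart → M.Dart} {c : T.Dart → Fin 4 → M.Dart}

open Classical in
theorem idxOf_of_eq_append (hn : ds.Nodup) {a : T.Dart} (h : ds = A ++ a :: C) :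
    ds.idxOf a = A.length := by
  subst h
  rw [List.nodup_middle, List.nodup_cons, List.mem_append, not_or] at hn
  rw [List.idxOf_append_of_notMem hn.1.1, List.idxOf_cons_self, add_zero]

open Classical in
/-- A cycle in a threaded diagram that uses the pieces of the strand selected by `w`, no half-edges
on the right of the strand, and no edge whose ends the strand does not meet: the regions it bounds
give a function `ψ` on the vertices of `T`, which is normalized to vanish on the right of the
strand. -/
theorem Threaded.exists_potential (H : Threaded T α u ds M r c) (hM : M.Planar) (hds : ds ≠ [])
    (w : ℕ → ZMod 2) (hz : ∀ t, t ≠ α → t ≠ T.flip α →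
      (if t ∈ ds then w (ds.idxOf t) + w (ds.idxOf t + 1) else 0) =
      if T.flip t ∈ ds then w (ds.idxOf (T.flip t)) + w (ds.idxOf (T.flip t) + 1) else 0)
    (hα : (if α ∈ ds then w (ds.idxOf α) + w (ds.idxOf α + 1) else 0) = w 0)
    (hβ : (if T.flip α ∈ ds then w (ds.idxOf (T.flip α)) + w (ds.idxOf (T.flip α) + 1) else 0) =
      w ds.length) :
    ∃ ψ : T.Dart → ZMod 2, (∀ t, ψ (T.rot t) = ψ t) ∧ (∀ t ∈ ds, ψ t = 0) ∧
      (∀ t, t ≠ α → t ≠ T.flip α → (if t ∈ ds then w (ds.idxOf t) else ψ t) =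
        if T.flip t ∈ ds then w (ds.idxOf (T.flip t) + 1) else ψ (T.flip t)) ∧
      (if α ∈ ds then w (ds.idxOf α) else ψ α) = w 0 ∧
      (if T.flip α ∈ ds then w (ds.idxOf (T.flip α)) else ψ (T.flip α)) = 0 := by
  -- The cycle.
  obtain ⟨z, zr, zc⟩ : ∃ z : M.Dart → ZMod 2, (∀ x, z (r x) = 0) ∧ ∀ d ∈ ds, ∀ i, z (c d i) =
      if i = 0 then w (ds.idxOf d + 1) else if i = 1 then w (ds.idxOf d) + w (ds.idxOf d + 1)
      else if i = 2 then w (ds.idxOf d) else 0 := by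
    have : ∀ y : M.Dart, ∃ v : ZMod 2, (∀ x, y = r x → v = 0) ∧ ∀ d ∈ ds, ∀ i, y = c d i → v =
        if i = 0 then w (ds.idxOf d + 1) else if i = 1 then w (ds.idxOf d) + w (ds.idxOf d + 1)
        else if i = 2 then w (ds.idxOf d) else 0 := by
      intro y
      rcases H.cases y with ⟨x, rfl⟩ | ⟨d, hd, i, rfl⟩
      · exact ⟨0, fun _ _ => rfl, fun d hd i h => absurd h (H.r_ne _ _ hd _)⟩
      · refine ⟨if i = 0 then w (ds.idxOf d + 1) else if i = 1 then
          w (ds.idxOf d) + w (ds.idxOf d + 1) else if i = 2 then w (ds.idxOf d) else 0,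
          fun x h => absurd h.symm (H.r_ne _ _ hd _), fun d' hd' i' h => ?_⟩
        obtain ⟨rfl, rfl⟩ := H.c_inj _ hd _ hd' _ _ h
        rfl
    choose z h1 h2 using this
    exact ⟨z, fun x => h1 _ x rfl, fun d hd i => h2 _ d hd i rfl⟩
  have zport : ∀ t, z (threadPort ds r c t) =
      if t ∈ ds then w (ds.idxOf t) + w (ds.idxOf t + 1) else 0 := by
    intro t
    unfold threadPort
    split_ifs with h
    · simp [zc t h]
    · exact zr t
  have zfwd : ∀ A C, ds = A ++ C → z (threadFwd α ds r c A) = w A.length := by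
    intro A C h
    obtain rfl | ⟨A, a, rfl, ha⟩ := eq_nil_or_concat_mem h
    · exact (zport α).trans hα
    · rw [List.append_assoc, List.singleton_append] at h
      rw [threadFwd_concat, zc a ha, if_pos rfl, idxOf_of_eq_append H.nodup h]
      simp
  have zbwd : ∀ A C, ds = A ++ C → z (threadBwd α ds r c C) = w A.length := by
    intro A C h
    obtain rfl | ⟨a, C, rfl, ha⟩ := eq_nil_or_cons_mem h
    · rw [List.append_nil] at h
      rw [← h]
      exact (zport _).trans hβ
    · rw [threadBwd_cons, zc a ha, idxOf_of_eq_append H.nodup h]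
      simp
  obtain ⟨φ, hφ, e⟩ := hM.exists_potential (z := z) (by
    intro y
    refine H.flip_cases (P := fun y => z (M.flip y) = z y) ?_ ?_ ?_ ?_ ?_ y
    · intro d hd
      rw [H.flip_near d hd, zr, zc d hd]
      rfl
    · intro d hd
      rw [H.flip_far hd, zr, zc d hd]
      rfl
    · intro d h1 h2
      rw [H.flip_port d h1 h2, zport, zport]
      exact (hz d h1 h2).symm
    · intro A C h
      rw [H.flip_thread A C h, zfwd A C h, zbwd A C h]
    · intro A C h
      rw [H.flip_bwd h, zfwd A C h, zbwd A C h]) (by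
    intro y hy
    rcases H.cases y with ⟨x, rfl⟩ | ⟨d, hd, i, rfl⟩
    · rw [H.rot_r, zr, zr]
    · rw [H.rot_c d hd, H.rot_c d hd] at hy
      have h1 : ∀ i : Fin 4, i + 1 + 1 ≠ i := by decide
      exact absurd (H.c_inj _ hd _ hd _ _ hy).2 (h1 i)) (by
    intro y hy
    rcases H.cases y with ⟨x, rfl⟩ | ⟨d, hd, i, rfl⟩
    · simp only [H.rot_r, zr, add_zero]
    · simp only [H.rot_c d hd, zc d hd]
      have h2 : ∀ (a b : ZMod 2) (i : Fin 4), ((((if i = 0 then b else if i = 1 then a + b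
        else if i = 2 then a else 0) + if i + 1 = 0 then b else if i + 1 = 1 then a + b
        else if i + 1 = 2 then a else 0) + if i + 1 + 1 = 0 then b else if i + 1 + 1 = 1 then a + b
        else if i + 1 + 1 = 2 then a else 0) + if i + 1 + 1 + 1 = 0 then b
        else if i + 1 + 1 + 1 = 1 then a + b else if i + 1 + 1 + 1 = 2 then a else 0) = 0 := by
        decide
      exact h2 _ _ i)
  -- Across a dart the colour changes by the value of the cycle.
  have step : ∀ y, φ (M.rot y) = φ y + z (M.rot y) := by
    intro y
    have h1 := e (M.rot y)
    rw [← hφ, M.rot_four] at h1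
    have h2 : ∀ a b c : ZMod 2, a + b = c → a = b + c := by decide
    exact h2 _ _ _ h1
  have φr : ∀ t, φ (r (T.rot t)) = φ (r t) := by
    intro t
    rw [← H.rot_r, step, H.rot_r, zr, add_zero]
  have φ3 : ∀ d ∈ ds, φ (c d 3) = φ (r d) := by
    intro d hd
    have h1 := e (r d)
    rw [H.flip_far hd, zr] at h1
    exact (CharTwo.add_eq_zero.1 h1).symm
  have φ2 : ∀ d ∈ ds, φ (c d 2) = φ (r d) := by
    intro d hd
    rw [← φ3 d hd]
    have h1 := step (c d 2)
    rw [H.rot_c d hd] at h1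
    change φ (c d 3) = φ (c d 2) + z (c d 3) at h1
    rw [h1, zc d hd]
    exact (add_zero _).symm
  have φ0 : ∀ d ∈ ds, φ (c d 0) = φ (r d) + w (ds.idxOf d + 1) := by
    intro d hd
    have h1 := step (c d 3)
    rw [H.rot_c d hd] at h1
    change φ (c d 0) = φ (c d 3) + z (c d 0) at h1
    rw [zc d hd, φ3 d hd] at h1
    exact h1
  have φ1 : ∀ d ∈ ds, φ (c d 1) = φ (r d) + w (ds.idxOf d) := by
    intro d hd
    have h1 := step (c d 0)
    rw [H.rot_c d hd] at h1
    change φ (c d 1) = φ (c d 0) + z (c d 1) at h1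
    rw [zc d hd, φ0 d hd] at h1
    rw [h1]
    change _ + (w (ds.idxOf d) + w (ds.idxOf d + 1)) = _
    have h2 : ∀ a b c : ZMod 2, a + c + (b + c) = a + b := by decide
    exact h2 _ _ _
  -- The colour on the right of the strand is constant.
  have hpair : ∀ A a b C, ds = A ++ a :: b :: C → φ (r a) = φ (r b) := by
    intro A a b C h
    have ha : a ∈ ds := by simp [h]
    have hb : b ∈ ds := by simp [h]
    have h1 := H.flip_thread (A ++ [a]) (b :: C) (by simp [h])
    rw [threadFwd_concat, threadBwd_cons] at h1
    have h2 := hφ (c a 0)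
    rw [h1, H.rot_c a ha, H.rot_c a ha, H.rot_c a ha] at h2
    rw [← φ3 a ha, ← φ2 b hb]
    exact h2
  have hconst : ∀ A a C, ds = A ++ a :: C → φ (r a) = φ (r (ds.head hds)) := by
    intro A
    induction A using List.reverseRecOn with
    | nil =>
      intro a C h
      subst h
      rfl
    | append_singleton A b ih =>
      intro a C h
      rw [← ih b (a :: C) (by simp [h]), hpair A b a C (by simp [h])]
  have hκ : ∀ d ∈ ds, φ (r d) = φ (r (ds.head hds)) := by
    intro d hd
    obtain ⟨A, C, h⟩ := List.append_of_mem hd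
    exact hconst A d C h
  set κ := φ (r (ds.head hds)) with hκd
  have φport : ∀ t, φ (threadPort ds r c t) + κ =
      if t ∈ ds then w (ds.idxOf t) else φ (r t) + κ := by
    intro t
    unfold threadPort
    split_ifs with h
    · rw [φ1 t h, hκ t h]
      have h2 : ∀ a b : ZMod 2, a + b + a = b := by decide
      exact h2 _ _
    · rfl
  refine ⟨fun t => φ (r t) + κ, fun t => congrArg (· + κ) (φr t), fun t h => ?_, fun t h1 h2 => ?_, ?_, ?_⟩
  · change φ (r t) + κ = 0
    rw [hκ t h, CharTwo.add_self_eq_zero]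
  · rw [← φport]
    have h3 := hφ (threadPort ds r c (T.flip t))
    have h4 := H.flip_port t h1 h2
    rw [← h4, M.flip_flip, h4] at h3
    rw [← h3]
    unfold threadPort
    split_ifs with h
    · rw [H.rot_c _ h, H.rot_c _ h, H.rot_c _ h]
      change φ (c (T.flip t) 0) + κ = _
      rw [φ0 _ h, hκ _ h]
      have h2 : ∀ a b : ZMod 2, a + b + a = b := by decide
      exact h2 _ _
    · rw [H.rot_r, H.rot_r, H.rot_r, φr, φr, φr]
  · rw [← φport]
    obtain ⟨a, C, h⟩ := List.exists_cons_of_ne_nil hds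
    have ha : a ∈ ds := by simp [h]
    have h1 := H.flip_bwd (A := []) h
    rw [threadFwd_nil, threadBwd_cons] at h1
    have h2 := e (c a 2)
    rw [h1, zc a ha, φ2 a ha, hκ a ha, idxOf_of_eq_append (A := []) H.nodup h] at h2
    rw [add_comm]
    exact h2
  · rw [← φport]
    obtain h | ⟨A, a, h⟩ := List.eq_nil_or_concat' ds
    · exact absurd h hds
    have ha : a ∈ ds := by simp [h]
    have h1 := H.flip_thread (A ++ [a]) [] (by simpa using h)
    rw [threadFwd_concat, threadBwd_nil] at h1
    have h2 := hφ (c a 0)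
    rw [h1, H.rot_c a ha, H.rot_c a ha, H.rot_c a ha] at h2
    rw [← h2]
    change φ (c a 3) + κ = 0
    rw [φ3 a ha, hκ a ha, CharTwo.add_self_eq_zero]

end

end VirtualDiagram

namespace VirtualDiagram

/-! ### Pulling the strand tight -/

section

variable {T M S : VirtualDiagram} {α h k₀ : T.Dart} {u : Bool} {ds A C : List T.Dart}
  {r : T.Dart → M.Dart} {c : T.Dart → Fin 4 → M.Dart} {s : S.Dart}

open Classical in
/-- The part of the strand between its crossings number `p - 1` and `q` closes up: along an edge, at
the beginning of the strand, or at its end. -/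
def Closes (T : VirtualDiagram) (α : T.Dart) (ds : List T.Dart) (p q : ℕ) : Prop :=
  (∃ d ∈ ds, d ≠ α ∧ d ≠ T.flip α ∧ T.flip d ∈ ds ∧ ds.idxOf d + 1 = p ∧
    ds.idxOf (T.flip d) = q) ∨
  (p = 0 ∧ α ∈ ds ∧ ds.idxOf α = q) ∨
  (T.flip α ∈ ds ∧ ds.idxOf (T.flip α) + 1 = p ∧ ds.length = q)

/-- A set of vertices has an even number of darts, and so has a set of edges.  Hence a set of
vertices cannot be joined to its complement by exactly one edge. -/
theorem not_single_edge {ψ : T.Dart → ZMod 2} (hψ : ∀ t, ψ (T.rot t) = ψ t) (hk : ψ k₀ = 1)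
    (hflip : ∀ t, ψ t = 1 → t ≠ k₀ → ψ (T.flip t) = 1 ∧ T.flip t ≠ k₀) : False := by
  classical
  have := T.finite
  have := Fintype.ofFinite T.Dart
  let P : Finset T.Dart := {t | ψ t = 1}
  have h1 : ∑ t ∈ P, (1 : ZMod 2) = 0 := by
    refine Finset.sum_involution (fun t _ => if T.rot (T.rot t) = t then T.rot t else T.rot (T.rot t))
      (fun _ _ => rfl) (fun t _ _ => ?_) (fun t ht => ?_) (fun t _ => ?_)
    · split_ifs with h
      · exact T.rot_ne t
      · exact h
    · simp only [P, Finset.mem_filter, Finset.mem_univ, true_and] at ht ⊢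
      split_ifs <;> simp only [hψ, ht]
    · by_cases h : T.rot (T.rot t) = t
      · simp [h]
      · have : T.rot (T.rot t) ≠ t := h
        simp [h, T.rot_four, Ne.symm h]
  have h2 : ∑ t ∈ P.erase k₀, (1 : ZMod 2) = 0 := by
    refine Finset.sum_involution (fun t _ => T.flip t)
      (fun _ _ => rfl) (fun t _ _ => T.flip_ne t) (fun t ht => ?_) (fun t _ => T.flip_flip t)
    simp only [P, Finset.mem_erase, Finset.mem_filter, Finset.mem_univ, true_and] at ht ⊢
    exact (hflip t ht.2 ht.1).symm
  rw [← Finset.add_sum_erase _ _ (show k₀ ∈ P by simp [P, hk]), h2] at h1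
  rw [add_zero] at h1
  exact one_ne_zero h1

open Classical in
/-- Where the strand closes up, the crossings in between come in pairs on the same edge. -/
theorem Threaded.paired (H : Threaded T α u ds M r c) (hM : M.Planar)
    (hE : ∀ d ∈ ds, d = α ∨ d = T.flip α ∨ d = h ∨ T.flip d ∈ ds) (hh : T.flip h ∉ ds) {p q : ℕ}
    (hpq : p < q) (hc : Closes T α ds p q) {t : T.Dart} (ht : t ∈ ds) (hp : p ≤ ds.idxOf t)
    (hq : ds.idxOf t < q) :
    t ≠ α ∧ t ≠ T.flip α ∧ T.flip t ∈ ds ∧ p ≤ ds.idxOf (T.flip t) ∧ ds.idxOf (T.flip t) < q := by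
  let w : ℕ → ZMod 2 := fun m => if p ≤ m ∧ m ≤ q then 1 else 0
  have hw : ∀ m, w m = 1 ↔ p ≤ m ∧ m ≤ q := by
    intro m
    simp only [w]
    split_ifs with h <;> simp [h]
  have hds : ds ≠ [] := List.ne_nil_of_mem ht
  have hlt : ∀ {t}, t ∈ ds → ds.idxOf t < ds.length := fun h => List.idxOf_lt_length_iff.2 h
  have hinj : ∀ {a b}, a ∈ ds → ds.idxOf a = ds.idxOf b → a = b := fun ha e =>
    (List.idxOf_inj ha).1 e
  have hZ : ∀ t, (if t ∈ ds then w (ds.idxOf t) + w (ds.idxOf t + 1) else 0) =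
      if t ∈ ds ∧ (ds.idxOf t + 1 = p ∨ ds.idxOf t = q) then 1 else 0 := by
    intro t
    by_cases h : t ∈ ds
    · simp only [h, if_true, true_and, w]
      by_cases h1 : ds.idxOf t + 1 = p
      · rw [if_neg (by omega), if_pos (by omega), if_pos (Or.inl h1)]
        rfl
      by_cases h2 : ds.idxOf t = q
      · rw [if_pos (by omega), if_neg (by omega), if_pos (Or.inr h2)]
        rfl
      rw [if_neg (not_or.2 ⟨h1, h2⟩)]
      by_cases h3 : p ≤ ds.idxOf t ∧ ds.idxOf t ≤ q
      · rw [if_pos h3, if_pos (by omega)]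
        rfl
      · rw [if_neg h3, if_neg (by omega)]
        rfl
    · simp [h]
  have hαβ := T.flip_ne α
  obtain ⟨ψ, ψr, ψ0, hL, hLα, hLβ⟩ := H.exists_potential hM hds w (by
    intro t h1 h2
    rw [hZ, hZ]
    have h3 : T.flip t ≠ α := fun e => h2 (by rw [← e, T.flip_flip])
    have h4 : T.flip t ≠ T.flip α := fun e => h1 (T.flip.injective e)
    congr 1
    apply propext
    rcases hc with ⟨d, hd, d1, d2, hd', rfl, rfl⟩ | ⟨rfl, ha, rfl⟩ | ⟨hb, rfl, rfl⟩
    · constructor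
      · rintro ⟨h, e | e⟩
        · obtain rfl := hinj h (Nat.succ_injective e)
          exact ⟨hd', Or.inr rfl⟩
        · obtain rfl := hinj h e
          rw [T.flip_flip]
          exact ⟨hd, Or.inl rfl⟩
      · rintro ⟨h, e | e⟩
        · have e' := hinj h (Nat.succ_injective e)
          have : t = T.flip d := by rw [← e', T.flip_flip]
          subst this
          exact ⟨hd', Or.inr rfl⟩
        · have := T.flip.injective (hinj h e)
          subst this
          exact ⟨hd, Or.inl rfl⟩
    · constructor
      · rintro ⟨h, e | e⟩
        · omega
        · exact absurd (hinj h e) h1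
      · rintro ⟨h, e | e⟩
        · omega
        · exact absurd (hinj h e) h3
    · constructor
      · rintro ⟨h, e | e⟩
        · exact absurd (hinj h (Nat.succ_injective e)) h2
        · exact absurd e (hlt h).ne
      · rintro ⟨h, e | e⟩
        · exact absurd (hinj h (Nat.succ_injective e)) h4
        · exact absurd e (hlt h).ne) (by
    rw [hZ]
    change _ = if p ≤ 0 ∧ 0 ≤ q then (1 : ZMod 2) else 0
    congr 1
    apply propext
    rcases hc with ⟨d, hd, d1, d2, hd', rfl, rfl⟩ | ⟨rfl, ha, rfl⟩ | ⟨hb, rfl, rfl⟩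
    · refine ⟨?_, fun e => by omega⟩
      rintro ⟨h, e | e⟩
      · exact absurd (hinj h (Nat.succ_injective e)).symm d1
      · exact absurd (by rw [hinj h e, T.flip_flip]) d2
    · simp [ha]
    · refine ⟨?_, fun e => by omega⟩
      rintro ⟨h, e | e⟩
      · exact absurd (hinj h (Nat.succ_injective e)).symm hαβ
      · exact absurd e (hlt h).ne) (by
    rw [hZ]
    change _ = if p ≤ ds.length ∧ ds.length ≤ q then (1 : ZMod 2) else 0
    congr 1
    apply propext
    rcases hc with ⟨d, hd, d1, d2, hd', rfl, rfl⟩ | ⟨rfl, ha, rfl⟩ | ⟨hb, rfl, rfl⟩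
    · refine ⟨?_, fun e => by have := hlt hd'; omega⟩
      rintro ⟨h, e | e⟩
      · exact absurd (hinj h (Nat.succ_injective e)).symm d2
      · exact absurd (T.flip.injective (hinj h e)).symm d1
    · refine ⟨?_, fun e => by have := hlt ha; omega⟩
      rintro ⟨h, e | e⟩
      · omega
      · exact absurd (hinj h e) hαβ
    · have := hlt hb
      simp [hb]
      omega)
  -- The strand starts outside, unless it closes up at its beginning.
  have hw0 : w 0 = 1 → α ∈ ds ∧ ds.idxOf α = q := by
    intro h0
    have := ((hw 0).1 h0).1
    rcases hc with ⟨d, hd, d1, d2, hd', rfl, rfl⟩ | ⟨rfl, ha, rfl⟩ | ⟨hb, rfl, rfl⟩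
    · omega
    · exact ⟨ha, rfl⟩
    · omega
  have w1 : w (ds.idxOf t) = 1 := (hw _).2 ⟨hp, hq.le⟩
  have w2 : w (ds.idxOf t + 1) = 1 := (hw _).2 ⟨by omega, by omega⟩
  have t1 : t ≠ α := by
    rintro rfl
    rw [if_pos ht, w1] at hLα
    have := (hw0 hLα.symm).2
    omega
  have t2 : t ≠ T.flip α := by
    rintro rfl
    rw [if_pos ht, w1] at hLβ
    exact one_ne_zero hLβ
  have e1 := hL t t1 t2
  rw [if_pos ht, w1] at e1
  have t3 : T.flip t ≠ α := fun e => t2 (by rw [← e, T.flip_flip])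
  have t4 : T.flip t ≠ T.flip α := fun e => t1 (T.flip.injective e)
  have e2 := hL (T.flip t) t3 t4
  rw [T.flip_flip, if_pos ht, w2] at e2
  by_cases ht' : T.flip t ∈ ds
  · rw [if_pos ht'] at e1 e2
    have := (hw _).1 e1.symm
    have := (hw _).1 e2
    exact ⟨t1, t2, ht', by omega, by omega⟩
  · exfalso
    obtain rfl : t = h := by
      rcases hE t ht with h' | h' | h' | h'
      · exact absurd h' t1
      · exact absurd h' t2
      · exact h'
      · exact absurd h' ht'
    rw [if_neg ht'] at e1
    refine not_single_edge ψr e1.symm fun x hx hxt => ?_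
    have hx0 : x ∉ ds := fun h' => by
      rw [ψ0 x h'] at hx
      exact zero_ne_one hx
    have x1 : x ≠ α := by
      rintro rfl
      rw [if_neg hx0, hx] at hLα
      exact hx0 (hw0 hLα.symm).1
    have x2 : x ≠ T.flip α := by
      rintro rfl
      rw [if_neg hx0, hx] at hLβ
      exact one_ne_zero hLβ
    have e3 := hL x x1 x2
    rw [if_neg hx0, hx] at e3
    have hx' : T.flip x ∉ ds := by
      intro h'
      rcases hE _ h' with e | e | e | e
      · exact x2 (by rw [← e, T.flip_flip])
      · exact x1 (T.flip.injective e)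
      · exact hxt (by rw [← e, T.flip_flip])
      · exact hx0 (by rwa [T.flip_flip] at e)
    rw [if_neg hx'] at e3
    exact ⟨e3.symm, fun e => hx0 (T.flip.injective e ▸ ht)⟩

open Classical in
theorem exists_adjacent_of_idxOf {a b : T.Dart} (ha : a ∈ ds) (hb : b ∈ ds)
    (h : ds.idxOf b = ds.idxOf a + 1) : ∃ A C, ds = A ++ a :: b :: C := by
  have h1 := List.idxOf_lt_length_iff.2 ha
  have h2 := List.idxOf_lt_length_iff.2 hb
  refine ⟨ds.take (ds.idxOf a), ds.drop (ds.idxOf a + 1 + 1), ?_⟩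
  have e1 : ds[ds.idxOf a] = a := List.getElem_idxOf h1
  have e2 : ds[ds.idxOf a + 1]'(h ▸ h2) = b := by
    have := List.getElem_idxOf h2
    simp only [h] at this
    exact this
  calc ds = ds.take (ds.idxOf a) ++ ds.drop (ds.idxOf a) := (List.take_append_drop _ _).symm
    _ = _ := by
      rw [List.drop_eq_getElem_cons h1, List.drop_eq_getElem_cons (h ▸ h2), e1, e2]

open Classical in
/-- An innermost pair of crossings with the same edge consists of successive ones. -/
theorem Threaded.exists_adjacent (H : Threaded T α u ds M r c) (hM : M.Planar)
    (hE : ∀ d ∈ ds, d = α ∨ d = T.flip α ∨ d = h ∨ T.flip d ∈ ds) (hh : T.flip h ∉ ds) (n : ℕ) :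
    ∀ p q, q - p = n → p < q → Closes T α ds p q →
      ∃ A d C, ds = A ++ d :: T.flip d :: C ∧ d ≠ α ∧ d ≠ T.flip α := by
  induction n using Nat.strong_induction_on with
  | _ n ih =>
    intro p q hn hpq hc
    have hql : q ≤ ds.length := by
      rcases hc with ⟨d, hd, d1, d2, hd', rfl, rfl⟩ | ⟨rfl, ha, rfl⟩ | ⟨hb, rfl, rfl⟩
      · exact (List.idxOf_lt_length_iff.2 hd').le
      · exact (List.idxOf_lt_length_iff.2 ha).le
      · exact le_rfl
    have hpl : p < ds.length := by omega
    have ht : ds[p] ∈ ds := List.getElem_mem hpl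
    have hi : ds.idxOf ds[p] = p := H.nodup.idxOf_getElem p hpl
    generalize ds[p] = t at ht hi
    obtain ⟨t1, t2, ht', hp', hq'⟩ := H.paired hM hE hh hpq hc ht hi.ge (by omega)
    have hne : ds.idxOf (T.flip t) ≠ p := by
      intro e
      rw [← hi] at e
      exact T.flip_ne t ((List.idxOf_inj ht').1 e)
    by_cases hadj : ds.idxOf (T.flip t) = p + 1
    · obtain ⟨A, C, e⟩ := exists_adjacent_of_idxOf ht ht' (by omega)
      exact ⟨A, t, C, e, t1, t2⟩
    · exact ih (ds.idxOf (T.flip t) - (p + 1)) (by omega) (p + 1) _ rfl (by omega)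
        (Or.inl ⟨t, ht, t1, t2, ht', by omega, rfl⟩)

/-- Once all edges that the strand crosses only at one end have been dealt with, it can be pulled
tight. -/
theorem Reaches.tighten (n : ℕ) : ∀ {ds : List T.Dart}, ds.length = n →
    Reaches T α k₀ u S s ds →
    (∀ d ∈ ds, d = α ∨ d = T.flip α ∨ d = h ∨ T.flip d ∈ ds) → T.flip h ∉ ds →
    Reaches T α k₀ u S s [] ∨ Reaches T α k₀ u S s [h] := by
  classical
  induction n using Nat.strong_induction_on with
  | _ n ih =>
    intro ds hn hR hE hh
    obtain ⟨M, r, c, H, l⟩ := id hR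
    have hM := l.right_planar
    -- It suffices to find two successive crossings with the same edge.
    have key : (∃ A d C, ds = A ++ d :: T.flip d :: C ∧ d ≠ α ∧ d ≠ T.flip α) →
        Reaches T α k₀ u S s [] ∨ Reaches T α k₀ u S s [h] := by
      rintro ⟨A, d, C, rfl, d1, d2⟩
      have hnd := hR.nodup
      rw [List.nodup_middle, List.nodup_cons, List.nodup_middle, List.nodup_cons] at hnd
      simp only [List.mem_append, List.mem_cons, not_or] at hnd hE hh
      simp only [List.length_append, List.length_cons] at hn
      refine ih (A ++ C).length ?_ rfl (hR.cancel d1 d2) ?_ ?_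
      · simp only [List.length_append]
        omega
      · intro e he
        rw [List.mem_append] at he
        rcases hE e (by tauto) with h' | h' | h' | h' | h' | h' | h'
        · exact Or.inl h'
        · exact Or.inr (Or.inl h')
        · exact Or.inr (Or.inr (Or.inl h'))
        · exact Or.inr (Or.inr (Or.inr (List.mem_append_left _ h')))
        · have : e = T.flip d := by rw [← h', T.flip_flip]
          rw [this] at he
          tauto
        · have : e = d := T.flip.injective h'
          rw [this] at he
          tauto
        · exact Or.inr (Or.inr (Or.inr (List.mem_append_right _ h')))
      · rw [List.mem_append]
        tauto
    by_cases hpair : ∃ d ∈ ds, d ≠ α ∧ d ≠ T.flip α ∧ T.flip d ∈ ds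
    · obtain ⟨d, hd, d1, d2, hd'⟩ := hpair
      -- One of the two crossings comes first.
      obtain ⟨e, he, e1, e2, he', hlt⟩ : ∃ e ∈ ds, e ≠ α ∧ e ≠ T.flip α ∧ T.flip e ∈ ds ∧
          ds.idxOf e < ds.idxOf (T.flip e) := by
        rcases lt_trichotomy (ds.idxOf d) (ds.idxOf (T.flip d)) with h' | h' | h'
        · exact ⟨d, hd, d1, d2, hd', h'⟩
        · exact absurd ((List.idxOf_inj hd).1 h').symm (T.flip_ne d)
        · refine ⟨T.flip d, hd', fun e => d2 (by rw [← e, T.flip_flip]),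
            fun e => d1 (T.flip.injective e), by rwa [T.flip_flip], by rwa [T.flip_flip]⟩
      apply key
      by_cases hadj : ds.idxOf (T.flip e) = ds.idxOf e + 1
      · obtain ⟨A, C, h'⟩ := exists_adjacent_of_idxOf he he' hadj
        exact ⟨A, e, C, h', e1, e2⟩
      · exact H.exists_adjacent hM hE hh _ _ _ rfl (by omega)
          (Or.inl ⟨e, he, e1, e2, he', rfl, rfl⟩)
    by_cases hα : α ∈ ds
    · cases ds with
      | nil => exact absurd hα List.not_mem_nil
      | cons a C =>
        by_cases ha : a = α
        · subst ha
          simp only [List.mem_cons, not_or] at hE hh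
          refine ih C.length (by simp [← hn]) rfl hR.first ?_ hh.2
          intro e he
          rcases hE e (Or.inr he) with h' | h' | h' | h' | h'
          · exact Or.inl h'
          · exact Or.inr (Or.inl h')
          · exact Or.inr (Or.inr (Or.inl h'))
          · exact Or.inr (Or.inl (by rw [← h', T.flip_flip]))
          · exact Or.inr (Or.inr (Or.inr h'))
        · apply key
          refine H.exists_adjacent hM hE hh _ 0 _ rfl ?_ (Or.inr (Or.inl ⟨rfl, hα, rfl⟩))
          rw [List.idxOf_cons_ne _ ha]
          omega
    by_cases hβ : T.flip α ∈ ds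
    · obtain h' | ⟨A, b, rfl⟩ := List.eq_nil_or_concat' ds
      · rw [h'] at hβ
        exact absurd hβ List.not_mem_nil
      by_cases hb : b = T.flip α
      · subst hb
        simp only [List.mem_append, List.mem_singleton, not_or] at hE hh
        simp only [List.length_append, List.length_singleton] at hn
        refine ih A.length (by omega) rfl hR.last ?_ hh.1
        intro e he
        rcases hE e (Or.inl he) with h' | h' | h' | h' | h'
        · exact Or.inl h'
        · exact Or.inr (Or.inl h')
        · exact Or.inr (Or.inr (Or.inl h'))
        · exact Or.inr (Or.inr (Or.inr h'))
        · exact Or.inl (T.flip.injective h')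
      · apply key
        refine H.exists_adjacent hM hE hh _ _ _ rfl ?_ (Or.inr (Or.inr ⟨hβ, rfl, rfl⟩))
        have hA : T.flip α ∈ A := by
          rw [List.mem_append, List.mem_singleton] at hβ
          exact hβ.resolve_right fun e => hb e.symm
        rw [List.idxOf_append_of_mem hA, List.length_append, List.length_singleton]
        have := List.idxOf_lt_length_iff.2 hA
        omega
    · have hall : ∀ d ∈ ds, d = h := by
        intro d hd
        rcases hE d hd with h' | h' | h' | h'
        · exact absurd (h' ▸ hd) hα
        · exact absurd (h' ▸ hd) hβ
        · exact h'
        · exact absurd ⟨d, hd, fun e => hα (e ▸ hd), fun e => hβ (e ▸ hd), h'⟩ hpair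
      match ds, hR.nodup, hall, hR with
      | [], _, _, hR => exact Or.inl hR
      | [a], _, hall, hR => exact Or.inr (hall a (by simp) ▸ hR)
      | a :: b :: C, hnd, hall, _ =>
        have h1 := hall a (by simp)
        have h2 := hall b (by simp)
        rw [h1, h2] at hnd
        simp at hnd

end

end VirtualDiagram

namespace VirtualDiagram

/-! ### Sweeping the strand over the vertices -/

section

variable {T S : VirtualDiagram} {α k₀ : T.Dart} {u : Bool} {s : S.Dart} {ds A N C : List T.Dart}
  {B : Set T.Dart}

theorem aux_of_sameCycle {x y : T.Dart} (h : T.rot.SameCycle x y) (hx : T.rot (T.rot x) = x) :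
    T.rot (T.rot y) = y := by
  rcases (T.sameCycle_rot x y).1 h with rfl | rfl | rfl | rfl <;> simp only [hx]

/-- The set `B` of vertices lies on one side of the strand, which crosses precisely those half-edges
at these vertices that do not lead to the same side, except `k₀`. -/
structure Sweeps (T : VirtualDiagram) (α k₀ : T.Dart) (ds : List T.Dart) (B : Set T.Dart) :
    Prop where
  rot_mem : ∀ t ∈ B, T.rot t ∈ B
  subset : ∀ d ∈ ds, d ∈ B
  base_mem : k₀ ∈ B
  base_notMem : k₀ ∉ ds
  pair : ∀ t ∈ B, t ∉ ds → t ≠ k₀ → T.flip t ∈ B ∧ T.flip t ∉ ds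
  start : α ∈ B → α ∈ ds
  finish : T.flip α ∈ B → T.flip α ∈ ds

theorem Sweeps.notMem_of_sameCycle (H : Sweeps T α k₀ ds B) {k x : T.Dart} (hk : k ∉ B)
    (h : T.rot.SameCycle k x) : x ∉ B := by
  intro hx
  have h1 := H.rot_mem _ hx
  have h2 := H.rot_mem _ h1
  have h3 := H.rot_mem _ h2
  rcases (T.sameCycle_rot x k).1 h.symm with rfl | rfl | rfl | rfl <;> exact hk ‹_›

theorem Sweeps.step {d : T.Dart} (H : Sweeps T α k₀ (A ++ d :: C) B) (hd : d ∉ A ++ C)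
    (h1 : d ≠ α) (h2 : d ≠ T.flip α) (hk : T.flip d ∉ B)
    (hN : ∀ t, t ∈ N ↔ T.rot.SameCycle (T.flip d) t ∧ t ≠ T.flip d) :
    Sweeps T α k₀ (A ++ N ++ C) (B ∪ {t | T.rot.SameCycle (T.flip d) t}) := by
  have hO : ∀ {x}, T.rot.SameCycle (T.flip d) x → x ∉ B := fun h => H.notMem_of_sameCycle hk h
  have hds : ∀ {t}, t ∈ A ++ C → t ∈ A ++ d :: C := fun h => by
    simp only [List.mem_append, List.mem_cons] at h ⊢
    tauto
  have hds' : ∀ {t}, t ∈ A ++ d :: C → t = d ∨ t ∈ A ++ C := fun h => by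
    simp only [List.mem_append, List.mem_cons] at h ⊢
    tauto
  have hmem : ∀ {t}, t ∈ A ++ N ++ C ↔ t ∈ A ++ C ∨ t ∈ N := by
    intro t
    simp only [List.mem_append]
    tauto
  have hdB : d ∈ B := H.subset d (by simp)
  have hα : ∀ a, d ≠ T.flip a → (a ∈ B → a ∈ A ++ d :: C) → d ≠ a →
      a ∈ B ∪ {t | T.rot.SameCycle (T.flip d) t} → a ∈ A ++ N ++ C := by
    rintro a ha haB had (h | h)
    · rcases hds' (haB h) with h' | h'
      · exact absurd h'.symm had
      · exact hmem.2 (Or.inl h')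
    · exact hmem.2 (Or.inr ((hN a).2 ⟨h, fun e => ha (by rw [e, T.flip_flip])⟩))
  refine ⟨?_, ?_, Or.inl H.base_mem, ?_, ?_, hα _ h2 H.start h1,
    hα _ (by rwa [T.flip_flip]) H.finish h2⟩
  · rintro t (ht | ht)
    · exact Or.inl (H.rot_mem t ht)
    · exact Or.inr (Equiv.Perm.sameCycle_apply_right.2 ht)
  · intro t ht
    rcases hmem.1 ht with h | h
    · exact Or.inl (H.subset t (hds h))
    · exact Or.inr ((hN t).1 h).1
  · intro h
    rcases hmem.1 h with h | h
    · exact H.base_notMem (hds h)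
    · exact hO ((hN _).1 h).1 H.base_mem
  · rintro t (ht | ht) htd htk
    · by_cases e : t = d
      · subst e
        refine ⟨Or.inr (Equiv.Perm.SameCycle.refl _ _), fun h => ?_⟩
        rcases hmem.1 h with h | h
        · exact hk (H.subset _ (hds h))
        · exact ((hN _).1 h).2 rfl
      · have := H.pair t ht (fun h => ?_) htk
        · refine ⟨Or.inl this.1, fun h => ?_⟩
          rcases hmem.1 h with h | h
          · exact this.2 (hds h)
          · exact hO ((hN _).1 h).1 this.1
        · rcases hds' h with h | h
          · exact e h
          · exact htd (hmem.2 (Or.inl h))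
    · have e : t = T.flip d := by
        by_contra e
        exact htd (hmem.2 (Or.inr ((hN t).2 ⟨ht, e⟩)))
      rw [e, T.flip_flip]
      refine ⟨Or.inl hdB, fun h => ?_⟩
      rcases hmem.1 h with h | h
      · exact hd h
      · exact hO ((hN _).1 h).1 hdB

/-- Sweeping over one more vertex. -/
theorem Reaches.exists_step {d : T.Dart}
    (hlo : ∀ x, T.rot (T.rot x) ≠ x → T.rot (T.rot (T.flip x)) = T.flip x)
    (hα : T.rot (T.rot α) = α) (hα' : T.rot (T.rot (T.flip α)) = T.flip α)
    (hR : Reaches T α k₀ u S s (A ++ d :: C)) (H : Sweeps T α k₀ (A ++ d :: C) B)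
    (h1 : d ≠ α) (h2 : d ≠ T.flip α) (hk : T.flip d ∉ B) :
    ∃ ds', Reaches T α k₀ u S s ds' ∧
      Sweeps T α k₀ ds' (B ∪ {t | T.rot.SameCycle (T.flip d) t}) := by
  have hO : ∀ {x}, T.rot.SameCycle (T.flip d) x → x ∉ B := fun h => H.notMem_of_sameCycle hk h
  have hds : ∀ x, T.rot.SameCycle (T.flip d) x → x ∉ A ++ C := fun x hx h =>
    hO hx (H.subset x (by simp only [List.mem_append, List.mem_cons] at h ⊢; tauto))
  have hd := hR.exists_cross.1
  have hk₀ : ∀ {x}, T.rot.SameCycle (T.flip d) x → k₀ ≠ x := fun h e => hO h (e ▸ H.base_mem)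
  obtain ⟨s0, s1, s2, s3⟩ := sameCycle_self (T.flip d)
  by_cases hkk : T.rot (T.rot (T.flip d)) = T.flip d
  · refine ⟨_, hR.push_aux hkk (fun e => hO s1 (e ▸ H.subset d (by simp))) h1 h2 (hds _ s0)
      (hds _ s1) (hk₀ s0) (hk₀ s1), ?_⟩
    have := H.step (N := [T.rot (T.flip d)]) hd h1 h2 hk fun t => by
      rw [List.mem_singleton, T.sameCycle_rot]
      have := T.rot_ne (T.flip d)
      constructor
      · rintro rfl
        exact ⟨by tauto, this⟩
      · rintro ⟨rfl | rfl | rfl | rfl, h⟩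
        · exact absurd rfl h
        · rfl
        · exact absurd hkk h
        · rw [hkk]
    simpa using this
  · have haux : ∀ {x}, T.rot.SameCycle (T.flip d) x → T.rot (T.rot x) ≠ x := fun h e =>
      hkk (aux_of_sameCycle h.symm e)
    refine ⟨_, hR.push_crossing hkk (fun x hx hx' => haux hx' (hlo x (haux hx)))
      (fun h => haux h hα) (fun h => haux h hα') hds (fun h => hk₀ h rfl), ?_⟩
    have := H.step (N := [T.rot (T.rot (T.rot (T.flip d))), T.rot (T.rot (T.flip d)),
        T.rot (T.flip d)]) hd h1 h2 hk fun t => by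
      obtain ⟨n1, n2, n3, n4, n5, n6⟩ := ne_of_crossing hkk
      rw [T.sameCycle_rot]
      simp only [List.mem_cons, List.not_mem_nil, or_false]
      constructor
      · rintro (rfl | rfl | rfl)
        · exact ⟨by tauto, n3⟩
        · exact ⟨by tauto, n2⟩
        · exact ⟨by tauto, n1⟩
      · rintro ⟨rfl | h, h'⟩
        · exact absurd rfl h'
        · tauto
    simpa using this

/-- The strand can be swept over all vertices that it encounters. -/
theorem Reaches.sweep
    (hlo : ∀ x, T.rot (T.rot x) ≠ x → T.rot (T.rot (T.flip x)) = T.flip x)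
    (hα : T.rot (T.rot α) = α) (hα' : T.rot (T.rot (T.flip α)) = T.flip α) (n : ℕ) :
    ∀ {ds : List T.Dart} {B : Set T.Dart}, Bᶜ.ncard = n → Reaches T α k₀ u S s ds →
    Sweeps T α k₀ ds B → ∃ ds', Reaches T α k₀ u S s ds' ∧ k₀ ∉ ds' ∧
      ∀ d ∈ ds', d = α ∨ d = T.flip α ∨ d = T.flip k₀ ∨ T.flip d ∈ ds' := by
  have := T.finite
  induction n using Nat.strong_induction_on with
  | _ n ih =>
    intro ds B hn hR H
    by_cases h : ∃ d ∈ ds, d ≠ α ∧ d ≠ T.flip α ∧ T.flip d ∉ B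
    · obtain ⟨d, hd, h1, h2, h3⟩ := h
      obtain ⟨A, C, rfl⟩ := List.append_of_mem hd
      obtain ⟨ds', hR', H'⟩ := hR.exists_step hlo hα hα' H h1 h2 h3
      refine ih _ ?_ rfl hR' H'
      rw [← hn]
      refine Set.ncard_lt_ncard ⟨Set.compl_subset_compl.2 Set.subset_union_left, fun h => ?_⟩
        (Set.toFinite _)
      exact h h3 (Or.inr (Equiv.Perm.SameCycle.refl _ _))
    · push Not at h
      refine ⟨ds, hR, H.base_notMem, fun d hd => ?_⟩
      by_cases h1 : d = α
      · exact Or.inl h1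
      by_cases h2 : d = T.flip α
      · exact Or.inr (Or.inl h2)
      by_cases h3 : T.flip d = k₀
      · exact Or.inr (Or.inr (Or.inl (by rw [← h3, T.flip_flip])))
      refine Or.inr (Or.inr (Or.inr ?_))
      by_contra h4
      have := (H.pair _ (h d hd h1 h2) h4 h3).2
      rw [T.flip_flip] at this
      exact this hd

/-- The strand can be moved until it crosses no half-edge, or only the one opposite to `k₀`. -/
theorem Reaches.sweep_and_tighten {ds : List T.Dart} {B : Set T.Dart}
    (hlo : ∀ x, T.rot (T.rot x) ≠ x → T.rot (T.rot (T.flip x)) = T.flip x)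
    (hα : T.rot (T.rot α) = α) (hα' : T.rot (T.rot (T.flip α)) = T.flip α)
    (hR : Reaches T α k₀ u S s ds) (H : Sweeps T α k₀ ds B) :
    Reaches T α k₀ u S s [] ∨ Reaches T α k₀ u S s [T.flip k₀] := by
  obtain ⟨ds', hR', h1, h2⟩ := hR.sweep hlo hα hα' _ rfl H
  exact hR'.tighten _ rfl h2 (by rwa [T.flip_flip])

end

end VirtualDiagram

namespace VirtualDiagram

/-! ### Swinging an arc around the sphere -/

section

variable {T : VirtualDiagram} {α h : T.Dart} {u : Bool}

/-- The strand is moved away from the edge of `h` and around the sphere until it either comes back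
to this edge from the other side or has disappeared. -/
theorem linked_of_aux
    (hlo : ∀ x, T.rot (T.rot x) ≠ x → T.rot (T.rot (T.flip x)) = T.flip x)
    (hα : T.rot (T.rot α) = α) (hα' : T.rot (T.rot (T.flip α)) = T.flip α)
    (hk : T.rot (T.rot (T.flip h)) = T.flip h) (hrk : h ≠ T.rot (T.flip h))
    (h1 : h ≠ α) (h2 : h ≠ T.flip α) (hC : (T.cross α h u).Planar) :
    Linked (T.cross α h u) (.inl h) (T.cross α h u) (.inr 1) ∨
      Linked (T.cross α h u) (.inl h) T h := by
  have ff := T.flip_flip h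
  have h3 : T.flip h ≠ α := fun e => h2 (by rw [← e, ff])
  have h4 : T.flip h ≠ T.flip α := fun e => h1 (T.flip.injective e)
  have h5 : T.flip h ≠ h := T.flip_ne h
  have h6 : T.flip h ≠ T.rot (T.flip h) := (T.rot_ne _).symm
  have l : Linked (T.cross α h u) (.inl h) (T.cross α (T.rot (T.flip h)) u) (.inl h) := by
    have := cross_aux_linked (u := u) (g := α) (k := T.flip h) (x := h) hk (by rwa [ff]) h3 h4
      h5.symm hrk (by rwa [ff])
    rwa [ff] at this
  have l' : Linked (T.cross α h u) (.inr 3) (T.cross α (T.rot (T.flip h)) u) (.inl (T.flip h)) := by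
    have := l.flip
    simpa [crossFlip_inl, crossFar_of_ne, crossPort_of_ne, *] using this
  have hR : Reaches T α (T.flip h) u (T.cross α h u) (.inr 3) [T.rot (T.flip h)] :=
    ⟨_, _, _, (Threaded.refl T α u).insert (A := []) (C := []) (g := α)
      (q := T.rot (T.flip h)) List.not_mem_nil (by simp [threadPort]) rfl, l'⟩
  have hS : Sweeps T α (T.flip h) [T.rot (T.flip h)] {T.flip h, T.rot (T.flip h)} := by
    refine ⟨?_, ?_, Or.inl rfl, by simpa using h6, ?_, ?_, ?_⟩
    · rintro t (rfl | rfl)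
      · exact Or.inr rfl
      · exact Or.inl hk
    · rintro d hd
      exact Or.inr (List.mem_singleton.1 hd)
    · rintro t (rfl | rfl) ht ht'
      · exact absurd rfl ht'
      · exact absurd (by simp) ht
    · rintro (e | e)
      · exact absurd e.symm h3
      · exact List.mem_singleton.2 e
    · rintro (e | e)
      · exact absurd e.symm h4
      · exact List.mem_singleton.2 e
  rcases hR.sweep_and_tighten hlo hα hα' hS with hR | hR
  · right
    have := (hR.linked (Threaded.refl T α u)).flip
    simpa [ff] using this
  · left
    rw [ff] at hR
    have := (hR.linked ((Threaded.refl T α u).insert (A := []) (C := []) (g := α) (q := h)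
      List.not_mem_nil (by simp [threadPort]) rfl)).flip
    simpa [crossFlip_inl, crossFar_of_ne, crossPort_of_ne, crossFar_flip', *] using this

/-- Two punctures on the two sides of one of the strands at the crossing can be moved along this
strand through the crossing. -/
theorem cross_linked
    (hlo : ∀ x, T.rot (T.rot x) ≠ x → T.rot (T.rot (T.flip x)) = T.flip x)
    (hα : T.rot (T.rot α) = α) (hα' : T.rot (T.rot (T.flip α)) = T.flip α)
    (hh : T.rot (T.rot h) = h) (hk : T.rot (T.rot (T.flip h)) = T.flip h)
    (hrk : h ≠ T.rot (T.flip h)) (h1 : h ≠ α) (h2 : h ≠ T.flip α) (hC : (T.cross α h u).Planar) :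
    Linked (T.cross α h u) (.inl h) (T.cross α h u) (.inr 1) := by
  have ff := T.flip_flip h
  have h3 : T.flip h ≠ α := fun e => h2 (by rw [← e, ff])
  have h4 : T.flip h ≠ T.flip α := fun e => h1 (T.flip.injective e)
  have h5 : T.flip h ≠ h := T.flip_ne h
  rcases linked_of_aux hlo hα hα' hk hrk h1 h2 hC with l | l
  · exact l
  -- The strand can also be moved in the opposite direction.
  have m := cross_flip_flip_isIso (u := u) h1 h2
  have l1 : Linked (T.cross α h u) (.inl (T.flip h)) (T.cross (T.flip α) (T.flip h) u)
    (.inl (T.flip h)) := m.linked hC (.inl (T.flip h))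
  have l2 : Linked (T.cross α h u) (.inr 3) (T.cross (T.flip α) (T.flip h) u) (.inr 1) :=
    m.linked hC (.inr 1)
  have e : (T.cross α h u).flip (.inl (T.flip h)) = .inr 1 := by
    simp [crossFlip_inl, crossFar_of_ne, *]
  rcases linked_of_aux (α := T.flip α) (h := T.flip h) (u := u) hlo hα' (by rwa [T.flip_flip])
    (by rwa [ff]) (by rw [ff]; exact fun e => hrk (by rw [e, hh])) h4 (by rwa [T.flip_flip])
    (m.planar hC) with l' | l'
  · have := ((l1.trans l').trans l2.symm).flip
    rw [e] at this
    exact this.symm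
  · have := (l1.trans l').flip
    rw [e, ff] at this
    exact l.trans this.symm

end

/-! ### Punctures can be moved through a crossing -/

section

variable {V : VirtualDiagram} {x : V.Dart}

open Classical in
/-- Turn the crossing of `x` into two auxiliary points, one on each strand. -/
@[reducible] noncomputable def split (V : VirtualDiagram) (x : V.Dart)
    (hx : V.rot (V.rot x) ≠ x) : VirtualDiagram where
  Dart := V.Dart
  finite := V.finite
  nonempty := V.nonempty
  rot :=
    { toFun := fun t => if V.rot.SameCycle x t then V.rot (V.rot t) else V.rot t
      invFun := fun t => if V.rot.SameCycle x t then V.rot (V.rot t) else V.rot.symm t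
      left_inv := fun t => by
        by_cases h : V.rot.SameCycle x t <;> simp [h, V.rot_four]
      right_inv := fun t => by
        by_cases h : V.rot.SameCycle x t
        · simp [h, V.rot_four]
        · have : ¬ V.rot.SameCycle x (V.rot.symm t) := fun h' => h (by
            have := Equiv.Perm.sameCycle_apply_right.2 h'
            rwa [Equiv.apply_symm_apply] at this)
          simp [h, this] }
  flip := V.flip
  upper := V.upper
  rot_ne t := by
    by_cases h : V.rot.SameCycle x t
    · have : V.rot (V.rot t) ≠ t := fun e => hx (aux_of_sameCycle h.symm e)
      simpa [h] using this
    · simpa [h] using V.rot_ne t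
  rot_four t := by
    by_cases h : V.rot.SameCycle x t <;> simp [h, V.rot_four]
  flip_ne := V.flip_ne
  flip_flip := V.flip_flip
  upper_rot t := by
    by_cases h : V.rot.SameCycle x t
    · simp [h, V.rot_four]
    · simpa [h] using V.upper_rot t
  along := by
    intro P h1 h2 h3
    refine V.along P h1 (fun a ha hP => ?_) (fun a ha hP => ?_)
    · have h : ¬ V.rot.SameCycle x a := fun h => hx (aux_of_sameCycle h.symm ha)
      have := h2 a (by simpa [h] using ha) hP
      simpa [h] using this
    · by_cases h : V.rot.SameCycle x a
      · have := h2 a (by simp [h, V.rot_four]) hP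
        simpa [h] using this
      · have := h3 a (by simpa [h] using ha) hP
        simpa [h] using this

open Classical in
/-- Splitting a crossing and crossing the two strands again amounts to inserting an auxiliary point
on one half of each strand. -/
noncomputable def splitEquiv (V : VirtualDiagram) (x : V.Dart) (hx : V.rot (V.rot x) ≠ x) :
    V.Dart ⊕ Fin 4 ≃ (V.Dart ⊕ Bool) ⊕ Bool where
  toFun := Sum.elim
    (fun t => if t = x then .inr false else if t = V.rot x then .inl (.inr false) else
      if t = V.rot (V.rot x) then .inr true else
      if t = V.rot (V.rot (V.rot x)) then .inl (.inr true) else .inl (.inl t))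
    (fun i => .inl (.inl (if i = 0 then x else if i = 1 then V.rot x else
      if i = 2 then V.rot (V.rot x) else V.rot (V.rot (V.rot x)))))
  invFun := Sum.elim (Sum.elim
    (fun t => if t = x then .inr 0 else if t = V.rot x then .inr 1 else
      if t = V.rot (V.rot x) then .inr 2 else if t = V.rot (V.rot (V.rot x)) then .inr 3 else .inl t)
    (fun i => .inl (if i then V.rot (V.rot (V.rot x)) else V.rot x)))
    (fun i => .inl (if i then V.rot (V.rot x) else x))
  left_inv := by
    obtain ⟨n1, n2, n3, n4, n5, n6⟩ := ne_of_crossing hx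
    apply inr_cases
    · intro t
      by_cases e1 : t = x
      · simp [e1]
      by_cases e2 : t = V.rot x
      · simp [e2, n1]
      by_cases e3 : t = V.rot (V.rot x)
      · simp [e3, n2, n4]
      by_cases e4 : t = V.rot (V.rot (V.rot x))
      · simp [e4, n3, n5, n6]
      simp [e1, e2, e3, e4]
    all_goals simp [n1, n2, n3, n4, n5, n6]
  right_inv := by
    obtain ⟨n1, n2, n3, n4, n5, n6⟩ := ne_of_crossing hx
    rintro ((t | i) | i)
    · by_cases e1 : t = x
      · simp [e1]
      by_cases e2 : t = V.rot x
      · simp [e2, n1]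
      by_cases e3 : t = V.rot (V.rot x)
      · simp [e3, n2, n4]
      by_cases e4 : t = V.rot (V.rot (V.rot x))
      · simp [e4, n3, n5, n6]
      simp [e1, e2, e3, e4]
    all_goals cases i <;> simp [n1, n2, n3, n4, n5, n6]

theorem split_isIso (hx : V.rot (V.rot x) ≠ x)
    (hflip : ∀ t, V.rot.SameCycle x t → ¬ V.rot.SameCycle x (V.flip t)) :
    IsIso ((V.sub (V.rot (V.rot (V.rot x)))).sub (.inl (V.rot (V.rot x))))
      ((V.split x hx).cross x (V.rot x) (V.upper x)) (V.splitEquiv x hx) where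
  upper_eq := by
    obtain ⟨n1, n2, n3, n4, n5, n6⟩ := ne_of_crossing hx
    have u1 := V.upper_rot x hx
    have u2 := V.upper_rot (V.rot x) (fun e => hx (V.rot.injective e))
    have u3 := V.upper_rot (V.rot (V.rot x)) (fun e => hx (V.rot.injective (V.rot.injective e)))
    obtain ⟨s0, s1, s2, s3⟩ := sameCycle_self x
    apply inr_cases
    · intro t
      by_cases e1 : t = x
      · simp [e1, s0, s2, V.rot_four]
      by_cases e2 : t = V.rot x
      · simp [e2, s1, s3, V.rot_four]
      by_cases e3 : t = V.rot (V.rot x)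
      · simp [e3, s2, s0, V.rot_four]
      by_cases e4 : t = V.rot (V.rot (V.rot x))
      · simp [e4, s1, s3, V.rot_four]
      intro _
      simp [splitEquiv, e1, e2, e3, e4]
    all_goals simp [splitEquiv, u1, u2, u3]
  rot_eq := by
    obtain ⟨n1, n2, n3, n4, n5, n6⟩ := ne_of_crossing hx
    obtain ⟨s0, s1, s2, s3⟩ := sameCycle_self x
    apply inr_cases
    · intro t
      by_cases e1 : t = x
      · simp [splitEquiv, s0, e1, n2, n4]
      by_cases e2 : t = V.rot x
      · simp [splitEquiv, s1, e2, n1, n3, n5, n6]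
      by_cases e3 : t = V.rot (V.rot x)
      · simp [splitEquiv, s2, e3, n2, n4, V.rot_four]
      by_cases e4 : t = V.rot (V.rot (V.rot x))
      · simp [splitEquiv, s3, e4, n1, n3, n5, n6, V.rot_four]
      have h : ¬ V.rot.SameCycle x t := by
        rw [V.sameCycle_rot]
        tauto
      have f1 : V.rot t ≠ x := fun e => e4 (V.rot.injective (by rw [e, V.rot_four]))
      have f2 : V.rot t ≠ V.rot x := fun e => e1 (V.rot.injective e)
      have f3 : V.rot t ≠ V.rot (V.rot x) := fun e => e2 (V.rot.injective e)
      have f4 : V.rot t ≠ V.rot (V.rot (V.rot x)) := fun e => e3 (V.rot.injective e)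
      simp [splitEquiv, e1, e2, e3, e4, f1, f2, f3, f4, h]
    all_goals simp [splitEquiv, V.rot_four]
  flip_eq := by
    obtain ⟨n1, n2, n3, n4, n5, n6⟩ := ne_of_crossing hx
    obtain ⟨s0, s1, s2, s3⟩ := sameCycle_self x
    have hS : ∀ {t}, V.rot.SameCycle x t → t = x ∨ t = V.rot x ∨ t = V.rot (V.rot x) ∨
      t = V.rot (V.rot (V.rot x)) := fun h => (V.sameCycle_rot _ _).1 h
    have hF : ∀ {t}, V.rot.SameCycle x t → V.flip t ≠ x ∧ V.flip t ≠ V.rot x ∧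
        V.flip t ≠ V.rot (V.rot x) ∧ V.flip t ≠ V.rot (V.rot (V.rot x)) := fun h => by
      have := hflip _ h
      rw [V.sameCycle_rot] at this
      tauto
    obtain ⟨a1, a2, a3, a4⟩ := hF s0
    obtain ⟨b1, b2, b3, b4⟩ := hF s1
    obtain ⟨c1, c2, c3, c4⟩ := hF s2
    obtain ⟨d1, d2, d3, d4⟩ := hF s3
    have ff := V.flip_flip
    have fi := V.flip.injective
    have a1' := a1.symm
    have a2' := a2.symm
    have a3' := a3.symm
    have a4' := a4.symm
    have b1' := b1.symm
    have b2' := b2.symm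
    have b3' := b3.symm
    have b4' := b4.symm
    have c1' := c1.symm
    have c2' := c2.symm
    have c3' := c3.symm
    have c4' := c4.symm
    have d1' := d1.symm
    have d2' := d2.symm
    have d3' := d3.symm
    have d4' := d4.symm
    have m1 := n1.symm
    have m2 := n2.symm
    have m3 := n3.symm
    have m4 := n4.symm
    have m5 := n5.symm
    have m6 := n6.symm
    have i1 : V.flip (V.rot x) ≠ V.flip x := fun e => n1 (fi e)
    have i2 : V.flip (V.rot (V.rot x)) ≠ V.flip x := fun e => n2 (fi e)
    have i3 : V.flip (V.rot (V.rot (V.rot x))) ≠ V.flip x := fun e => n3 (fi e)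
    have i4 : V.flip (V.rot (V.rot x)) ≠ V.flip (V.rot x) := fun e => n4 (fi e)
    have i5 : V.flip (V.rot (V.rot (V.rot x))) ≠ V.flip (V.rot x) := fun e => n5 (fi e)
    have i6 : V.flip (V.rot (V.rot (V.rot x))) ≠ V.flip (V.rot (V.rot x)) := fun e => n6 (fi e)
    have i1' := i1.symm
    have i2' := i2.symm
    have i3' := i3.symm
    have i4' := i4.symm
    have i5' := i5.symm
    have i6' := i6.symm
    clear hF hS hflip s0 s1 s2 s3
    apply inr_cases
    · intro t
      by_cases he : t = x ∨ t = V.rot x ∨ t = V.rot (V.rot x) ∨ t = V.rot (V.rot (V.rot x)) ∨ t =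
          V.flip x ∨ t = V.flip (V.rot x) ∨ t = V.flip (V.rot (V.rot x)) ∨ t = V.flip (V.rot
          (V.rot (V.rot x)))
      · rcases he with e | e | e | e | e | e | e | e <;> rw [e] <;>
          simp (maxDischargeDepth := 6) [splitEquiv, crossFlip_inl, crossFar_of_ne,
            crossFar_flip', crossPort_of_ne, subFlip_inl, subFlip_flip', *]
      push Not at he
      obtain ⟨e1, e2, e3, e4, f1, f2, f3, f4⟩ := he
      have g1 : V.flip t ≠ x := fun h => f1 ((V.flip_flip t).symm.trans (congrArg V.flip h))
      have g2 : V.flip t ≠ V.rot x := fun h => f2 ((V.flip_flip t).symm.trans (congrArg V.flip h))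
      have g3 : V.flip t ≠ V.rot (V.rot x) := fun h => f3 ((V.flip_flip t).symm.trans (congrArg V.flip h))
      have g4 : V.flip t ≠ V.rot (V.rot (V.rot x)) := fun h => f4 ((V.flip_flip t).symm.trans (congrArg V.flip h))
      simp (maxDischargeDepth := 6) [splitEquiv, crossFlip_inl, crossFar_of_ne,
        crossPort_of_ne, subFlip_inl, *]
    all_goals simp (maxDischargeDepth := 6) [splitEquiv, crossFar_of_ne,
      crossPort_of_ne, subFlip_inl, *]

end

end VirtualDiagram

namespace VirtualDiagram

/-! ### Punctures can be moved along the curve -/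

section

variable {V : VirtualDiagram}

/-- The case in which every half-edge at a crossing leads to an auxiliary point.  The diagram then
arises from the one without the crossing (`split`) by letting one of its strands cross the other. -/
theorem across_linked_of_aux (hV : V.Planar)
    (hlo : ∀ x, V.rot (V.rot x) ≠ x → V.rot (V.rot (V.flip x)) = V.flip x) {g : V.Dart}
    (hg : V.rot (V.rot g) ≠ g) : Linked V g V (V.flip (V.rot (V.rot g))) := by
  have hx : V.rot (V.rot (V.rot g)) ≠ V.rot g := fun e => hg (V.rot.injective e)
  generalize hxg : V.rot g = x at hx
  have e3 : V.rot (V.rot (V.rot x)) = g := by rw [← hxg, V.rot_four]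
  obtain ⟨n1, n2, n3, n4, n5, n6⟩ := ne_of_crossing hx
  obtain ⟨s0, s1, s2, s3⟩ := sameCycle_self x
  have haux : ∀ {t}, V.rot.SameCycle x t → V.rot (V.rot t) ≠ t := fun h e =>
    hx (aux_of_sameCycle h.symm e)
  have hflip : ∀ t, V.rot.SameCycle x t → ¬ V.rot.SameCycle x (V.flip t) := fun t h h' =>
    haux h' (hlo t (haux h))
  have m := split_isIso hx hflip
  have l : ∀ t, Linked ((V.sub (V.rot (V.rot (V.rot x)))).sub (.inl (V.rot (V.rot x))))
      (Sum.inl (Sum.inl t)) V t := fun t => by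
    have l1 := sub_linked (V := V) (V.rot (V.rot (V.rot x))) (.inr hV) t
    exact (sub_linked (V := V.sub _) (.inl (V.rot (V.rot x))) (.inr l1.left_planar) _).trans l1
  have hC := m.planar (l x).left_planar
  have hr : ∀ {t}, V.rot.SameCycle x t →
      (V.split x hx).rot t = V.rot (V.rot t) := fun h => by simp [h]
  have hr' : ∀ {t}, ¬ V.rot.SameCycle x t → (V.split x hx).rot t = V.rot t := fun h => by simp [h]
  have hr2 : ∀ {t}, V.rot.SameCycle x t → (V.split x hx).rot ((V.split x hx).rot t) = t :=
    fun {t} h => by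
      rw [hr h, hr (Equiv.Perm.sameCycle_apply_right.2 (Equiv.Perm.sameCycle_apply_right.2 h)),
        V.rot_four]
  have hr2' : ∀ {t}, ¬ V.rot.SameCycle x t →
      (V.split x hx).rot ((V.split x hx).rot t) = V.rot (V.rot t) := fun {t} h => by
    rw [hr' h, hr' (fun h' => h (Equiv.Perm.sameCycle_apply_right.1 h'))]
  have hf : ∀ {t}, V.rot.SameCycle x t → (V.split x hx).rot ((V.split x hx).rot (V.flip t)) =
      V.flip t := fun {t} h => by rw [hr2' (hflip t h), hlo t (haux h)]
  have key : Linked ((V.split x hx).cross x (V.rot x) (V.upper x)) (.inl (V.rot x))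
      ((V.split x hx).cross x (V.rot x) (V.upper x)) (.inr 1) := by
    refine cross_linked (fun t ht => ?_) (hr2 s0) ?_ (hr2 s1) ?_ ?_ n1 ?_ hC
    · have h : ¬ V.rot.SameCycle x t := fun h => ht (hr2 h)
      rw [hr2' h] at ht
      have := hlo t ht
      change (V.split x hx).rot ((V.split x hx).rot (V.flip t)) = V.flip t
      rw [hr2', this]
      exact fun h => haux h this
    · exact hf s0
    · exact hf s1
    · intro e
      change V.rot x = (V.split x hx).rot (V.flip (V.rot x)) at e
      rw [hr' (hflip _ s1)] at e
      exact hflip _ s1 (Equiv.Perm.sameCycle_apply_right.1 (e ▸ s1))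
    · intro e
      change V.rot x = V.flip x at e
      exact hflip x s0 (e ▸ s1)
  have l1 := m.linked (l x).left_planar (.inl (V.rot x))
  have l2 := m.linked (l x).left_planar (.inr 1)
  have k := (l1.trans key).trans l2.symm
  have e1 : V.splitEquiv x hx (.inl (V.rot x)) = .inl (.inr false) := by
    simp [splitEquiv, n1]
  have e2 : V.splitEquiv x hx (.inr 1) = .inl (.inl (V.rot x)) := by
    simp [splitEquiv]
  rw [e1, e2] at k
  -- The inserted auxiliary point leads back to `g`.
  have e3' : ((V.sub (V.rot (V.rot (V.rot x)))).sub (.inl (V.rot (V.rot x)))).flip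
      (.inl (.inr false)) = .inl (.inl (V.rot (V.rot (V.rot x)))) := by
    have n6' : V.flip (V.rot (V.rot x)) ≠ V.rot (V.rot (V.rot x)) := fun e =>
      hflip _ s2 (e ▸ s3)
    refine (subFlip_inl (by simp) ?_).trans rfl
    change (Sum.inr false : V.Dart ⊕ Bool) ≠
      subFlip V.flip (V.rot (V.rot (V.rot x))) (.inl (V.rot (V.rot x)))
    rw [subFlip_inl n6.symm fun e =>
      n6' ((congrArg V.flip e).trans (V.flip_flip _))]
    simp
  have k' := k.flip
  rw [e3'] at k'
  have k2 := ((l _).symm.trans k').trans (l _).flip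
  rw [e3] at k2
  exact k2

/-- Two punctures on the two sides of a strand can be moved along it through a crossing. -/
theorem across_linked (n : ℕ) : ∀ {V : VirtualDiagram}, V.Planar →
    {h : V.Dart | V.rot (V.rot h) ≠ h ∧ V.rot (V.rot (V.flip h)) ≠ V.flip h}.ncard = n →
    ∀ g : V.Dart, V.rot (V.rot g) ≠ g → Linked V g V (V.flip (V.rot (V.rot g))) := by
  induction n using Nat.strong_induction_on with
  | _ n ih =>
    intro V hV hn g hg
    by_cases hlo : ∀ x, V.rot (V.rot x) ≠ x → V.rot (V.rot (V.flip x)) = V.flip x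
    · exact across_linked_of_aux hV hlo hg
    push Not at hlo
    -- Subdivide an edge that joins crossings, and use induction on the number of such half-edges.
    obtain ⟨h, h1, h2⟩ := hlo
    have l : ∀ t, Linked (V.sub h) (Sum.inl t) V t := sub_linked h (.inr hV)
    have hfin := V.finite
    have hfin' := (V.sub h).finite
    have := ih _ ?_ (l g).left_planar rfl (Sum.inl g) (by simpa using hg)
    · exact ((l g).symm.trans this).trans (l (V.rot (V.rot g))).flip
    · rw [← hn]
      set B := {h : V.Dart | V.rot (V.rot h) ≠ h ∧ V.rot (V.rot (V.flip h)) ≠ V.flip h} with hB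
      have hh : h ∈ B := ⟨h1, h2⟩
      have h3 : (Sum.inl '' (B \ {h}) : Set (V.Dart ⊕ Bool)).ncard < B.ncard := by
        rw [Set.ncard_image_of_injective _ Sum.inl_injective]
        exact Set.ncard_sdiff_singleton_lt_of_mem hh (Set.toFinite _)
      refine (Set.ncard_le_ncard ?_ (Set.toFinite _)).trans_lt h3
      rintro (t | b) ⟨a1, a2⟩
      · have b1 : t ≠ h := by
          rintro rfl
          simp at a2
        have b2 : t ≠ V.flip h := by
          rintro rfl
          simp [subFlip_flip (V.flip_ne h)] at a2
        refine ⟨t, ⟨⟨by simpa using a1, ?_⟩, b1⟩, rfl⟩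
        simpa [subFlip_inl b1 b2] using a2
      · simp at a1

/-- The position of two punctures on the two sides of the curve does not matter. -/
theorem linked_or_linked_flip (hV : V.Planar) (g k : V.Dart) :
    Linked V g V k ∨ Linked V g V (V.flip k) := by
  refine V.along (fun k => Linked V g V k ∨ Linked V g V (V.flip k)) (fun a h => ?_)
    (fun a ha h => ?_) (fun a ha h => ?_) g k (Or.inl (.refl hV g))
  · rw [V.flip_flip]
    exact h.symm
  · have l := linked_rot hV ha
    refine h.elim (fun h => Or.inr (h.trans l)) fun h => Or.inl (h.trans ?_)
    have := l.flip
    rwa [V.flip_flip] at this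
  · have l := across_linked _ hV rfl a ha
    refine h.elim (fun h => Or.inr (h.trans l)) fun h => Or.inl (h.trans ?_)
    have := l.flip
    rwa [V.flip_flip] at this

end

/-- Moves on the sphere can be carried out in the complement of two punctures on the two sides of
the curve. -/
theorem linked_of_eqvGen {ι : Type} {P Q : PuncturedDiagram ι}
    (h : Relation.EqvGen ElementaryMove P Q) :
    ∀ x y, Linked P.diagram.toVirtual x Q.diagram.toVirtual y ∨
      Linked P.diagram.toVirtual x Q.diagram.toVirtual (Q.diagram.toVirtual.flip y) := by
  induction h with
  | rel P Q h =>
    intro x y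
    obtain ⟨a, b, l⟩ := h.exists_linked
    have h1 : Linked P.diagram.toVirtual x Q.diagram.toVirtual b ∨ Linked P.diagram.toVirtual x
        Q.diagram.toVirtual (Q.diagram.toVirtual.flip b) :=
      (linked_or_linked_flip P.diagram.planar x a).imp (fun h => h.trans l) fun h => h.trans l.flip
    have h2 := linked_or_linked_flip Q.diagram.planar b y
    rcases h1 with h1 | h1 <;> rcases h2 with h2 | h2
    · exact Or.inl (h1.trans h2)
    · exact Or.inr (h1.trans h2)
    · exact Or.inr (h1.trans h2.flip)
    · have := h1.trans h2.flip
      rw [VirtualDiagram.flip_flip] at this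
      exact Or.inl this
  | refl P => exact linked_or_linked_flip P.diagram.planar
  | symm P Q _ ih =>
    intro x y
    refine (ih y x).imp Linked.symm fun h => ?_
    have := h.symm.flip
    rwa [VirtualDiagram.flip_flip] at this
  | trans P Q R _ _ ih1 ih2 =>
    intro x y
    obtain ⟨z⟩ := Q.diagram.nonempty
    rcases ih1 x z with h1 | h1 <;> rcases ih2 z y with h2 | h2
    · exact Or.inl (h1.trans h2)
    · exact Or.inr (h1.trans h2)
    · exact Or.inr (h1.trans h2.flip)
    · have := h1.trans h2.flip
      rw [VirtualDiagram.flip_flip] at this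
      exact Or.inl this

end VirtualDiagram

namespace VirtualDiagram

/-! ### Crossings that are separated by punctures -/

section

variable {V W U : VirtualDiagram} {ι : Type} {j : W.Dart → V.Dart}

/-- A colouring with vanishing corner sums has the colours `s` at the punctures on the left of the
darts `a`. -/
def IsNull (V : VirtualDiagram) (a : ι → V.Dart) (s : ι → ZMod 2) : Prop :=
  ∃ φ, V.IsColoring φ ∧ (∀ x, V.cornerSum φ x = 0) ∧ ∀ i, φ (a i) = s i

open Classical in
/-- The darts at those crossings for which there is a colouring with the colours `s` at the
punctures and with odd corner sum at this crossing only. -/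
def hits (V : VirtualDiagram) (a : ι → V.Dart) (s : ι → ZMod 2) : Set V.Dart :=
  {v | ∃ φ, V.IsColoring φ ∧ (∀ x, V.cornerSum φ x = if V.rot.SameCycle v x then 1 else 0) ∧
    ∀ i, φ (a i) = s i}

/-- The number of crossings in `hits` has the same parity for both diagrams, provided that there is
no such colouring without odd corner sums.  (A crossing has four darts.) -/
def SameHits (V : VirtualDiagram) (a : ι → V.Dart) (W : VirtualDiagram) (b : ι → W.Dart) : Prop :=
  ∀ s, (V.IsNull a s ↔ W.IsNull b s) ∧
    (¬ V.IsNull a s → (V.hits a s).ncard ≡ (W.hits b s).ncard [MOD 8])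

variable {a a' : ι → V.Dart} {b : ι → W.Dart} {d : ι → U.Dart} {s : ι → ZMod 2}

theorem SameHits.symm (h : SameHits V a W b) : SameHits W b V a := fun s =>
  ⟨(h s).1.symm, fun hs => ((h s).2 fun h' => hs ((h s).1.1 h')).symm⟩

theorem SameHits.trans (h : SameHits V a W b) (h' : SameHits W b U d) : SameHits V a U d :=
  fun s => ⟨(h s).1.trans (h' s).1, fun hs => ((h s).2 hs).trans ((h' s).2 fun e => hs ((h s).1.2 e))⟩

theorem sameHits_of_eq (h : ∀ φ, V.IsColoring φ → ∀ i, φ (a i) = φ (a' i)) :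
    SameHits V a V a' := by
  intro s
  have h1 : V.IsNull a s ↔ V.IsNull a' s := by
    constructor
    · rintro ⟨φ, hφ, h0, hs⟩
      exact ⟨φ, hφ, h0, fun i => by rw [← h φ hφ, hs]⟩
    · rintro ⟨φ, hφ, h0, hs⟩
      exact ⟨φ, hφ, h0, fun i => by rw [h φ hφ, hs]⟩
  have h2 : V.hits a s = V.hits a' s := by
    ext v
    constructor
    · rintro ⟨φ, hφ, h0, hs⟩
      exact ⟨φ, hφ, h0, fun i => by rw [← h φ hφ, hs]⟩
    · rintro ⟨φ, hφ, h0, hs⟩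
      exact ⟨φ, hφ, h0, fun i => by rw [h φ hφ, hs]⟩
  exact ⟨h1, fun _ => by rw [h2]⟩

/-- Only crossings are hit. -/
theorem crossing_of_mem_hits {v : V.Dart} (h : v ∈ V.hits a s) : V.rot (V.rot v) ≠ v := by
  obtain ⟨φ, -, h0, -⟩ := h
  intro hv
  have := h0 v
  rw [cornerSum_aux φ hv, if_pos (Equiv.Perm.SameCycle.refl _ _)] at this
  exact zero_ne_one this

theorem mem_hits_iff_of_sameCycle {v w : V.Dart} (h : V.rot.SameCycle v w) :
    v ∈ V.hits a s ↔ w ∈ V.hits a s := by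
  have h2 : ∀ {v w : V.Dart}, V.rot.SameCycle v w → v ∈ V.hits a s → w ∈ V.hits a s := by
    rintro v w h ⟨φ, hφ, h0, hs⟩
    refine ⟨φ, hφ, fun x => (h0 x).trans ?_, hs⟩
    congr 1
    exact propext ⟨fun h' => h.symm.trans h', fun h' => h.trans h'⟩
  exact ⟨h2 h, h2 h.symm⟩

namespace Restricts

variable {B : V.Dart → Prop}

theorem bad_of_sameCycle (m : Restricts V W j B) {x y : V.Dart} (h : V.rot.SameCycle x y) :
    B y ↔ B x := by
  rw [V.sameCycle_rot] at h
  rcases h with rfl | rfl | rfl | rfl <;> simp only [m.bad_rot]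

theorem sameCycle_iff (m : Restricts V W j B) {x y : W.Dart} (hx : ¬ B (j x)) :
    V.rot.SameCycle (j x) (j y) ↔ W.rot.SameCycle x y := by
  have h1 : ¬ B (j (W.rot x)) := by rwa [m.bad_rot']
  have h2 : ¬ B (j (W.rot (W.rot x))) := by rwa [m.bad_rot']
  rw [V.sameCycle_rot, W.sameCycle_rot, ← m.rot_eq _ hx, ← m.rot_eq _ h1, ← m.rot_eq _ h2]
  simp only [m.injective.eq_iff]

theorem isNull_iff (m : Restricts V W j B) (hV : V.Planar) :
    V.IsNull (j ∘ b) s ↔ W.IsNull b s := by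
  constructor
  · rintro ⟨φ, hφ, h0, hs⟩
    refine ⟨φ ∘ j, m.coloring φ hφ fun y _ => h0 y, fun x => ?_, hs⟩
    by_cases hx : B (j x)
    · exact m.cornerSum_bad _ hx
    · rw [m.cornerSum φ hx, h0]
  · rintro ⟨ψ, hψ, h0, hs⟩
    obtain ⟨φ, hφ, rfl, h1, h2⟩ := m.exists_coloring hV hψ
    refine ⟨φ, hφ, fun y => ?_, hs⟩
    by_cases hy : B y
    · exact h1 y hy
    · obtain h | ⟨x, rfl⟩ := m.cases y
      · exact absurd h hy
      · rw [h2 x hy, h0]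

theorem mem_hits_iff (m : Restricts V W j B) (hV : V.Planar) {x : W.Dart} (hx : ¬ B (j x)) :
    j x ∈ V.hits (j ∘ b) s ↔ x ∈ W.hits b s := by
  have hB : ∀ {y}, B y → ¬ V.rot.SameCycle (j x) y := fun hy h =>
    hx ((m.bad_of_sameCycle h).1 hy)
  constructor
  · rintro ⟨φ, hφ, h0, hs⟩
    refine ⟨φ ∘ j, m.coloring φ hφ fun y hy => ?_, fun y => ?_, hs⟩
    · rw [h0, if_neg (hB hy)]
    · by_cases hy : B (j y)
      · rw [m.cornerSum_bad _ hy, if_neg]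
        rw [← m.sameCycle_iff hx]
        exact hB hy
      · rw [m.cornerSum φ hy, h0]
        congr 1
        exact propext (m.sameCycle_iff hx)
  · rintro ⟨ψ, hψ, h0, hs⟩
    obtain ⟨φ, hφ, rfl, h1, h2⟩ := m.exists_coloring hV hψ
    refine ⟨φ, hφ, fun y => ?_, hs⟩
    by_cases hy : B y
    · rw [h1 y hy, if_neg (hB hy)]
    · obtain h | ⟨y, rfl⟩ := m.cases y
      · exact absurd h hy
      · rw [h2 y hy, h0]
        congr 1
        exact propext (m.sameCycle_iff hx).symm

/-- It suffices to see that the number of crossings in question that take part in the move is even. -/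
theorem sameHits (m : Restricts V W j B) (hV : V.Planar) (b : ι → W.Dart)
    (h : ∀ s, ¬ W.IsNull b s → (V.hits (j ∘ b) s ∩ {y | B y}).ncard ≡ 0 [MOD 8]) :
    SameHits V (j ∘ b) W b := by
  have := V.finite
  have := W.finite
  refine fun s => ⟨m.isNull_iff hV, fun hs => ?_⟩
  have e : V.hits (j ∘ b) s = j '' W.hits b s ∪ (V.hits (j ∘ b) s ∩ {y | B y}) := by
    ext y
    constructor
    · intro hy
      by_cases hB : B y
      · exact Or.inr ⟨hy, hB⟩
      · obtain h | ⟨x, rfl⟩ := m.cases y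
        · exact absurd h hB
        · exact Or.inl ⟨x, (m.mem_hits_iff hV hB).1 hy, rfl⟩
    · rintro (⟨x, hx, rfl⟩ | hy)
      · refine (m.mem_hits_iff hV fun h => ?_).2 hx
        exact crossing_of_mem_hits hx (m.bad_aux x h).1
      · exact hy.1
  have hdis : Disjoint (j '' W.hits b s) (V.hits (j ∘ b) s ∩ {y | B y}) := by
    rw [Set.disjoint_left]
    rintro _ ⟨x, hx, rfl⟩ h
    exact crossing_of_mem_hits hx (m.bad_aux x h.2).1
  rw [e, Set.ncard_union_eq hdis (Set.toFinite _) (Set.toFinite _),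
    Set.ncard_image_of_injective _ m.injective]
  exact (Nat.ModEq.refl _).add (h s fun h' => hs ((m.isNull_iff hV).2 h'))

end Restricts

theorem IsIso.restricts {j : W.Dart ≃ V.Dart} (m : IsIso V W j) :
    Restricts V W j fun _ => False where
  injective := j.injective
  bad_rot _ := Iff.rfl
  cases y := Or.inr ⟨j.symm y, (j.apply_symm_apply y).symm⟩
  rot_eq x _ := m.rot_eq x
  bad_aux _ h := h.elim
  coloring _ hφ _ := m.coloring hφ
  flip_checkerboard χ _ h x := by rw [m.flip_eq, h]

theorem IsIso.sameHits {j : W.Dart ≃ V.Dart} (m : IsIso V W j) (hV : V.Planar) (b : ι → W.Dart) :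
    SameHits V (j ∘ b) W b :=
  m.restricts.sameHits hV b fun s _ => by simp [Nat.ModEq.refl]

theorem Erases.sameHits {k : V.Dart} (m : Erases V W j k) (hV : V.Planar) (b : ι → W.Dart) :
    SameHits V (j ∘ b) W b := by
  refine m.restricts.sameHits hV b fun s _ => ?_
  have : V.hits (j ∘ b) s ∩ {y | y = k ∨ y = V.rot k} = ∅ := by
    rw [Set.eq_empty_iff_forall_notMem]
    rintro y ⟨h1, rfl | rfl⟩
    · exact crossing_of_mem_hits h1 m.aux
    · exact crossing_of_mem_hits h1 (by rw [m.aux])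
  rw [this, Set.ncard_empty]

/-- The corner sum at the crossing of a loop does not matter for the restriction of a colouring. -/
theorem Untwists.sameHits {h : V.Dart} (m : Untwists V W j h) (hV : V.Planar) (b : ι → W.Dart) :
    SameHits V (j ∘ b) W b := by
  refine m.restricts.sameHits hV b fun s hs => ?_
  have : V.hits (j ∘ b) s ∩ {y | V.rot.SameCycle h y} = ∅ := by
    rw [Set.eq_empty_iff_forall_notMem]
    rintro y ⟨⟨φ, hφ, h0, h1⟩, hy⟩
    refine hs ⟨φ ∘ j, m.coloring hφ, fun x => ?_, h1⟩
    by_cases hx : V.rot.SameCycle h (j x)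
    · exact m.restricts.cornerSum_bad _ hx
    · rw [m.cornerSum φ x hx, h0, if_neg fun h' => hx (Equiv.Perm.SameCycle.trans hy h')]
  rw [this, Set.ncard_empty]

theorem ncard_orbit {v : V.Dart} (hv : V.rot (V.rot v) ≠ v) :
    {y | V.rot.SameCycle v y}.ncard = 4 := by
  obtain ⟨n1, n2, n3, n4, n5, n6⟩ := ne_of_crossing hv
  have : {y | V.rot.SameCycle v y} =
      {v, V.rot v, V.rot (V.rot v), V.rot (V.rot (V.rot v))} := by
    ext y
    simp only [Set.mem_ofPred_eq, V.sameCycle_rot, Set.mem_insert_iff, Set.mem_singleton_iff]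
  classical
  rw [this, ← Finset.coe_pair, ← Finset.coe_insert, ← Finset.coe_insert, Set.ncard_coe_finset,
    Finset.card_insert_of_notMem, Finset.card_insert_of_notMem, Finset.card_pair n6.symm]
  · simp [n4.symm, n5.symm]
  · simp [n1.symm, n2.symm, n3.symm]

/-- Either both corners of the bigon are hit, or none. -/
theorem Separates.sameHits {v w : V.Dart} (m : Separates V W j v w) (hV : V.Planar)
    (b : ι → W.Dart) : SameHits V (j ∘ b) W b := by
  classical
  have := V.finite
  refine m.restricts.sameHits hV b fun s _ => ?_
  have two : ∀ a : ZMod 2, a + a = 0 := by decide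
  have hvw : v ∈ V.hits (j ∘ b) s ↔ w ∈ V.hits (j ∘ b) s := by
    constructor
    · rintro ⟨φ, hφ, h0, h1⟩
      obtain ⟨φ', hφ', e, h0'⟩ := m.toggle hφ
      refine ⟨φ', hφ', fun x => ?_, fun i => (congrFun e (b i)).trans (h1 i)⟩
      rw [h0', h0, two, zero_add]
    · rintro ⟨φ, hφ, h0, h1⟩
      obtain ⟨φ', hφ', e, h0'⟩ := m.toggle hφ
      refine ⟨φ', hφ', fun x => ?_, fun i => (congrFun e (b i)).trans (h1 i)⟩
      rw [h0', h0, add_right_comm, two, zero_add]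
  have e : V.hits (j ∘ b) s ∩ {y | V.rot.SameCycle v y ∨ V.rot.SameCycle w y} =
      if v ∈ V.hits (j ∘ b) s then {y | V.rot.SameCycle v y} ∪ {y | V.rot.SameCycle w y} else ∅ := by
    split_ifs with h
    · ext y
      constructor
      · exact fun hy => hy.2
      · rintro (hy | hy)
        · exact ⟨(mem_hits_iff_of_sameCycle hy).1 h, Or.inl hy⟩
        · exact ⟨(mem_hits_iff_of_sameCycle hy).1 (hvw.1 h), Or.inr hy⟩
    · rw [Set.eq_empty_iff_forall_notMem]
      rintro y ⟨h1, hy | hy⟩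
      · exact h ((mem_hits_iff_of_sameCycle hy).2 h1)
      · exact h (hvw.2 ((mem_hits_iff_of_sameCycle hy).2 h1))
  rw [e]
  split_ifs with h
  · rw [Set.ncard_union_eq _ (Set.toFinite _) (Set.toFinite _), ncard_orbit m.cross_v,
      ncard_orbit m.cross_w]
    · rfl
    · rw [Set.disjoint_left]
      exact fun y h1 h2 => m.distinct (Equiv.Perm.SameCycle.trans h1 (Equiv.Perm.SameCycle.symm h2))
  · rw [Set.ncard_empty]

theorem Slides.isNull {j : W.Dart ≃ V.Dart} {x y z : V.Dart} (m : Slides V W j x y z)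
    (ha : ∀ i, a i ∉ V.triangle x y z) (h : V.IsNull a s) :
    W.IsNull (fun i => j.symm (V.slide x y z (a i))) s := by
  obtain ⟨φ, hφ, h0, hs⟩ := h
  obtain ⟨ψ, hψ, e, h1⟩ := m.exists_coloring hφ
  exact ⟨ψ, hψ, fun x => by rw [h1, h0], fun i => by rw [e _ (ha i), hs]⟩

theorem Slides.mem_hits {j : W.Dart ≃ V.Dart} {x y z : V.Dart} (m : Slides V W j x y z)
    (ha : ∀ i, a i ∉ V.triangle x y z) {v : V.Dart} (h : v ∈ V.hits a s) :
    j.symm v ∈ W.hits (fun i => j.symm (V.slide x y z (a i))) s := by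
  obtain ⟨φ, hφ, h0, hs⟩ := h
  obtain ⟨ψ, hψ, e, h1⟩ := m.exists_coloring hφ
  refine ⟨ψ, hψ, fun x => ?_, fun i => by rw [e _ (ha i), hs]⟩
  rw [h1, h0]
  congr 1
  obtain ⟨x, rfl⟩ := j.symm.surjective x
  simp only [sameCycle_rot, m.rot_symm, j.symm.apply_eq_iff_eq, j.apply_symm_apply]

theorem Slides.sameHits {j : W.Dart ≃ V.Dart} {x y z : V.Dart} (m : Slides V W j x y z)
    (ha : ∀ i, a i ∉ V.triangle x y z) :
    SameHits V a W (fun i => j.symm (V.slide x y z (a i))) := by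
  have t := m.isTriangle
  have hb : ∀ i, j.symm (V.slide x y z (a i)) ∉ W.triangle (j.symm (V.rot (V.rot x)))
      (j.symm (V.rot (V.rot y))) (j.symm (V.rot (V.rot z))) := fun i => by
    rw [m.mem_triangle_symm]
    exact t.across_slide_notMem (ha i)
  have hba : (fun i => j.symm.symm (W.slide (j.symm (V.rot (V.rot x)))
      (j.symm (V.rot (V.rot y))) (j.symm (V.rot (V.rot z))) (j.symm (V.slide x y z (a i))))) = a := by
    funext i
    rw [m.slide_symm, t.slide_slide]
    simp
  refine fun s => ⟨⟨m.isNull ha, fun h => ?_⟩, fun _ => ?_⟩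
  · have := m.symm.isNull hb h
    rwa [hba] at this
  · have e : W.hits (fun i => j.symm (V.slide x y z (a i))) s = j.symm '' V.hits a s := by
      ext v
      constructor
      · intro hv
        have := m.symm.mem_hits hb hv
        rw [hba] at this
        exact ⟨_, this, by simp⟩
      · rintro ⟨v, hv, rfl⟩
        exact m.mem_hits ha hv
    rw [e, Set.ncard_image_of_injective _ j.symm.injective]

/-- If there is a puncture in every region, every crossing is the only one that is hit for suitable
colours at the punctures.  Hence some crossing of `W` is hit for these colours, and crossings of `W`
obtained in this way from different crossings of `V` are different. -/
theorem SameHits.card_crossing_le (hS : SameHits V a W b) (hV : V.Planar)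
    (hext : ∀ φ ψ, V.IsColoring φ → V.IsColoring ψ → (∀ i, φ (a i) = ψ (a i)) → φ = ψ) :
    Nat.card V.Crossing ≤ Nat.card W.Crossing := by
  classical
  have := W.finite
  have hex : ∀ v : {v : V.Dart // V.rot (V.rot v) ≠ v}, ∃ φ : V.Dart → ZMod 2, V.IsColoring φ ∧
      ∀ x, V.cornerSum φ x = if V.rot.SameCycle v.1 x then 1 else 0 := by
    rintro ⟨v, hv⟩
    obtain ⟨φ, hφ, e⟩ := hV.2 (fun x => if V.rot.SameCycle v x then 1 else 0)
      (fun x => by simp only [Equiv.Perm.sameCycle_apply_right])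
      (fun x hx => if_neg fun h => hv (aux_of_sameCycle h.symm hx))
    exact ⟨φ, hφ, congrFun e⟩
  choose φ hφ hφ0 using hex
  have hnull : ∀ v, ¬ V.IsNull a (φ v ∘ a) := by
    rintro v ⟨κ, hκ, h0, h1⟩
    have e := h0 v.1
    rw [hext _ _ hκ (hφ v) h1, hφ0, if_pos (Equiv.Perm.SameCycle.refl _ _)] at e
    exact one_ne_zero e
  have hhits : ∀ v, V.hits a (φ v ∘ a) = {y | V.rot.SameCycle v.1 y} := by
    intro v
    ext w
    constructor
    · rintro ⟨κ, hκ, h0, h1⟩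
      have e := h0 w
      rw [hext _ _ hκ (hφ v) h1, hφ0, if_pos (Equiv.Perm.SameCycle.refl _ w)] at e
      by_contra h
      exact zero_ne_one ((if_neg h).symm.trans e)
    · intro hw
      refine (mem_hits_iff_of_sameCycle hw).1 ⟨φ v, hφ v, fun x => ?_, fun i => rfl⟩
      exact (hφ0 v x).trans (by congr)
  have hf : ∀ v, ∃ w, w ∈ W.hits b (φ v ∘ a) := by
    intro v
    by_contra! h
    have h1 := (hS _).2 (hnull v)
    rw [hhits, Set.eq_empty_iff_forall_notMem.2 h, Set.ncard_empty, ncard_orbit v.2] at h1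
    exact absurd h1 (by decide)
  choose f hf using hf
  have hinj : ∀ v w, W.rot.SameCycle (f v) (f w) → V.rot.SameCycle v.1 w.1 := by
    intro v w h
    obtain ⟨ψ, hψ, h0, h1⟩ := (mem_hits_iff_of_sameCycle h).1 (hf v)
    obtain ⟨ψ', hψ', h0', h1'⟩ := hf w
    obtain ⟨κ, hκ, k0, k1⟩ := (hS (φ v ∘ a + φ w ∘ a)).1.2
      ⟨ψ + ψ', W.colorings.add_mem hψ hψ', fun x => by
        rw [cornerSum_add, h0, h0', CharTwo.add_self_eq_zero], fun i => by
        rw [Pi.add_apply, h1, h1', Pi.add_apply]⟩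
    have e := k0 w.1
    rw [hext _ _ hκ (V.colorings.add_mem (hφ v) (hφ w)) k1, cornerSum_add, hφ0, hφ0,
      if_pos (Equiv.Perm.SameCycle.refl _ w.1)] at e
    by_contra hne
    rw [if_neg hne] at e
    exact one_ne_zero ((zero_add _).symm.trans e)
  choose r hr hr' using fun o : V.Crossing => o.2
  refine Nat.card_le_card_of_injective
    (fun o => (⟨Quotient.mk _ (f ⟨r o, hr o⟩), _, crossing_of_mem_hits (hf ⟨r o, hr o⟩), rfl⟩ :
      W.Crossing)) ?_
  intro o o' h
  have h1 := hinj _ _ (Quotient.exact (congrArg Subtype.val h))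
  apply Subtype.ext
  rw [← hr' o, ← hr' o']
  exact Quotient.sound h1

end

end VirtualDiagram

open VirtualDiagram

namespace KnotDiagram

section

variable {D : KnotDiagram} {ι κ : Type}

/-- A colouring is a function of the regions. -/
theorem coloring_eq_of_leftRegion {φ : D.Dart → ZMod 2} (hφ : D.toVirtual.IsColoring φ)
    {x y : D.Dart} (h : D.leftRegion x = D.leftRegion y) : φ x = φ y :=
  congrArg (D.toVirtual.coloringsEquiv ⟨φ, hφ⟩) h

theorem exists_leftRegion (R : D.Region) : ∃ x, D.leftRegion x = R := Quotient.exists_rep R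

end

end KnotDiagram

/-! ### A puncture in every region -/

section

variable {ι : Type} {P Q : PuncturedDiagram ι}

theorem ElementaryMove.exists_sameHits (h : ElementaryMove P Q) :
    ∃ (a : ι → P.diagram.Dart) (b : ι → Q.diagram.Dart),
      (∀ i, P.place i = P.diagram.leftRegion (a i)) ∧
      (∀ i, Q.place i = Q.diagram.leftRegion (b i)) ∧
      SameHits P.diagram.toVirtual a Q.diagram.toVirtual b := by
  cases h with
  | homeo D E p q j h1 h2 h3 h4 =>
    choose b hp hq using h4
    have m : IsIso D.toVirtual E.toVirtual j := ⟨h1, h2, h3⟩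
    exact ⟨j ∘ b, b, hp, hq, m.sameHits D.planar b⟩
  | erase D E p q j k h1 h2 h3 h4 h5 h6 =>
    choose b hp hq using h6
    have m : Erases D.toVirtual E.toVirtual j k := ⟨not_not.1 h1, h2, h3.1, h3.2, h3.3, h4, h5⟩
    exact ⟨j ∘ b, b, hp, hq, m.sameHits D.planar b⟩
  | reidemeister1 D E p q j h h1 h2 h3 h4 h5 h6 =>
    choose b hp hq using h6
    have m : Untwists D.toVirtual E.toVirtual j h := ⟨h1, h2, h3.1, h3.2, h3.3, h4, h5⟩
    exact ⟨j ∘ b, b, hp, hq, m.sameHits D.planar b⟩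
  | reidemeister2 D E p q j v w h1 h2 h3 h4 h5 h6 h7 h8 h9 h10 =>
    choose b hp hq using h10
    have m : Separates D.toVirtual E.toVirtual j v w :=
      ⟨h1, h2, h3, h4, h5, h6, h7.1, h7.2, h7.3, h8, h9⟩
    exact ⟨j ∘ b, b, hp, hq, m.sameHits D.planar b⟩
  | reidemeister3 D E p q j a b c h1 h2 h3 h4 h5 h6 h7 h8 h9 h10 h11 h12 h13 h14 =>
    choose y hy hp hq using h14
    have m : Slides D.toVirtual E.toVirtual j a b c :=
      ⟨h1, h2, h3, h4, h5, h6, h7, h8, h9, h10, h11, h12, h13⟩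
    exact ⟨y, _, hp, hq, m.sameHits hy⟩

/-- Parities of hit crossings are invariant under moves on the punctured sphere, whatever darts are
chosen to describe the regions of the punctures. -/
theorem sameHits_of_eqvGen (h : Relation.EqvGen ElementaryMove P Q) :
    ∀ (a : ι → P.diagram.Dart) (b : ι → Q.diagram.Dart),
      (∀ i, P.place i = P.diagram.leftRegion (a i)) →
      (∀ i, Q.place i = Q.diagram.leftRegion (b i)) →
      SameHits P.diagram.toVirtual a Q.diagram.toVirtual b := by
  have key : ∀ (P : PuncturedDiagram ι) (a a' : ι → P.diagram.Dart),
      (∀ i, P.place i = P.diagram.leftRegion (a i)) →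
      (∀ i, P.place i = P.diagram.leftRegion (a' i)) →
      SameHits P.diagram.toVirtual a P.diagram.toVirtual a' := fun P a a' ha ha' =>
    sameHits_of_eq fun φ hφ i =>
      KnotDiagram.coloring_eq_of_leftRegion hφ ((ha i).symm.trans (ha' i))
  induction h with
  | rel P Q h =>
    intro a b ha hb
    obtain ⟨a', b', ha', hb', e⟩ := h.exists_sameHits
    exact ((key P a a' ha ha').trans e).trans (key Q b' b hb' hb)
  | refl P => exact fun a b => key P a b
  | symm P Q _ ih => exact fun a b ha hb => (ih b a hb ha).symm
  | trans P Q R _ _ ih1 ih2 =>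
    intro a b ha hb
    choose d hd using fun i => KnotDiagram.exists_leftRegion (Q.place i)
    exact (ih1 a d ha fun i => (hd i).symm).trans (ih2 d b (fun i => (hd i).symm) hb)

end

namespace KnotDiagram

section

variable {D : KnotDiagram} {ι κ : Type}

/-- With a puncture in every region, no move sequence decreases the number of crossings. -/
theorem crossings_le_of_surjective {p : ι → D.Region} (hp : Function.Surjective p)
    {E : PuncturedDiagram ι} (h : Relation.EqvGen ElementaryMove ⟨D, p⟩ E) :
    D.crossings ≤ E.diagram.crossings := by
  choose a ha using fun i => exists_leftRegion (p i)
  choose b hb using fun i => exists_leftRegion (E.place i)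
  have hS : SameHits D.toVirtual a E.diagram.toVirtual b :=
    sameHits_of_eqvGen h a b (fun i => (ha i).symm) fun i => (hb i).symm
  refine SameHits.card_crossing_le hS D.planar fun φ ψ hφ hψ h => ?_
  funext g
  obtain ⟨i, hi⟩ := hp (D.leftRegion g)
  have e : D.leftRegion g = D.leftRegion (a i) := by rw [ha, hi]
  exact (coloring_eq_of_leftRegion hφ e).trans ((h i).trans (coloring_eq_of_leftRegion hψ e).symm)

/-! ### Crossing numbers -/

theorem minCrossings_le {p : ι → D.Region} {E : PuncturedDiagram ι}
    (h : Relation.EqvGen ElementaryMove ⟨D, p⟩ E) : D.minCrossings p ≤ E.diagram.crossings :=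
  Nat.sInf_le ⟨E, h, rfl⟩

theorem exists_minCrossings (p : ι → D.Region) : ∃ E : PuncturedDiagram ι,
    Relation.EqvGen ElementaryMove ⟨D, p⟩ E ∧ E.diagram.crossings = D.minCrossings p :=
  Nat.sInf_mem (s := {k | ∃ E : PuncturedDiagram ι,
    Relation.EqvGen ElementaryMove ⟨D, p⟩ E ∧ E.diagram.crossings = k}) ⟨_, _, .refl _, rfl⟩

/-- Forgetting punctures does not increase the crossing number. -/
theorem minCrossings_comp_le (p : ι → D.Region) (f : κ → ι) :
    D.minCrossings (p ∘ f) ≤ D.minCrossings p := by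
  obtain ⟨E, h, e⟩ := exists_minCrossings p
  rw [← e]
  exact minCrossings_le (eqvGen_reindex f h)

theorem minCrossings_le_of_forall {p : ι → D.Region} {q : κ → D.Region} (h : ∀ k, ∃ i, p i = q k) :
    D.minCrossings q ≤ D.minCrossings p := by
  choose f hf using h
  obtain rfl : p ∘ f = q := funext hf
  exact minCrossings_comp_le p f

theorem cOn_mono {S T : Set D.Region} (h : S ⊆ T) : D.cOn S ≤ D.cOn T :=
  minCrossings_le_of_forall fun R => ⟨⟨R.1, h R.2⟩, rfl⟩

theorem cOn_le (S : Set D.Region) : D.cOn S ≤ D.crossings := minCrossings_le (.refl _)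

theorem cOn_univ : D.cOn Set.univ = D.crossings := by
  apply le_antisymm (cOn_le _)
  obtain ⟨E, h, e⟩ := exists_minCrossings (Subtype.val : ↥(Set.univ : Set D.Region) → D.Region)
  rw [cOn, ← e]
  exact crossings_le_of_surjective (fun R => ⟨⟨R, trivial⟩, rfl⟩) h

theorem c_le_cOn (S : Set D.Region) : D.c ≤ D.cOn S :=
  minCrossings_le_of_forall fun k => k.elim

/-- Punctures in the two regions next to an edge do not matter. -/
theorem cOn_of_subset {g : D.Dart} {S : Set D.Region}
    (h : S ⊆ {D.leftRegion g, D.leftRegion (D.flip g)}) : D.cOn S = D.c := by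
  refine le_antisymm ?_ (c_le_cOn S)
  have h1 : D.cOn S ≤ D.minCrossings (D.sides g) := by
    refine minCrossings_le_of_forall fun R => ?_
    rcases h R.2 with e | e
    · exact ⟨true, e.symm⟩
    · exact ⟨false, e.symm⟩
  refine h1.trans ?_
  obtain ⟨E, h, e⟩ := exists_minCrossings (Empty.elim : Empty → D.Region)
  rw [c, ← e]
  obtain ⟨y⟩ := E.diagram.nonempty
  rcases linked_of_eqvGen h g y with ⟨_, _, l⟩ | ⟨_, _, l⟩ <;>
  exact minCrossings_le l

theorem leftRegion_flip_ne (g : D.Dart) : D.leftRegion g ≠ D.leftRegion (D.flip g) := by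
  intro h
  obtain ⟨χ, hχ, h1⟩ := D.planar.1
  have h2 := coloring_eq_of_leftRegion hχ h
  have h3 : χ (D.flip g) = χ g + 1 := h1 g
  rw [h3] at h2
  have : ∀ a : ZMod 2, a ≠ a + 1 := by decide
  exact this _ h2

instance : Finite D.Region :=
  have := D.finite
  inferInstanceAs (Finite (Quotient _))

theorem exists_ncard {n : ℕ} (h : n ≤ Nat.card D.Region) : ∃ S : Set D.Region, S.ncard = n := by
  rw [← Set.ncard_univ] at h
  obtain ⟨S, -, hS⟩ := Set.exists_subset_card_eq h
  exact ⟨S, hS⟩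

theorem cOn_le_cMax (S : Set D.Region) : D.cOn S ≤ D.cMax S.ncard :=
  le_csSup ⟨D.crossings, by rintro _ ⟨T, -, rfl⟩; exact cOn_le T⟩ ⟨S, rfl, rfl⟩

theorem cMin_le_cOn (S : Set D.Region) : D.cMin S.ncard ≤ D.cOn S := Nat.sInf_le ⟨S, rfl, rfl⟩

theorem exists_cMax {n : ℕ} (h : n ≤ Nat.card D.Region) :
    ∃ S : Set D.Region, S.ncard = n ∧ D.cOn S = D.cMax n := by
  obtain ⟨S, hS⟩ := exists_ncard h
  exact Nat.sSup_mem (s := {k | ∃ S : Set D.Region, S.ncard = n ∧ D.cOn S = k}) ⟨_, S, hS, rfl⟩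
    ⟨D.crossings, by rintro _ ⟨T, -, rfl⟩; exact cOn_le T⟩

theorem exists_cMin {n : ℕ} (h : n ≤ Nat.card D.Region) :
    ∃ S : Set D.Region, S.ncard = n ∧ D.cOn S = D.cMin n := by
  obtain ⟨S, hS⟩ := exists_ncard h
  exact Nat.sInf_mem (s := {k | ∃ S : Set D.Region, S.ncard = n ∧ D.cOn S = k}) ⟨_, S, hS, rfl⟩

theorem cMax_eq {n k : ℕ} (h : n ≤ Nat.card D.Region)
    (hk : ∀ S : Set D.Region, S.ncard = n → D.cOn S = k) : D.cMax n = k := by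
  obtain ⟨S, hS, e⟩ := exists_cMax h
  rw [← e, hk S hS]

theorem cMin_eq {n k : ℕ} (h : n ≤ Nat.card D.Region)
    (hk : ∀ S : Set D.Region, S.ncard = n → D.cOn S = k) : D.cMin n = k := by
  obtain ⟨S, hS, e⟩ := exists_cMin h
  rw [← e, hk S hS]

theorem cMax_le_succ {n : ℕ} (h : n < Nat.card D.Region) : D.cMax n ≤ D.cMax (n + 1) := by
  obtain ⟨S, rfl, e⟩ := exists_cMax h.le
  obtain ⟨R, hR⟩ : ∃ R, R ∉ S := by
    by_contra! h'
    rw [Set.eq_univ_of_forall h', Set.ncard_univ] at h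
    exact lt_irrefl _ h
  rw [← e, ← Set.ncard_insert_of_notMem hR]
  exact (cOn_mono (Set.subset_insert R S)).trans (cOn_le_cMax _)

theorem cMin_le_succ {n : ℕ} (h : n < Nat.card D.Region) : D.cMin n ≤ D.cMin (n + 1) := by
  obtain ⟨S, hS, e⟩ := exists_cMin h
  obtain ⟨T, hTS, rfl⟩ := Set.exists_subset_card_eq (show n ≤ S.ncard by omega)
  rw [← e]
  exact (cMin_le_cOn T).trans (cOn_mono hTS)

theorem cMin_le_cMax {n : ℕ} (h : n ≤ Nat.card D.Region) : D.cMin n ≤ D.cMax n := by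
  obtain ⟨S, rfl⟩ := exists_ncard h
  exact (cMin_le_cOn S).trans (cOn_le_cMax S)

theorem cOn_empty : D.cOn ∅ = D.c := by
  obtain ⟨g⟩ := D.nonempty
  exact cOn_of_subset (g := g) (Set.empty_subset _)

theorem cOn_singleton (R : D.Region) : D.cOn {R} = D.c := by
  obtain ⟨g, rfl⟩ := exists_leftRegion R
  exact cOn_of_subset (g := g) (by simp)

theorem cMin_two : D.cMin 2 = D.c := by
  obtain ⟨g⟩ := D.nonempty
  refine le_antisymm ?_ ?_
  · have := cMin_le_cOn {D.leftRegion g, D.leftRegion (D.flip g)}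
    rwa [Set.ncard_pair (leftRegion_flip_ne g), cOn_of_subset subset_rfl] at this
  · obtain ⟨S, -, e⟩ := exists_cMin (D := D) (n := 2) (by rw [D.card_region]; omega)
    rw [← e]
    exact c_le_cOn S

end

end KnotDiagram

open KnotDiagram in
theorem proposition1p5 (D : KnotDiagram) (m : ℕ) (hm : D.crossings = m) :
    Nat.card D.Region = m + 2 ∧
    (∀ n, n < m + 2 → D.cMax n ≤ D.cMax (n + 1)) ∧
    (∀ n, n < m + 2 → D.cMin n ≤ D.cMin (n + 1)) ∧
    (∀ n, n ≤ m + 2 → D.cMin n ≤ D.cMax n) ∧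
    D.cMax 0 = D.cMax 1 ∧
    D.cMin 0 = D.cMin 1 ∧
    D.cMin 1 = D.cMin 2 ∧
    D.cMax 0 = D.c ∧
    D.cMin 0 = D.c ∧
    D.cMax (m + 2) = D.crossings ∧
    D.cMin (m + 2) = D.crossings := by
  have hN : Nat.card D.Region = m + 2 := by rw [D.card_region, hm]
  have h0 : ∀ S : Set D.Region, S.ncard = 0 → D.cOn S = D.c := fun S hS => by
    rw [(Set.ncard_eq_zero (Set.toFinite S)).1 hS, cOn_empty]
  have h1 : ∀ S : Set D.Region, S.ncard = 1 → D.cOn S = D.c := fun S hS => by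
    obtain ⟨R, rfl⟩ := Set.ncard_eq_one.1 hS
    exact cOn_singleton R
  have hall : ∀ S : Set D.Region, S.ncard = m + 2 → D.cOn S = D.crossings := fun S hS => by
    have : S = Set.univ :=
      Set.eq_of_subset_of_ncard_le (Set.subset_univ S) (by rw [Set.ncard_univ, hN, hS])
    rw [this, cOn_univ]
  have a0 : D.cMax 0 = D.c := cMax_eq (by omega) h0
  have a1 : D.cMax 1 = D.c := cMax_eq (by omega) h1
  have b0 : D.cMin 0 = D.c := cMin_eq (by omega) h0
  have b1 : D.cMin 1 = D.c := cMin_eq (by omega) h1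
  refine ⟨hN, fun n hn => cMax_le_succ (hN ▸ hn), fun n hn => cMin_le_succ (hN ▸ hn),
    fun n hn => cMin_le_cMax (hN ▸ hn), a0.trans a1.symm, b0.trans b1.symm, b1.trans cMin_two.symm,
    a0, b0, cMax_eq hN.ge hall, cMin_eq hN.ge hall⟩
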